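/- **Conventions.** $[x,y]=x^{-1}y^{-1}xy$ and $x^y=y^{-1}xy$. If a group $G$ is normally generated by $a_1,\dots,a_m$, its reduced group $\mathrm RG$ is the quotient of $G$ by all commutators $[a_j,a_j^g]$ ($g\in G$). $\Sigma=\Sigma_1\sqcup\cdots\sqcup\Sigma_n$ is a disjoint union of $n$ oriented 2-spheres. **Cut-diagrams.** Let $P\subset\Sigma$ be a compact oriented generically immersed 1-manifold, with over/under information at each double point, which splits $P$ into *cut arcs*; the components of $\Sigma\setminus P$ are the *regions*. Each end point of $P$ is of type $\bullet$ or $\circ$, and has sign $+$ (resp. $-$) if its arc is oriented outwards (resp. inwards). A *cut-diagram* $\mathcal C$ over $\Sigma$ (up to isotopy of $\Sigma$) is such a $P$ with a labeling of the cut arcs by regions such that: (1) at a crossing with over-arc labeled $C$ and under-arcs labeled $A$ (on the left of the over-arc) and $B$ (on its right), the regions $A$ (on the left) and $B$ (on the right) are adjacent along a $C$-labeled cut arc; (2) an arc that ends at a $\bullet$ in a region $A$ is labeled by $A$; (3) the $\circ$ on each $\Sigma_j$ are partitioned into pairs $\{p_1,p_2\}$ of equal sign such that, if $p_1$ lies in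 $X$ with incident arc labeled by $Y$, then $p_2$ lies in $Y$ with incident arc labeled by $X$ (an *$(X,Y)$-pair*). **Self-singular equivalence** is the equivalence relation generated by isotopy and the following moves, each of which takes place in supporting disks and is allowed if the labeling rules hold before and after. No arc is labeled by a region contained in the supporting disks; when regions merge or split, labels elsewhere change accordingly, a label that splits becoming any of its parts. An arc (strand) named once below, or whose ends outside the disk persist through the move, keeps one and the same label. *Topological moves:* an arc joining two $\bullet$ appears in a disk free of $P$; a circle appears in such a disk; a kink appears on a strand; a saddle move between two antiparallel strands with the same label; an end point $\bullet$ passes under a strand; a strand passes under another one, creating two crossings; the Reidemeister-3 move. *Self-singular moves* ($X,Y$ regions of one component): a crossing change between two strands labeled $X$ and $Y$, if there is an $(X,Y)$-pair; the two points of a pair, lying on the same side of two strands with the same label and orientation, pass simultaneously to the other side, one of them by retracting its arc, which passed under the strand, and the other one by extending its arc under the strand; an $Y$-labeled strand is cut open at two $\circ$, which are paired with the two end points $\circ$ of a new arc in the region $Y$; an end point $\bullet$ in a region $A$ is replaced by a $\circ$, paired with the $\circ$ of a new small arc in $A$ that joins it to a $\bullet$. **Groups.** $G(\mathcal C)$ is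 generated by the regions, with a relation $B=C^{-1}AC$ whenever $A$ (on the left) and $B$ (on the right) are adjacent along a $C$-labeled cut arc. A generic path $\gamma$ in $\Sigma$ defines $w_\gamma=A_1^{\varepsilon_1}\cdots A_m^{\varepsilon_m}\in G(\mathcal C)$, where $A_k$ is the label of the $k$-th arc it crosses and $\varepsilon_k=+1$ if it is crossed from left to right, $-1$ otherwise. A *basing* is a choice of a region $R_j$ of $\Sigma_j$ for each $j$. Reducing with respect to $R_1,\dots,R_n$ gives $\mathrm RG(\mathcal C)$, and $\mathrm RG(\mathcal C)_i$ is its quotient by the normal subgroup generated by the regions of $\Sigma_i$. Let $\mathrm RF^i$ be the reduced free group on the $x_j$, $j\neq i$. **Magnus expansion.** $\Lambda_i$ is the quotient of the ring of power series over $\mathbb Z$ in non-commuting variables $X_j$ ($j\ne i$) by the ideal of monomials that contain a variable twice, and $E_i:\mathrm RF^i\to\Lambda_i$, $x_j\mapsto 1+X_j$, extends linearly to $\mathbb Z\mathrm RF^i$. For $W\in\Lambda_i$ and a non-repeated sequence $I$ in $\{1,\dots,n\}\setminus\{i\}$, let $\kappa_W(I)$ be the coefficient of $X_I$ in $W$,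 and $D_W(I)$ the greatest common divisor of the $\kappa_W(J)$ over the *non-empty* proper subsequences $J$ of $I$ ($0$ if there is none). An element $x$ of $\mathrm RF^i$ is *positive* if $x=1$ or if the first non-zero non-constant term of $E_i(x)$, monomials being ordered by degree and then lexicographically in the indices, has a positive coefficient. **Invariants.** Fix $i$, a basing of $\mathcal C$, and paths in $\Sigma_i$ from a base point in $R_i$ to all $\circ$ of $\Sigma_i$. Let $\phi:\mathrm RG(\mathcal C)_i\to\mathrm RF^i$ be the isomorphism with $\phi(R_j)=x_j$, and call $g$ positive if $\phi(g)$ is. For a pair $\{p_1,p_2\}$ on $\Sigma_i$ with sign $\varepsilon(p_1,p_2)$ and chosen paths $\alpha_1,\alpha_2$, let $w_{p_1,p_2}\in \mathrm RG(\mathcal C)_i$ be $w_{\alpha_1}w_{\alpha_2}^{-1}$ if this is positive, and $w_{\alpha_2}w_{\alpha_1}^{-1}$ otherwise. Put $$S_i(\mathcal C)=\sum_{\{p_1,p_2\}}\varepsilon(p_1,p_2)\,(\phi(w_{p_1,p_2})-1),\qquad \rho_{\mathcal C}(g)=\sum_{\{p_1,p_2\}:\,w_{p_1,p_2}=g}\varepsilon(p_1,p_2).$$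 Let $\widetilde\kappa_{\mathcal C}(I;i)$ be the residue class of $\kappa_W(I)$ modulo $D_W(I)$ for $W=E_i(S_i(\mathcal C))$, and $\widetilde\kappa_{\mathcal C}(I;g)$ the one for $W=E_i(\phi(g))$. **Theorem.** For every cut-diagram $\mathcal C$ over $\Sigma$, every basing and every $i$, the homomorphism $\mathrm RF^i\to\mathrm RG(\mathcal C)_i$, $x_j\mapsto R_j$, is bijective (so that $\phi$ is defined). If $\mathcal C$ and $\mathcal C'$ are self-singular equivalent, then, for any choices of basings and of paths for $\mathcal C$ and for $\mathcal C'$: 1. $\widetilde\kappa_{\mathcal C}(I;i)=\widetilde\kappa_{\mathcal C'}(I;i)$ for every non-repeated sequence $I$ in $\{1,\dots,n\}\setminus\{i\}$; 2. the multiset $\mathcal K_i(\mathcal C)=\{(\rho_{\mathcal C}(g),\sum_I\widetilde\kappa_{\mathcal C}(I;g)X_I)\mid g\in\mathrm RG(\mathcal C)_i \text{ positive},\ g\ne1,\ \rho_{\mathcal C}(g)\neq0\}$ is equal to $\mathcal K_i(\mathcal C')$. -/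

import Mathlib

/-!
# Cut-diagrams over unions of 2-spheres and their higher order Kirk invariants

A generic diagram on the `j`-th sphere avoids a point "at infinity", hence lies in an oriented
plane, and is read from bottom to top along a generic height function.  It is thus recorded
by a finite list of elementary pieces (local minimum, local maximum, crossing, end point), each
placed at some position among the strands that are present at that height.  Isotopies of the
sphere become explicit elementary moves (`Isotopy` and `Sweep` below), which are part of the
equivalence relation.  In the planar picture the orientation of the sphere is the
counterclockwise one, so the left side of a strand oriented upwards is its left side on the page.
-/

open scoped Classical

namespace CutDiag

noncomputable section

/-! ## Reduced groups -/

/-- The commutators `[a_j, a_j ^ g]`, with `[x, y] = x⁻¹ y⁻¹ x y` and `x ^ y = y⁻¹ x y`. -/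
def reducedRelators {ι G : Type*} [Group G] (a : ι → G) : Set G :=
  {x | ∃ (j : ι) (g : G), x = (a j)⁻¹ * (g⁻¹ * a j * g)⁻¹ * a j * (g⁻¹ * a j * g)}

/-- The reduced group of `G` with respect to the (normal) generators `a_j`. -/
abbrev ReducedGroup {ι G : Type*} [Group G] (a : ι → G) : Type _ :=
  G ⧸ Subgroup.normalClosure (reducedRelators a)

/-- The reduced free group on the generators `x_j`, `j : ι`. -/
abbrev ReducedFreeGroup (ι : Type*) : Type _ :=
  ReducedGroup (FreeGroup.of : ι → FreeGroup ι)

/-- If `b_j` satisfies `[b_j, b_j ^ g] = 1` for all `j` and `g`, then `x_j ↦ b_j` defines a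
homomorphism on the reduced free group. -/
def reducedLift {ι H : Type*} [Group H] (b : ι → H)
    (hb : ∀ j (g : H), (b j)⁻¹ * (g⁻¹ * b j * g)⁻¹ * b j * (g⁻¹ * b j * g) = 1) :
    ReducedFreeGroup ι →* H :=
  QuotientGroup.lift _ (FreeGroup.lift b) (by
    refine Subgroup.normalClosure_le_normal ?_
    rintro x ⟨j, g, rfl⟩
    simpa using hb j (FreeGroup.lift b g))

/-! ## The ring `Λ` and the reduced Magnus expansion -/

/-- Non-repeated sequences of indices. -/
abbrev NRSeq (ι : Type*) : Type _ := {l : List ι // l.Nodup}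

namespace NRSeq

variable {ι : Type*}

def take (k : ℕ) (l : NRSeq ι) : NRSeq ι := ⟨l.1.take k, l.2.sublist (List.take_sublist k l.1)⟩

def drop (k : ℕ) (l : NRSeq ι) : NRSeq ι := ⟨l.1.drop k, l.2.sublist (List.drop_sublist k l.1)⟩

end NRSeq

/-- The quotient of the ring of formal power series over `ℤ` in non-commuting variables `X_j`,
`j : ι`, by the ideal generated by the monomials that contain a variable twice.  An element is
given by its coefficients on the monomials `X_I`, for `I` a non-repeated sequence. -/
def Lam (ι : Type*) : Type _ := NRSeq ι → ℤ

namespace Lam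

variable {ι : Type*}

/-- The coefficient of `X_I`. -/
def coeff (W : Lam ι) (I : NRSeq ι) : ℤ := W I

@[ext] theorem ext {f g : Lam ι} (h : ∀ I, f.coeff I = g.coeff I) : f = g := funext h

instance : AddCommGroup (Lam ι) := inferInstanceAs (AddCommGroup (NRSeq ι → ℤ))

/-- The coefficient of `X_I` in a product is the sum over all ways of writing `I = I₁ I₂`. -/
instance : Mul (Lam ι) :=
  ⟨fun f g I => ∑ k ∈ Finset.range (I.1.length + 1), f (I.take k) * g (I.drop k)⟩

instance : One (Lam ι) := ⟨fun I => if I.1 = [] then 1 else 0⟩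

theorem mul_coeff (f g : Lam ι) (I : NRSeq ι) : (f * g).coeff I =
    ∑ k ∈ Finset.range (I.1.length + 1), f.coeff (I.take k) * g.coeff (I.drop k) := rfl

theorem one_coeff (I : NRSeq ι) : (1 : Lam ι).coeff I = if I.1 = [] then 1 else 0 := rfl

theorem add_coeff (f g : Lam ι) (I : NRSeq ι) : (f + g).coeff I = f.coeff I + g.coeff I := rfl

theorem zero_coeff (I : NRSeq ι) : (0 : Lam ι).coeff I = 0 := rfl

theorem neg_coeff (f : Lam ι) (I : NRSeq ι) : (-f).coeff I = -f.coeff I := rfl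

theorem mul_assoc' (f g h : Lam ι) : f * g * h = f * (g * h) := by
  ext I
  have lt : ∀ k, (I.take k).1.length = min k I.1.length := fun k => by simp [NRSeq.take]
  have ld : ∀ k, (I.drop k).1.length = I.1.length - k := fun k => by simp [NRSeq.drop]
  simp only [mul_coeff, Finset.sum_mul, Finset.mul_sum, lt, ld]
  rw [Finset.sum_sigma', Finset.sum_sigma']
  refine Finset.sum_bij' (fun x _ => ⟨x.2, x.1 - x.2⟩) (fun x _ => ⟨x.1 + x.2, x.1⟩) ?_ ?_ ?_ ?_ ?_
  · rintro ⟨k, m⟩ hx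
    simp only [Finset.mem_sigma, Finset.mem_range] at hx ⊢
    omega
  · rintro ⟨k, m⟩ hx
    simp only [Finset.mem_sigma, Finset.mem_range] at hx ⊢
    omega
  · rintro ⟨k, m⟩ hx
    simp only [Finset.mem_sigma, Finset.mem_range] at hx
    have : m + (k - m) = k := by omega
    simp [this]
  · rintro ⟨k, m⟩ hx
    simp
  · rintro ⟨k, m⟩ hx
    simp only [Finset.mem_sigma, Finset.mem_range] at hx
    have e1 : (I.take k).take m = I.take m := by
      apply Subtype.ext
      simp only [NRSeq.take, List.take_take]
      rw [min_eq_left (by omega)]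
    have e2 : (I.take k).drop m = (I.drop m).take (k - m) := by
      apply Subtype.ext; simp [NRSeq.take, NRSeq.drop, List.drop_take]
    have e3 : I.drop k = (I.drop m).drop (k - m) := by
      apply Subtype.ext; simp [NRSeq.drop, List.drop_drop]; congr 1; omega
    simp only [e1, e2, e3]
    ring

theorem one_mul' (f : Lam ι) : 1 * f = f := by
  ext I
  rw [mul_coeff, Finset.sum_eq_single 0]
  · have : I.drop 0 = I := by apply Subtype.ext; simp [NRSeq.drop]
    rw [this]; simp [one_coeff, NRSeq.take]
  · intro k hk h0
    have : (I.take k).1 ≠ [] := by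
      simp only [Finset.mem_range] at hk
      intro h
      have := congrArg List.length h
      simp only [NRSeq.take, List.length_take, List.length_nil] at this
      omega
    simp [one_coeff, this]
  · simp

theorem mul_one' (f : Lam ι) : f * 1 = f := by
  ext I
  rw [mul_coeff, Finset.sum_eq_single I.1.length]
  · have : I.take I.1.length = I := by apply Subtype.ext; simp [NRSeq.take]
    rw [this]; simp [one_coeff, NRSeq.drop]
  · intro k hk h0
    have : (I.drop k).1 ≠ [] := by
      simp only [Finset.mem_range] at hk
      intro h
      have := congrArg List.length h
      simp only [NRSeq.drop, List.length_drop, List.length_nil] at this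
      omega
    simp [one_coeff, this]
  · simp

instance : Ring (Lam ι) :=
  { (inferInstance : AddCommGroup (Lam ι)), (inferInstance : Mul (Lam ι)),
    (inferInstance : One (Lam ι)) with
    mul_assoc := mul_assoc'
    one_mul := one_mul'
    mul_one := mul_one'
    left_distrib := fun f g h => by
      ext I; simp [mul_coeff, add_coeff, mul_add, Finset.sum_add_distrib]
    right_distrib := fun f g h => by
      ext I; simp [mul_coeff, add_coeff, add_mul, Finset.sum_add_distrib]
    zero_mul := fun f => by ext I; simp [mul_coeff, zero_coeff]
    mul_zero := fun f => by ext I; simp [mul_coeff, zero_coeff] }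

/-- The variable `X_j`. -/
def X (j : ι) : Lam ι := fun I => if I.1 = [j] then 1 else 0

theorem X_coeff (j : ι) (I : NRSeq ι) : (X j).coeff I = if I.1 = [j] then 1 else 0 := rfl

theorem X_mul_mul_X (j : ι) (f : Lam ι) : X j * f * X j = 0 := by
  ext I
  rw [mul_coeff, zero_coeff]
  refine Finset.sum_eq_zero fun k _ => ?_
  rw [mul_coeff, Finset.sum_mul]
  refine Finset.sum_eq_zero fun m _ => ?_
  simp only [X_coeff]
  split_ifs with h1 h2 <;> simp
  exfalso
  have hnd := I.2
  rw [← List.take_append_drop k I.1, List.nodup_append] at hnd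
  have m1 : j ∈ I.1.take k := by
    have : j ∈ ((I.take k).take m).1 := by rw [h1]; simp
    exact List.mem_of_mem_take this
  have m2 : j ∈ I.1.drop k := by
    have : j ∈ (I.drop k).1 := by rw [h2]; simp
    exact this
  exact hnd.2.2 j m1 j m2 rfl

theorem X_mul_X (j : ι) : X j * X j = 0 := by
  have := X_mul_mul_X j 1
  rwa [mul_one] at this

/-- The unit `1 + X_j`, with inverse `1 - X_j`. -/
def unitX (j : ι) : (Lam ι)ˣ where
  val := 1 + X j
  inv := 1 - X j
  val_inv := by
    have h := X_mul_X j
    simp only [add_mul, mul_sub, one_mul, mul_one, h]; abel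
  inv_val := by
    have h := X_mul_X j
    simp only [sub_mul, mul_add, one_mul, mul_one, h]; abel

theorem unitX_relator (j : ι) (g : (Lam ι)ˣ) :
    (unitX j)⁻¹ * (g⁻¹ * unitX j * g)⁻¹ * unitX j * (g⁻¹ * unitX j * g) = 1 := by
  suffices h : unitX j * (g⁻¹ * unitX j * g) = (g⁻¹ * unitX j * g) * unitX j by
    rw [mul_assoc, mul_assoc, h]; group
  apply Units.ext
  have e : ((g⁻¹ * unitX j * g : (Lam ι)ˣ) : Lam ι) = 1 + (g⁻¹ : (Lam ι)ˣ) * X j * g := by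
    simp [unitX, mul_add, add_mul]
  have h1 : X j * ((g⁻¹ : (Lam ι)ˣ) * X j * g) = 0 := by
    rw [← mul_assoc, ← mul_assoc, X_mul_mul_X, zero_mul]
  have h2 : ((g⁻¹ : (Lam ι)ˣ) * X j * g) * X j = 0 := by
    rw [mul_assoc, mul_assoc, ← mul_assoc (X j), X_mul_mul_X, mul_zero]
  rw [Units.val_mul, Units.val_mul _ (unitX j), e]
  simp only [unitX, add_mul, mul_add, one_mul, mul_one, h1, h2]
  abel

/-- `D_W(I)`: the greatest common divisor of the coefficients of `W` on the proper
(non-empty) subsequences of `I`. -/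
def D (W : Lam ι) (I : NRSeq ι) : ℤ :=
  (I.1.sublists.toFinset.filter (fun J => J ≠ I.1 ∧ J ≠ [])).gcd
    (fun J => if h : J.Nodup then W.coeff ⟨J, h⟩ else 0)

/-- The residue class of the coefficient of `X_I` in `W` modulo `D_W(I)`, as a subset of `ℤ`. -/
def residue (W : Lam ι) (I : NRSeq ι) : Set ℤ := {z | W.D I ∣ z - W.coeff I}

end Lam

section Magnus

variable {ι : Type*}

/-- The reduced Magnus expansion `x_j ↦ 1 + X_j`, as a homomorphism into the units of `Λ`. -/
def magnusUnits (ι : Type*) : ReducedFreeGroup ι →* (Lam ι)ˣ :=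
  reducedLift Lam.unitX Lam.unitX_relator

/-- The reduced Magnus expansion. -/
def magnus (ι : Type*) : ReducedFreeGroup ι →* Lam ι :=
  (Units.coeHom (Lam ι)).comp (magnusUnits ι)

/-- The linear extension of the reduced Magnus expansion to the group ring. -/
def magnusRing (ι : Type*) : MonoidAlgebra ℤ (ReducedFreeGroup ι) →ₐ[ℤ] Lam ι :=
  MonoidAlgebra.lift ℤ (Lam ι) (ReducedFreeGroup ι) (magnus ι)

/-- The order on monomials: by degree, then lexicographically in the indices. -/
def monomialLT [LT ι] (J I : NRSeq ι) : Prop :=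
  J.1.length < I.1.length ∨ (J.1.length = I.1.length ∧ J.1 < I.1)

/-- An element of the reduced free group is positive if it is trivial, or if the first non-zero
term of non-zero degree of its reduced Magnus expansion has a positive coefficient. -/
def IsPositive [LT ι] (x : ReducedFreeGroup ι) : Prop :=
  x = 1 ∨ ∃ I : NRSeq ι, I.1 ≠ [] ∧ 0 < (magnus ι x).coeff I ∧
    ∀ J : NRSeq ι, J.1 ≠ [] → monomialLT J I → (magnus ι x).coeff J = 0

end Magnus

/-! ## Planar words -/

/-- The two types of end points. -/
inductive Color
  | black
  | white

/-- The elementary pieces of a diagram, read from bottom to top.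
`cross true` is the crossing whose over-strand goes from bottom left to top right;
`cross false` is the one whose over-strand goes from bottom right to top left.
`birth c` is an end point whose strand leaves it upwards, `death c` one whose strand
leaves it downwards. -/
inductive Piece
  | cup
  | cap
  | cross (b : Bool)
  | birth (c : Color)
  | death (c : Color)

/-- The number of strands entering a piece from below. -/
def Piece.bot : Piece → ℕ
  | cup => 0
  | cap => 2
  | cross _ => 2
  | birth _ => 0
  | death _ => 1

/-- The number of strands leaving a piece at its top. -/
def Piece.top : Piece → ℕ
  | cup => 2
  | cap => 0
  | cross _ => 2
  | birth _ => 1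
  | death _ => 0

/-- A piece together with the number `pos` of strands to its left. -/
structure Slice where
  pos : ℕ
  piece : Piece

/-- The number of strands at level `t`, that is, after the first `t` slices. -/
def width (w : List Slice) (t : ℕ) : ℕ :=
  (w.take t).foldl (fun m s => m - s.piece.bot + s.piece.top) 0

/-- The gaps `(j, t, g)` between strands: on the `j`-th sphere, at level `t`, to the right of
exactly `g` strands. -/
def Gap {n : ℕ} (W : Fin n → List Slice) : Type :=
  {x : Fin n × ℕ × ℕ // x.2.1 ≤ (W x.1).length ∧ x.2.2 ≤ width (W x.1) x.2.1}

/-- Two gaps at consecutive levels that touch each other. -/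
def Gap.Touch {n : ℕ} {W : Fin n → List Slice} (x y : Gap W) : Prop :=
  x.1.1 = y.1.1 ∧ y.1.2.1 = x.1.2.1 + 1 ∧
    ∃ s : Slice, (W x.1.1)[x.1.2.1]? = some s ∧
      ((x.1.2.2 = y.1.2.2 ∧ x.1.2.2 ≤ s.pos) ∨
        (s.pos + s.piece.bot ≤ x.1.2.2 ∧ s.pos + s.piece.top ≤ y.1.2.2 ∧
          x.1.2.2 + s.piece.top = y.1.2.2 + s.piece.bot))

/-- The regions: the connected components of the complement of the diagram. -/
def Region {n : ℕ} (W : Fin n → List Slice) : Type := Quot (Gap.Touch (W := W))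

/-- The sphere that contains a given region. -/
def Region.comp {n : ℕ} {W : Fin n → List Slice} : Region W → Fin n :=
  Quot.lift (fun x => x.1.1) (fun _ _ h => h.1)

/-- The region of the gap `(j, t, g)`.  (Arguments out of range are truncated to the range.) -/
def region {n : ℕ} (W : Fin n → List Slice) (j : Fin n) (t g : ℕ) : Region W :=
  Quot.mk _ ⟨(j, min t (W j).length, min g (width (W j) (min t (W j).length))),
    min_le_right _ _, min_le_right _ _⟩

/-! ## Cut-diagrams -/

/-- The data of a cut-diagram over `n` spheres.  The strand `(j, t, p)` is the one at level `t` of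
the `j`-th sphere with exactly `p` strands to its left; only the values at strands
with `p < width (word j) t` are relevant.
`up` tells if the strand is oriented upwards; `label` is its label; `pair` gives, for an
end point `∘` that is the `t`-th slice of the `j`-th sphere, the slice of the `∘` that it is
paired with. -/
structure CutData (n : ℕ) where
  word : Fin n → List Slice
  up : Fin n → ℕ → ℕ → Bool
  label : Fin n → ℕ → ℕ → Region word
  pair : Fin n → ℕ → ℕ

namespace CutData

variable {n : ℕ} (C : CutData n)

/-- The region of a gap. -/
def reg (j : Fin n) (t g : ℕ) : Region C.word := region C.word j t g

/-- There is a strand `(j, t, p)`. -/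
def IsStrand (j : Fin n) (t p : ℕ) : Prop := p < width (C.word j) t

/-- The region on the left of a strand, with respect to its orientation. -/
def leftReg (j : Fin n) (t p : ℕ) : Region C.word :=
  if C.up j t p then C.reg j t p else C.reg j t (p + 1)

/-- The region on the right of a strand, with respect to its orientation. -/
def rightReg (j : Fin n) (t p : ℕ) : Region C.word :=
  if C.up j t p then C.reg j t (p + 1) else C.reg j t p

/-- The regions `A` (on the left) and `B` (on the right) are adjacent along a cut arc that is
labeled by `L`. -/
def Adjacent (A B L : Region C.word) : Prop :=
  ∃ j t p, C.IsStrand j t p ∧ C.label j t p = L ∧ C.leftReg j t p = A ∧ C.rightReg j t p = B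

/-- Two strands have the same orientation and the same label. -/
def SameStrand (j : Fin n) (t p t' p' : ℕ) : Prop :=
  C.up j t p = C.up j t' p' ∧ C.label j t p = C.label j t' p'

/-- The `t`-th slice of the `j`-th sphere is an end point of colour `c` that lies in the region
`A`, with incident cut arc labeled by `L`, and with sign `ε` (`true` if the
incident cut arc is oriented outwards). -/
inductive Tip (c : Color) (j : Fin n) (t : ℕ) : Region C.word → Region C.word → Bool → Prop
  | birth (k : ℕ) : (C.word j)[t]? = some ⟨k, .birth c⟩ →
      Tip c j t (C.reg j t k) (C.label j (t + 1) k) (C.up j (t + 1) k)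
  | death (k : ℕ) : (C.word j)[t]? = some ⟨k, .death c⟩ →
      Tip c j t (C.reg j (t + 1) k) (C.label j t k) (!C.up j t k)

/-- Orientations and labels are constant along the cut arcs, and the first labeling rule holds:
in each crossing, the under-arc on the left and the under-arc on the right of the over-strand
are labeled by two regions that are adjacent, in this order, along a cut arc with the
same label as the over-strand. -/
def PieceRule (j : Fin n) (t k : ℕ) : Piece → Prop
  | .cup => C.up j (t + 1) k ≠ C.up j (t + 1) (k + 1) ∧
      C.label j (t + 1) k = C.label j (t + 1) (k + 1)
  | .cap => C.up j t k ≠ C.up j t (k + 1) ∧ C.label j t k = C.label j t (k + 1)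
  | .cross true => C.SameStrand j t k (t + 1) (k + 1) ∧
      C.up j t (k + 1) = C.up j (t + 1) k ∧
      if C.up j t k then C.Adjacent (C.label j (t + 1) k) (C.label j t (k + 1)) (C.label j t k)
      else C.Adjacent (C.label j t (k + 1)) (C.label j (t + 1) k) (C.label j t k)
  | .cross false => C.SameStrand j t (k + 1) (t + 1) k ∧
      C.up j t k = C.up j (t + 1) (k + 1) ∧
      if C.up j t (k + 1) then
        C.Adjacent (C.label j t k) (C.label j (t + 1) (k + 1)) (C.label j t (k + 1))
      else C.Adjacent (C.label j (t + 1) (k + 1)) (C.label j t k) (C.label j t (k + 1))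
  | .birth _ => True
  | .death _ => True

end CutData

/-- A cut-diagram over a disjoint union of `n` oriented 2-spheres. -/
structure CutDiagram (n : ℕ) extends CutData n where
  fits : ∀ j t s, (word j)[t]? = some s → s.pos + s.piece.bot ≤ width (word j) t
  closed : ∀ j, width (word j) (word j).length = 0
  strand_left : ∀ j t s, (word j)[t]? = some s → ∀ p < s.pos,
    toCutData.SameStrand j t p (t + 1) p
  strand_right : ∀ j t s, (word j)[t]? = some s → ∀ p, s.pos + s.piece.bot + p < width (word j) t →
    toCutData.SameStrand j t (s.pos + s.piece.bot + p) (t + 1) (s.pos + s.piece.top + p)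
  piece_rule : ∀ j t s, (word j)[t]? = some s → toCutData.PieceRule j t s.pos s.piece
  /-- An arc that ends at a `•` in the region `A` is labeled by `A`. -/
  black_rule : ∀ j t A L ε, toCutData.Tip .black j t A L ε → L = A
  /-- The `∘` of each sphere are partitioned into `(X, Y)`-pairs with equal signs. -/
  white_rule : ∀ j t A L ε, toCutData.Tip .white j t A L ε →
    pair j t ≠ t ∧ pair j (pair j t) = t ∧ toCutData.Tip .white j (pair j t) L A ε

/-! ## Moves -/

/-- A partial identification of two diagrams, outside the supporting disks of a move: on each
sphere, which levels (with a shift in the position) and which slices correspond. -/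
structure Matching (n : ℕ) where
  level : Fin n → ℕ → ℕ → Prop
  shift : Fin n → ℕ
  slice : Fin n → ℕ → ℕ → Prop

namespace Matching

variable {n : ℕ} (M : Matching n)

/-- The regions `A` and `A'` have a common gap outside the supporting disks. -/
def SameRegion (C C' : CutDiagram n) (A : Region C.word) (A' : Region C'.word) : Prop :=
  ∃ j t t' g, M.level j t t' ∧ g ≤ width (C.word j) t ∧ g + M.shift j ≤ width (C'.word j) t' ∧
    A = C.reg j t g ∧ A' = C'.reg j t' (g + M.shift j)

/-- Two strands correspond. -/
def SameArc (C C' : CutDiagram n) (j : Fin n) (t p t' p' : ℕ) : Prop :=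
  M.level j t t' ∧ p' = p + M.shift j ∧ C.IsStrand j t p ∧ C'.IsStrand j t' p'

/-- The cut-diagrams agree outside the supporting disks.  Corresponding cut arcs have the same
orientation and are labeled by regions that have a common gap outside
the supporting disks (hence labels follow regions that merge or split), no cut arc is labeled by
a region that is contained in the supporting disks, and corresponding `∘` are
paired in the same way. -/
structure Agree (C C' : CutDiagram n) : Prop where
  up_eq : ∀ j t p t' p', M.SameArc C C' j t p t' p' → C.up j t p = C'.up j t' p'
  label_same : ∀ j t p t' p', M.SameArc C C' j t p t' p' →
    M.SameRegion C C' (C.label j t p) (C'.label j t' p')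
  label_tgt : ∀ j t p t₁ p₁ t₂ p₂, M.SameArc C C' j t p t₁ p₁ → M.SameArc C C' j t p t₂ p₂ →
    C'.label j t₁ p₁ = C'.label j t₂ p₂
  label_src : ∀ j t₁ p₁ t₂ p₂ t p, M.SameArc C C' j t₁ p₁ t p → M.SameArc C C' j t₂ p₂ t p →
    C.label j t₁ p₁ = C.label j t₂ p₂
  label_outside_src : ∀ j t p, C.IsStrand j t p → ∃ A', M.SameRegion C C' (C.label j t p) A'
  label_outside_tgt : ∀ j t p, C'.IsStrand j t p → ∃ A, M.SameRegion C C' A (C'.label j t p)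
  pair_same : ∀ j t t', M.slice j t t' → (∃ A L ε, C.Tip .white j t A L ε) →
    M.slice j (C.pair j t) (C'.pair j t')

end Matching

/-- A simultaneous replacement, on one sphere, of `A ++ u₁ ++ B ++ u₂ ++ D` by
`A ++ v₁ ++ B ++ v₂ ++ D`.  The lists `m₁` and `m₂` tell which slices of `u₁` and `v₁`, and of
`u₂` and `v₂`, are the same end point. -/
structure Sites (n : ℕ) where
  comp : Fin n
  A : List Slice
  u₁ : List Slice
  v₁ : List Slice
  m₁ : List (ℕ × ℕ)
  B : List Slice
  u₂ : List Slice
  v₂ : List Slice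
  m₂ : List (ℕ × ℕ)
  D : List Slice

namespace Sites

variable {n : ℕ}

/-- A replacement at one place only. -/
def single (j : Fin n) (A u v : List Slice) (m : List (ℕ × ℕ)) (D : List Slice) : Sites n :=
  ⟨j, A, u, v, m, [], [], [], [], D⟩

variable (S : Sites n)

/-- The level of the first diagram at the start of the second place. -/
def src₂ : ℕ := S.A.length + S.u₁.length + S.B.length

/-- The level of the second diagram at the start of the second place. -/
def tgt₂ : ℕ := S.A.length + S.v₁.length + S.B.length

/-- Everything outside the two places is identified. -/
def matching : Matching n where
  level j t t' := if j = S.comp then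
      (t ≤ S.A.length ∧ t' = t) ∨
      (∃ r ≤ S.B.length, t = S.A.length + S.u₁.length + r ∧ t' = S.A.length + S.v₁.length + r) ∨
      (∃ r ≤ S.D.length, t = S.src₂ + S.u₂.length + r ∧ t' = S.tgt₂ + S.v₂.length + r)
    else t = t'
  shift _ := 0
  slice j t t' := if j = S.comp then
      (t < S.A.length ∧ t' = t) ∨
      (∃ x ∈ S.m₁, t = S.A.length + x.1 ∧ t' = S.A.length + x.2) ∨
      (∃ r < S.B.length, t = S.A.length + S.u₁.length + r ∧ t' = S.A.length + S.v₁.length + r) ∨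
      (∃ x ∈ S.m₂, t = S.src₂ + x.1 ∧ t' = S.tgt₂ + x.2) ∨
      (∃ r < S.D.length, t = S.src₂ + S.u₂.length + r ∧ t' = S.tgt₂ + S.v₂.length + r)
    else t = t'

/-- `C'` is obtained from `C` by the given replacement. -/
def Replaces (C C' : CutDiagram n) : Prop :=
  C.word S.comp = S.A ++ S.u₁ ++ S.B ++ S.u₂ ++ S.D ∧
  C'.word S.comp = S.A ++ S.v₁ ++ S.B ++ S.v₂ ++ S.D ∧
  (∀ j, j ≠ S.comp → C.word j = C'.word j) ∧ S.matching.Agree C C'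

end Sites

/-- Isotopies of the plane: exchange of the heights of two pieces, birth of two
extremal points of a strand, sliding of a crossing along an extremal point of one of its strands,
rotation of an end point. -/
inductive Isotopy : List Slice → List Slice → List (ℕ × ℕ) → Prop
  | exchange (P Q : Piece) (k r : ℕ) :
      Isotopy [⟨k, P⟩, ⟨k + P.top + r, Q⟩] [⟨k + P.bot + r, Q⟩, ⟨k, P⟩] [(0, 1), (1, 0)]
  | snake_right (k : ℕ) : Isotopy [] [⟨k, .cup⟩, ⟨k + 1, .cap⟩] []
  | snake_left (k : ℕ) : Isotopy [] [⟨k + 1, .cup⟩, ⟨k, .cap⟩] []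
  | slide_cap (k : ℕ) (b : Bool) :
      Isotopy [⟨k, .cross b⟩, ⟨k + 1, .cap⟩] [⟨k + 1, .cross !b⟩, ⟨k, .cap⟩] []
  | slide_cup (k : ℕ) (b : Bool) :
      Isotopy [⟨k + 1, .cup⟩, ⟨k, .cross b⟩] [⟨k, .cup⟩, ⟨k + 1, .cross !b⟩] []
  | birth_left (k : ℕ) (c : Color) :
      Isotopy [⟨k, .birth c⟩] [⟨k, .cup⟩, ⟨k, .death c⟩] [(0, 1)]
  | birth_right (k : ℕ) (c : Color) :
      Isotopy [⟨k, .birth c⟩] [⟨k, .cup⟩, ⟨k + 1, .death c⟩] [(0, 1)]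
  | death_left (k : ℕ) (c : Color) :
      Isotopy [⟨k, .death c⟩] [⟨k, .birth c⟩, ⟨k, .cap⟩] [(0, 0)]
  | death_right (k : ℕ) (c : Color) :
      Isotopy [⟨k, .death c⟩] [⟨k + 1, .birth c⟩, ⟨k, .cap⟩] [(0, 0)]

/-- Insert one strand on the left. -/
def shiftRight (A : List Slice) : List Slice := A.map fun s => ⟨s.pos + 1, s.piece⟩

/-- The isotopy of the sphere that pushes the leftmost strand, at the level between `A` and `B`,
across the point at infinity: this strand is pulled around the whole diagram. -/
def sweepWord (A B : List Slice) : List Slice :=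
  [⟨0, .cup⟩] ++ shiftRight A ++ [⟨0, .cap⟩, ⟨0, .cup⟩] ++ shiftRight B ++ [⟨0, .cap⟩]

/-- The identification that goes with `sweepWord`. -/
def sweepMatching {n : ℕ} (j : Fin n) (A B : List Slice) : Matching n where
  level j' t t' := if j' = j then
      (t ≤ A.length ∧ t' = t + 1) ∨ (A.length ≤ t ∧ t ≤ A.length + B.length ∧ t' = t + 3)
    else t = t'
  shift j' := if j' = j then 1 else 0
  slice j' t t' := if j' = j then
      (t < A.length ∧ t' = t + 1) ∨ (A.length ≤ t ∧ t < A.length + B.length ∧ t' = t + 3)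
    else t = t'

/-- Passage of a strand across the point at infinity of one of the spheres. -/
def Sweep {n : ℕ} (C C' : CutDiagram n) : Prop :=
  ∃ (j : Fin n) (A B : List Slice), C.word j = A ++ B ∧ 0 < width (C.word j) A.length ∧
    C'.word j = sweepWord A B ∧ (∀ j', j' ≠ j → C.word j' = C'.word j') ∧
    (sweepMatching j A B).Agree C C'

/-- The supporting disks of the topological moves (except for the saddle move).
The labels are only subject to the labeling rules, before and after the move. -/
inductive Topological : List Slice → List Slice → Prop
  /-- An arc between two `•` appears. -/
  | branch_pair (k : ℕ) : Topological [] [⟨k, .birth .black⟩, ⟨k, .death .black⟩]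
  /-- A circle appears. -/
  | circle (k : ℕ) : Topological [] [⟨k, .cup⟩, ⟨k, .cap⟩]
  /-- A kink appears on a strand. -/
  | kink_right (k : ℕ) (b : Bool) :
      Topological [] [⟨k + 1, .cup⟩, ⟨k, .cross b⟩, ⟨k + 1, .cap⟩]
  | kink_left (k : ℕ) (b : Bool) :
      Topological [] [⟨k, .cup⟩, ⟨k + 1, .cross b⟩, ⟨k, .cap⟩]
  /-- A `•` passes under a strand. -/
  | branch_right (k : ℕ) :
      Topological [⟨k + 1, .birth .black⟩] [⟨k, .birth .black⟩, ⟨k, .cross false⟩]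
  | branch_left (k : ℕ) :
      Topological [⟨k, .birth .black⟩] [⟨k + 1, .birth .black⟩, ⟨k, .cross true⟩]
  /-- A strand passes under another one. -/
  | bigon (k : ℕ) (b : Bool) : Topological [] [⟨k, .cross b⟩, ⟨k, .cross !b⟩]
  /-- A strand passes under (or over) the crossing of two other strands.  If the three strands are
  numbered at the bottom from left to right, then `a`, `b`, `c` say that `1` is over `2`, that
  `1` is over `3`, that `2` is over `3`; the hypothesis excludes the cyclic cases. -/
  | triangle (k : ℕ) (a b c : Bool) (h : a = c → b = a) :
      Topological [⟨k, .cross a⟩, ⟨k + 1, .cross b⟩, ⟨k, .cross c⟩]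
        [⟨k + 1, .cross c⟩, ⟨k, .cross b⟩, ⟨k + 1, .cross a⟩]

/-- The saddle move, between two antiparallel strands with the same label. -/
def Saddle {n : ℕ} (C C' : CutDiagram n) : Prop :=
  ∃ (j : Fin n) (A D : List Slice) (k : ℕ),
    (Sites.single j A [] [⟨k, .cap⟩, ⟨k, .cup⟩] [] D).Replaces C C' ∧
    C.label j A.length k = C.label j A.length (k + 1)

/-- A crossing change between two strands labeled by `X` and `Y`, where there is an
`(X, Y)`-pair. -/
def SingularCrossing {n : ℕ} (C C' : CutDiagram n) : Prop :=
  ∃ (j : Fin n) (A D : List Slice) (k : ℕ) (b : Bool) (X Y : Region C.word),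
    (Sites.single j A [⟨k, .cross b⟩] [⟨k, .cross !b⟩] [] D).Replaces C C' ∧
    (∃ j' t ε, C.Tip .white j' t X Y ε) ∧
    (if b then
      C.label j A.length k = Y ∧ C.label j A.length (k + 1) = X ∧
        C.label j (A.length + 1) k = X
    else
      C.label j A.length (k + 1) = Y ∧ C.label j A.length k = X ∧
        C.label j (A.length + 1) (k + 1) = X)

/-- The end points `∘` of a pair pass simultaneously from the left to the right of two strands
with the same label and the same orientation: the first one, whose arc goes to the right, passes
from one side to the other by retracting its arc, and the second one, whose arc goes to the left,
passes under the strand. -/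
def SingularPass {n : ℕ} (C C' : CutDiagram n) : Prop :=
  ∃ (S : Sites n) (k l k₁ k₂ : ℕ),
    S.Replaces C C' ∧ S.m₁ = [(0, 0)] ∧ S.m₂ = [(0, 0)] ∧
    ((S.u₁ = [⟨k, .birth .white⟩, ⟨k, .cross false⟩] ∧ S.v₁ = [⟨k + 1, .birth .white⟩] ∧
        S.u₂ = [⟨l, .birth .white⟩] ∧ S.v₂ = [⟨l + 1, .birth .white⟩, ⟨l, .cross true⟩] ∧
        k₁ = k ∧ k₂ = l) ∨
      (S.u₁ = [⟨l, .birth .white⟩] ∧ S.v₁ = [⟨l + 1, .birth .white⟩, ⟨l, .cross true⟩] ∧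
        S.u₂ = [⟨k, .birth .white⟩, ⟨k, .cross false⟩] ∧ S.v₂ = [⟨k + 1, .birth .white⟩] ∧
        k₁ = l ∧ k₂ = k)) ∧
    C.pair S.comp S.A.length = S.src₂ ∧
    C.up S.comp S.A.length k₁ = C.up S.comp S.src₂ k₂ ∧
    C.label S.comp S.A.length k₁ = C.label S.comp S.src₂ k₂ ∧
    C'.label S.comp S.A.length k₁ = C'.label S.comp S.tgt₂ k₂

/-- The finger move: a strand is cut open at two new `∘`, which are paired with the two end points
of a new arc, in the region that labels the strand. -/
def Finger {n : ℕ} (C C' : CutDiagram n) : Prop :=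
  ∃ (S : Sites n) (k l : ℕ),
    S.Replaces C C' ∧ S.m₁ = [] ∧ S.m₂ = [] ∧ S.u₁ = [] ∧ S.u₂ = [] ∧
    ((S.v₁ = [⟨k, .death .white⟩, ⟨k, .birth .white⟩] ∧
        S.v₂ = [⟨l, .birth .white⟩, ⟨l, .death .white⟩] ∧
        C.label S.comp S.A.length k = C.reg S.comp S.src₂ l) ∨
      (S.v₁ = [⟨l, .birth .white⟩, ⟨l, .death .white⟩] ∧
        S.v₂ = [⟨k, .death .white⟩, ⟨k, .birth .white⟩] ∧
        C.label S.comp S.src₂ k = C.reg S.comp S.A.length l)) ∧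
    ({C'.pair S.comp S.A.length, C'.pair S.comp (S.A.length + 1)} : Set ℕ) =
      {S.tgt₂, S.tgt₂ + 1}

/-- The cusp move: a `•` is replaced by a `∘`, which is paired with the `∘` of a new arc that
joins it to a `•` in the same region. -/
def Cusp {n : ℕ} (C C' : CutDiagram n) : Prop :=
  ∃ (j : Fin n) (A D : List Slice) (k : ℕ),
    (Sites.single j A [⟨k, .birth .black⟩]
      [⟨k, .birth .white⟩, ⟨k, .death .black⟩, ⟨k, .birth .white⟩] [] D).Replaces C C' ∧
    C'.pair j A.length = A.length + 2

/-- The moves on cut-diagrams: isotopies, topological moves and self-singular moves. -/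
inductive Move {n : ℕ} (C C' : CutDiagram n) : Prop
  | isotopy (j : Fin n) (A u v : List Slice) (m : List (ℕ × ℕ)) (D : List Slice) :
      Isotopy u v m → (Sites.single j A u v m D).Replaces C C' → Move C C'
  | sweep : Sweep C C' → Move C C'
  | topological (j : Fin n) (A u v D : List Slice) :
      Topological u v → (Sites.single j A u v [] D).Replaces C C' → Move C C'
  | saddle : Saddle C C' → Move C C'
  | singular_crossing : SingularCrossing C C' → Move C C'
  | singular_pass : SingularPass C C' → Move C C'
  | finger : Finger C C' → Move C C'
  | cusp : Cusp C C' → Move C C'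

/-- Self-singular equivalence of cut-diagrams. -/
def SelfSingularEquiv {n : ℕ} : CutDiagram n → CutDiagram n → Prop := Relation.EqvGen Move

/-! ## Groups of cut-diagrams -/

namespace CutDiagram

variable {n : ℕ} (C : CutDiagram n)

/-- The relations `B⁻¹ * A ^ L` for all regions `A` (left) and `B` (right) that are adjacent along
a cut arc labeled by `L`. -/
def relators : Set (FreeGroup (Region C.word)) :=
  {x | ∃ A B L, C.Adjacent A B L ∧
    x = (FreeGroup.of B)⁻¹ * ((FreeGroup.of L)⁻¹ * FreeGroup.of A * FreeGroup.of L)}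

/-- The group `G(C)` of a cut-diagram. -/
abbrev Grp : Type := PresentedGroup C.relators

/-- The meridian `[A]` of a region. -/
def meridian (A : Region C.word) : C.Grp := PresentedGroup.of A

/-- A basing: a region on each sphere. -/
structure Basing where
  reg : Fin n → Region C.word
  comp_reg : ∀ j, (reg j).comp = j

/-- `C.PathWord A B w` says that `w` is the element of `G(C)` associated with some generic path from
the region `A` to the region `B`: the product of the labels of the cut arcs that are met, with
exponent `1` if the arc is crossed from its left to its right, and `-1` otherwise. -/
inductive PathWord (A : Region C.word) : Region C.word → C.Grp → Prop
  | nil : PathWord A A 1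
  | pos (j : Fin n) (t p : ℕ) (w : C.Grp) : C.IsStrand j t p →
      PathWord A (C.leftReg j t p) w →
      PathWord A (C.rightReg j t p) (w * C.meridian (C.label j t p))
  | neg (j : Fin n) (t p : ℕ) (w : C.Grp) : C.IsStrand j t p →
      PathWord A (C.rightReg j t p) w →
      PathWord A (C.leftReg j t p) (w * (C.meridian (C.label j t p))⁻¹)

variable {C}

/-- The reduced group `RG(C)`, for the choice of meridians given by a basing. -/
abbrev RGrp (b : C.Basing) : Type := ReducedGroup (fun j => C.meridian (b.reg j))

/-- The images of the `i`-th meridians in `RG(C)`. -/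
def meridiansAt (b : C.Basing) (i : Fin n) : Set (RGrp b) :=
  {x | ∃ A : Region C.word, A.comp = i ∧ x = QuotientGroup.mk (C.meridian A)}

/-- The quotient `RG(C)_i` of `RG(C)` by the normal subgroup generated by the `i`-th meridians. -/
abbrev RGrpAt (b : C.Basing) (i : Fin n) : Type :=
  RGrp b ⧸ Subgroup.normalClosure (meridiansAt b i)

/-- The projection from `G(C)` to `RG(C)_i`. -/
def proj (b : C.Basing) (i : Fin n) : C.Grp →* RGrpAt b i :=
  (QuotientGroup.mk' (Subgroup.normalClosure (meridiansAt b i))).comp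
    (QuotientGroup.mk' (Subgroup.normalClosure
      (reducedRelators (fun j => C.meridian (b.reg j)))))

theorem proj_surjective (b : C.Basing) (i : Fin n) : Function.Surjective (proj b i) :=
  (QuotientGroup.mk'_surjective _).comp (QuotientGroup.mk'_surjective _)

theorem proj_relator (b : C.Basing) (i j : Fin n) (g : RGrpAt b i) :
    (proj b i (C.meridian (b.reg j)))⁻¹ * (g⁻¹ * proj b i (C.meridian (b.reg j)) * g)⁻¹ *
      proj b i (C.meridian (b.reg j)) * (g⁻¹ * proj b i (C.meridian (b.reg j)) * g) = 1 := by
  obtain ⟨h, rfl⟩ := proj_surjective b i g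
  have key : QuotientGroup.mk' (Subgroup.normalClosure
      (reducedRelators (fun j => C.meridian (b.reg j))))
      ((C.meridian (b.reg j))⁻¹ * (h⁻¹ * C.meridian (b.reg j) * h)⁻¹ * C.meridian (b.reg j) *
        (h⁻¹ * C.meridian (b.reg j) * h)) = 1 :=
    (QuotientGroup.eq_one_iff _).2 (Subgroup.subset_normalClosure ⟨j, h, rfl⟩)
  have := congrArg (QuotientGroup.mk' (Subgroup.normalClosure (meridiansAt b i))) key
  simpa [proj] using this

/-- The indices of the generators `x_j`, `j ≠ i`. -/
abbrev Idx {n : ℕ} (i : Fin n) : Type := {j : Fin n // j ≠ i}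

/-- The homomorphism from the reduced free group to `RG(C)_i` that maps `x_j` to the meridian of
the `j`-th basing region. -/
def psi (b : C.Basing) (i : Fin n) : ReducedFreeGroup (Idx i) →* RGrpAt b i :=
  reducedLift (fun j => proj b i (C.meridian (b.reg j.1))) (fun j g => proj_relator b i j.1 g)

/-- The isomorphism `φ` from `RG(C)_i` to the reduced free group that is specified by the basing:
the inverse of `psi`. -/
def phi (b : C.Basing) (i : Fin n) : RGrpAt b i →* ReducedFreeGroup (Idx i) :=
  if h : Function.Bijective (psi b i) then (MulEquiv.ofBijective (psi b i) h).symm.toMonoidHom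
  else 1

/-! ## The invariants -/

/-- The set of `∘` on the `i`-th sphere (as slices). -/
def whites (C : CutDiagram n) (i : Fin n) : Finset ℕ :=
  (Finset.range (C.word i).length).filter (fun t => ∃ A L ε, C.Tip .white i t A L ε)

/-- The set of pairs of `∘` on the `i`-th sphere, each one represented by its first element. -/
def whitePairs (C : CutDiagram n) (i : Fin n) : Finset ℕ :=
  (C.whites i).filter (fun t => t < C.pair i t)

/-- The sign of a pair of `∘`. -/
def sign (C : CutDiagram n) (i : Fin n) (t : ℕ) : ℤ :=
  if ∃ A L, C.Tip .white i t A L true then 1 else -1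

/-- A choice of paths from the base point of the `i`-th sphere to its `∘`, or rather of the
elements of `G(C)` associated with these paths. -/
structure Paths (b : C.Basing) (i : Fin n) where
  val : ℕ → C.Grp
  isPath : ∀ t A L ε, C.Tip .white i t A L ε → C.PathWord (b.reg i) A (val t)

/-- The positive element `w_{p₁,p₂}` of `RG(C)_i` for the pair of `p₁ = t`. -/
def w (b : C.Basing) (i : Fin n) (a : Paths b i) (t : ℕ) : RGrpAt b i :=
  if IsPositive (phi b i (proj b i (a.val t * (a.val (C.pair i t))⁻¹))) then
    proj b i (a.val t * (a.val (C.pair i t))⁻¹)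
  else proj b i (a.val (C.pair i t) * (a.val t)⁻¹)

/-- The element `S_i(C)` of the group ring of the reduced free group. -/
def S (b : C.Basing) (i : Fin n) (a : Paths b i) : MonoidAlgebra ℤ (ReducedFreeGroup (Idx i)) :=
  ∑ t ∈ C.whitePairs i, C.sign i t • (MonoidAlgebra.of ℤ _ (phi b i (w b i a t)) - 1)

/-- The residue class of the coefficient of `X_I` in `E_i(S_i(C))` modulo the greatest common
divisor of the coefficients of the proper subsequences of `I`. -/
def kappa (b : C.Basing) (i : Fin n) (a : Paths b i) (I : NRSeq (Idx i)) : Set ℤ :=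
  (magnusRing (Idx i) (S b i a)).residue I

/-- The coefficients `ρ_C(g)`: the sum of the signs of the pairs of `∘` whose positive element
is `g`. -/
def rho (b : C.Basing) (i : Fin n) (a : Paths b i) : RGrpAt b i →₀ ℤ :=
  ∑ t ∈ C.whitePairs i, Finsupp.single (w b i a t) (C.sign i t)

/-- The multiset `K_i(C)` of the pairs formed by `ρ_C(g)` and the residue classes of the
coefficients of `E_i(φ(g))`, for all non-trivial (positive) `g` with `ρ_C(g) ≠ 0`. -/
def K (b : C.Basing) (i : Fin n) (a : Paths b i) : Multiset (ℤ × (NRSeq (Idx i) → Set ℤ)) :=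
  ((rho b i a).support.erase 1).val.map
    (fun g => (rho b i a g, fun I => (magnus (Idx i) (phi b i g)).residue I))

end CutDiagram

end

end CutDiag

open scoped Classical

namespace CutDiag

noncomputable section

/-! ## Families whose members commute with their conjugates -/

section ReducedFamily

variable {ι G H : Type*} [Group G] [Group H]

/-! One principle drives the proof (`IsReducedFamily.conj_congr`). If every `x j` commutes with its
conjugates, then, once the members with index in `K` are killed, the conjugate of `x j` by `u`
depends only on the image of `u` after killing `x j` as well. A claim about conjugates of `x j` over
a set `s` of surviving indices thus becomes a claim about conjugators over `s` without `j`, and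
induction on finite sets applies. It gives generation from normal generation
(`IsReducedFamily.closure_eq_top`), existence of representations (`exists_hom`) and their uniqueness
outside the support of a move (`Coherent.sol_eq`).

Geometrically, when the regions of a sphere are sent to `1`, the product of the signed labels on the
left of a gap depends only on the region of the gap (`leftProd_eq_of_reg_eq`): this is how simple
connectivity enters. The resulting potential satisfies "right = left times label", so the word of a
path on that sphere is determined by its ends. Conjugating the generators by such potentials, and
iterating, produces a solution of all relations of the diagram that takes prescribed values on the
basing. Together with generation by the basing meridians this makes `psi` bijective.

A marking is a homomorphism from the group of the diagram to the reduced free group that sends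
meridians to conjugates of the corresponding generators. Two markings differ by an endomorphism that
conjugates each generator. On Magnus expansions it acts by a triangular substitution, so every
coefficient changes by a combination of coefficients on proper non-empty subsequences (`Lam.Tri`);
residues and positivity are unaffected. Injectivity of the reduced Magnus expansion makes such
endomorphisms automorphisms, and shows that exactly one of `g`, `g⁻¹` is positive when `g ≠ 1`, so
that the order within a pair is irrelevant.

Both invariants are therefore read off from `kirk`, a sum over all `∘`, taken up to
basis-conjugating automorphisms and with the coefficient of `1` erased. Each pair is counted twice,
which is undone at the end. Markings exist on both sides of a move and agree on the regions outside
its support, so the group need not be followed through the move; only the `∘` matter. The cusp move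
adds terms at `1`, the finger move adds cancelling terms, the simultaneous passage multiplies both
potentials of a pair on the right by the same value, and a passage across infinity multiplies all
potentials on its sphere on the left by one element, which is a global conjugation. -/

/-- Each member of the family commutes with all its conjugates. -/
def IsReducedFamily (x : ι → G) : Prop := ∀ j g, Commute (x j) (g⁻¹ * x j * g)

/-- The normal subgroup generated by the members with index in `K`. -/
abbrev killed (x : ι → G) (K : Set ι) : Subgroup G := Subgroup.normalClosure (x '' K)

theorem relator_eq_one_iff (a b : G) : a⁻¹ * b⁻¹ * a * b = 1 ↔ Commute a b := by
  rw [commute_iff_eq]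
  constructor
  · intro h
    have : a * b = b * a * (a⁻¹ * b⁻¹ * a * b) := by group
    rw [this, h, mul_one]
  · intro h
    rw [mul_assoc, h]; group

theorem mk_killed_eq_one {x : ι → G} {K : Set ι} {j : ι} (hj : j ∈ K) (g : G) :
    QuotientGroup.mk' (killed x K) (g⁻¹ * x j * g) = 1 := by
  rw [QuotientGroup.mk'_apply, QuotientGroup.eq_one_iff]
  have := Subgroup.normalClosure_normal.conj_mem (x j)
    (Subgroup.subset_normalClosure (Set.mem_image_of_mem x hj)) g⁻¹
  simpa using this

/-- Modulo `killed x K`, conjugation of `x j` only depends on the conjugating element modulo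
`killed x (insert j K)`. -/
theorem IsReducedFamily.conj_congr {x : ι → G} (hx : IsReducedFamily x) {K : Set ι} {j : ι}
    {u u' : G} (h : QuotientGroup.mk' (killed x (insert j K)) u =
      QuotientGroup.mk' (killed x (insert j K)) u') :
    QuotientGroup.mk' (killed x K) (u⁻¹ * x j * u) =
      QuotientGroup.mk' (killed x K) (u'⁻¹ * x j * u') := by
  -- The factors of `z` are absorbed one by one, each into a different conjugator, so `u` stays
  -- universally quantified in the induction.
  have key : ∀ z ∈ killed x (insert j K), ∀ u, QuotientGroup.mk' (killed x K) (u⁻¹ * x j * u) =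
      QuotientGroup.mk' (killed x K) ((u * z)⁻¹ * x j * (u * z)) := by
    intro z hz
    change z ∈ Subgroup.closure _ at hz
    induction hz using Subgroup.closure_induction with
    | mem z hz =>
      intro u
      obtain ⟨_, ⟨k, hk, rfl⟩, hz⟩ := Group.mem_conjugatesOfSet_iff.1 hz
      obtain ⟨c, rfl⟩ := isConj_iff.1 hz
      rcases hk with rfl | hk
      · congr 1
        have hc := hx k (u * c)
        -- Seen through conjugation by `c`, the extra factor only conjugates a conjugate of `x k` by
        -- `x k` itself, and these two commute.
        have e : (u * (c * x k * c⁻¹))⁻¹ * x k * (u * (c * x k * c⁻¹)) =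
            c * ((x k)⁻¹ * ((u * c)⁻¹ * x k * (u * c)) * x k) * c⁻¹ := by group
        rw [e, mul_assoc (x k)⁻¹, ← hc.eq]
        group
      · have := mk_killed_eq_one (x := x) hk c⁻¹
        rw [inv_inv] at this
        simp only [map_mul, map_inv] at this ⊢
        rw [this]; simp
    | one => simp
    | mul z w _ _ hz hw =>
      intro u
      rw [hz u, hw (u * z), mul_assoc u]
    | inv z _ hz =>
      intro u
      rw [hz (u * z⁻¹)]; simp
  have hz : u⁻¹ * u' ∈ killed x (insert j K) := QuotientGroup.eq.1 h
  have := key _ hz u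
  rwa [mul_inv_cancel_left] at this

theorem eq_of_mk_killed_empty {x : ι → G} {K : Set ι} (hK : K = ∅) {u u' : G}
    (h : QuotientGroup.mk' (killed x K) u = QuotientGroup.mk' (killed x K) u') : u = u' := by
  subst hK
  have : u⁻¹ * u' ∈ killed x ∅ := QuotientGroup.eq.1 h
  rw [killed, Set.image_empty, Subgroup.normalClosure_empty, Subgroup.mem_bot] at this
  rwa [inv_mul_eq_one] at this

/-- A finite reduced family that normally generates the group generates it. -/
theorem IsReducedFamily.closure_eq_top [Fintype ι] {x : ι → G} (hx : IsReducedFamily x)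
    (h : Subgroup.normalClosure (Set.range x) = ⊤) : Subgroup.closure (Set.range x) = ⊤ := by
  -- The killed indices are released one at a time: for empty `s` this is normal generation, for
  -- full `s` it is the claim.
  have key : ∀ s : Finset ι, Subgroup.closure (Set.range x) ⊔ killed x (s : Set ι)ᶜ = ⊤ := by
    intro s
    induction s using Finset.induction_on with
    | empty => simp [killed, h]
    | insert j s hj ih =>
      have e : ((s : Set ι))ᶜ = insert j ((insert j s : Finset ι) : Set ι)ᶜ := by
        ext k; by_cases hk : k = j <;> simp [hk, hj]
      rw [e] at ih
      set K : Set ι := ((insert j s : Finset ι) : Set ι)ᶜ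
      rw [← ih]
      refine le_antisymm ?_ (sup_le le_sup_left ?_)
      · rw [ih]; exact le_top
      · refine (Subgroup.closure_le _).2 ?_
        rintro z hz
        obtain ⟨_, ⟨k, hk, rfl⟩, hz⟩ := Group.mem_conjugatesOfSet_iff.1 hz
        obtain ⟨c, rfl⟩ := isConj_iff.1 hz
        rcases hk with rfl | hk
        -- By induction the conjugator is a word in the generators up to an error in `killed x
        -- (insert k K)`; by `conj_congr` this error changes the conjugate of `x k` only by an
        -- element of `killed x K`.
        · have hc : c⁻¹ ∈ Subgroup.closure (Set.range x) ⊔ killed x (insert k K) := by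
            rw [ih]; trivial
          obtain ⟨a, ha, z, hz, haz⟩ := Subgroup.mem_sup_of_normal_right.1 hc
          have hq : QuotientGroup.mk' (killed x (insert k K)) a =
              QuotientGroup.mk' (killed x (insert k K)) c⁻¹ := by
            rw [← haz]
            exact QuotientGroup.eq.2 (by simpa using hz)
          have := QuotientGroup.eq.1 (hx.conj_congr hq)
          have e2 : c * x k * c⁻¹ = (a⁻¹ * x k * a) *
              ((a⁻¹ * x k * a)⁻¹ * ((c⁻¹)⁻¹ * x k * c⁻¹)) := by group
          rw [e2]
          have hxk : x k ∈ Subgroup.closure (Set.range x) := Subgroup.subset_closure ⟨k, rfl⟩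
          exact mul_mem (le_sup_left (α := Subgroup G) (mul_mem (mul_mem (inv_mem ha) hxk) ha))
            (le_sup_right (α := Subgroup G) this)
        · refine le_sup_right (α := Subgroup G) ?_
          exact Subgroup.normalClosure_normal.conj_mem (x k)
            (Subgroup.subset_normalClosure (Set.mem_image_of_mem x hk)) c
  have := key Finset.univ
  simpa [killed, Subgroup.normalClosure_empty] using this

/-- The generators of a reduced free group. -/
def rgen (j : ι) : ReducedFreeGroup ι := QuotientGroup.mk (FreeGroup.of j)

theorem reducedLift_rgen {b : ι → H}
    (hb : ∀ j (g : H), (b j)⁻¹ * (g⁻¹ * b j * g)⁻¹ * b j * (g⁻¹ * b j * g) = 1) (j : ι) :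
    reducedLift b hb (rgen j) = b j := by
  simp [reducedLift, rgen]

theorem isReducedFamily_rgen : IsReducedFamily (rgen : ι → ReducedFreeGroup ι) := by
  intro j g
  obtain ⟨g, rfl⟩ := QuotientGroup.mk_surjective g
  rw [← relator_eq_one_iff]
  exact (QuotientGroup.eq_one_iff _).2 (Subgroup.subset_normalClosure ⟨j, g, rfl⟩)

theorem closure_range_rgen : Subgroup.closure (Set.range (rgen : ι → ReducedFreeGroup ι)) = ⊤ := by
  have : (rgen : ι → ReducedFreeGroup ι) = QuotientGroup.mk' _ ∘ FreeGroup.of := rfl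
  rw [this, Set.range_comp, ← MonoidHom.map_closure, FreeGroup.closure_range_of,
    ← MonoidHom.range_eq_map, MonoidHom.range_eq_top]
  exact QuotientGroup.mk'_surjective _

theorem ReducedFreeGroup.hom_ext {M : Type*} [Monoid M] {f g : ReducedFreeGroup ι →* M}
    (h : ∀ j, f (rgen j) = g (rgen j)) : f = g :=
  MonoidHom.eq_of_eqOn_dense closure_range_rgen (by rintro _ ⟨j, rfl⟩; exact h j)

theorem IsReducedFamily.conj {x : ι → G} (hx : IsReducedFamily x) (c : ι → G) :
    IsReducedFamily (fun j => (c j)⁻¹ * x j * c j) := by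
  intro j g
  have h := hx j (c j * g * (c j)⁻¹)
  have := h.map (MulAut.conj (c j)⁻¹).toMonoidHom
  simpa [mul_assoc] using this

end ReducedFamily

/-! ## Substitutions in `Λ` and the reduced Magnus expansion -/

namespace Lam

variable {ι : Type*}

/-- The coefficient of `X_I`, as an additive map. -/
def coeffHom (I : NRSeq ι) : Lam ι →+ ℤ where
  toFun W := W.coeff I
  map_zero' := rfl
  map_add' _ _ := rfl

theorem coeff_sum {κ : Type*} (s : Finset κ) (f : κ → Lam ι) (I : NRSeq ι) :
    (∑ k ∈ s, f k).coeff I = ∑ k ∈ s, (f k).coeff I := map_sum (coeffHom I) f s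

theorem coeff_smul (c : ℤ) (f : Lam ι) (I : NRSeq ι) : (c • f).coeff I = c * f.coeff I := by
  have := map_zsmul (coeffHom I) c f
  rwa [smul_eq_mul] at this

theorem length_take_lt {I : NRSeq ι} {k : ℕ} (hk : k < I.1.length) :
    (I.take k).1.length = k := by simp [NRSeq.take]; omega

theorem mul_X_coeff_append {W : Lam ι} {j : ι} {I J : NRSeq ι} (h : I.1 = J.1 ++ [j]) :
    (W * X j).coeff I = W.coeff J := by
  rw [mul_coeff, Finset.sum_eq_single J.1.length]
  · have e1 : I.take J.1.length = J := Subtype.ext (by simp [NRSeq.take, h])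
    have e2 : (I.drop J.1.length).1 = [j] := by simp [NRSeq.drop, h]
    rw [X_coeff, if_pos e2, e1, mul_one]
  · intro k hk hne
    rw [X_coeff, if_neg, mul_zero]
    intro h2
    have := congrArg List.length h2
    have h3 := congrArg List.length h
    simp only [NRSeq.drop, List.length_drop, List.length_append, List.length_singleton,
      Finset.mem_range] at this h3 hk
    omega
  · intro h1
    simp [h] at h1

theorem mul_X_coeff_eq_zero {W : Lam ι} {j : ι} {I : NRSeq ι} (h : ∀ J, I.1 ≠ J ++ [j]) :
    (W * X j).coeff I = 0 := by
  rw [mul_coeff]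
  refine Finset.sum_eq_zero fun k _ => ?_
  rw [X_coeff, if_neg, mul_zero]
  intro h2
  apply h (I.1.take k)
  rw [← h2]
  exact (List.take_append_drop k I.1).symm

theorem mul_X_coeff [Fintype ι] (W : Lam ι) (j : ι) (I : NRSeq ι) :
    (W * X j).coeff I = ∑ J : NRSeq ι, if I.1 = J.1 ++ [j] then W.coeff J else 0 := by
  by_cases h : ∃ J, I.1 = J ++ [j]
  · obtain ⟨J, hJ⟩ := h
    have hnd : J.Nodup := I.2.sublist (by rw [hJ]; exact List.sublist_append_left _ _)
    rw [mul_X_coeff_append (J := ⟨J, hnd⟩) hJ, Finset.sum_eq_single ⟨J, hnd⟩, if_pos hJ]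
    · intro K _ hK
      rw [if_neg]
      intro h2
      apply hK
      rw [hJ] at h2
      exact Subtype.ext (List.append_cancel_right h2).symm
    · simp
  · push Not at h
    rw [mul_X_coeff_eq_zero h]
    exact (Finset.sum_eq_zero fun J _ => if_neg (h J.1)).symm

/-- The substitution `X_j ↦ y_j`. -/
def subst [Fintype ι] (y : ι → Lam ι) (W : Lam ι) : Lam ι :=
  ∑ J : NRSeq ι, W.coeff J • (J.1.map y).prod

theorem subst_add [Fintype ι] (y : ι → Lam ι) (V W : Lam ι) :
    subst y (V + W) = subst y V + subst y W := by
  simp [subst, add_coeff, add_smul, Finset.sum_add_distrib]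

theorem subst_one [Fintype ι] (y : ι → Lam ι) : subst y 1 = 1 := by
  rw [subst, Finset.sum_eq_single ⟨[], List.nodup_nil⟩]
  · simp [one_coeff]
  · intro J _ hJ
    rw [one_coeff, if_neg, zero_smul]
    exact fun h => hJ (Subtype.ext h)
  · simp

/-- Substitution respects right multiplication by a variable because a repeated letter vanishes on
both sides: in `Λ` by definition, and after substitution by `hy`. -/
theorem subst_mul_X [Fintype ι] {y : ι → Lam ι} (hy : ∀ j f, y j * f * y j = 0) (W : Lam ι)
    (j : ι) :
    subst y (W * X j) = subst y W * y j := by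
  simp only [subst, mul_X_coeff, Finset.sum_smul, Finset.sum_mul]
  rw [Finset.sum_comm]
  refine Finset.sum_congr rfl fun J _ => ?_
  by_cases hJ : j ∈ J.1
  · obtain ⟨A, B, hAB⟩ := List.append_of_mem hJ
    have e : (J.1.map y).prod * y j = 0 := by
      have := hy j (B.map y).prod
      simp only [hAB, List.map_append, List.map_cons, List.prod_append, List.prod_cons]
      rw [mul_assoc, this, mul_zero]
    rw [smul_mul_assoc, e, smul_zero]
    refine Finset.sum_eq_zero fun I _ => ?_
    rw [if_neg, zero_smul]
    intro h
    have := I.2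
    rw [h, List.nodup_append] at this
    exact this.2.2 j hJ j (by simp) rfl
  · have hnd : (J.1 ++ [j]).Nodup := by
      rw [List.nodup_append]
      refine ⟨J.2, by simp, ?_⟩
      rintro a ha b hb rfl
      simp at hb
      exact hJ (hb ▸ ha)
    rw [Finset.sum_eq_single ⟨J.1 ++ [j], hnd⟩]
    · simp [mul_assoc]
    · intro I _ hI
      rw [if_neg, zero_smul]
      exact fun h => hI (Subtype.ext h)
    · simp

/-- `W'` is obtained from `W` by adding, to each coefficient, a fixed combination of the
coefficients on the proper non-empty subsequences. -/
def Tri (W W' : Lam ι) : Prop := ∀ (I : NRSeq ι) (d : ℤ),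
  (∀ J : NRSeq ι, J.1 ≠ [] → J ≠ I → J.1.Sublist I.1 → d ∣ W.coeff J) →
    d ∣ W'.coeff I - W.coeff I

theorem length_lt_of_sublist {I J : NRSeq ι} (h : J.1.Sublist I.1) (hne : J ≠ I) :
    J.1.length < I.1.length :=
  lt_of_le_of_ne h.length_le fun e => hne (Subtype.ext (h.eq_of_length e))

theorem Tri.dvd {W W' : Lam ι} (h : Tri W W') {I : NRSeq ι} {d : ℤ}
    (hd : ∀ J : NRSeq ι, J.1 ≠ [] → J.1.Sublist I.1 → d ∣ W.coeff J) (hI : I.1 ≠ []) :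
    d ∣ W'.coeff I := by
  have := h I d fun J h0 _ h1 => hd J h0 h1
  simpa using dvd_add this (hd I hI (List.Sublist.refl _))

/-- A unitriangular change is invertible: by induction on length, a common divisor of the lower
coefficients of `W'` also divides those of `W`. -/
theorem Tri.symm {W W' : Lam ι} (h : Tri W W') : Tri W' W := by
  intro I d hd
  have key : ∀ m, ∀ J : NRSeq ι, J.1.length ≤ m → J.1 ≠ [] → J ≠ I → J.1.Sublist I.1 →
      d ∣ W.coeff J := by
    intro m
    induction m with
    | zero =>
      intro J hJ h0
      exact absurd (List.length_eq_zero_iff.1 (Nat.le_zero.1 hJ)) h0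
    | succ m ih =>
      intro J hJ h0 hne hs
      have h1 := h J d fun K hK0 hK hKs => by
        have hl := length_lt_of_sublist hKs hK
        have hl2 := length_lt_of_sublist hs hne
        exact ih K (by omega) hK0 (fun e => by subst e; omega) (hKs.trans hs)
      have := dvd_sub (hd J h0 hne hs) h1
      simpa using this
  have := h I d fun J h0 h1 h2 => key _ J le_rfl h0 h1 h2
  rw [← neg_sub, dvd_neg]
  exact this

theorem D_dvd {W : Lam ι} {I J : NRSeq ι} (h0 : J.1 ≠ []) (h1 : J ≠ I) (h2 : J.1.Sublist I.1) :
    W.D I ∣ W.coeff J := by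
  have : J.1 ∈ I.1.sublists.toFinset.filter (fun J => J ≠ I.1 ∧ J ≠ []) := by
    simp only [Finset.mem_filter, List.mem_toFinset, List.mem_sublists]
    exact ⟨h2, fun e => h1 (Subtype.ext e), h0⟩
  have := Finset.gcd_dvd (f := fun J => if h : J.Nodup then W.coeff ⟨J, h⟩ else 0) this
  simpa [D, J.2] using this

theorem Tri.D_dvd_D {W W' : Lam ι} (h : Tri W W') (I : NRSeq ι) : W.D I ∣ W'.D I := by
  refine Finset.dvd_gcd fun J hJ => ?_
  simp only [Finset.mem_filter, List.mem_toFinset, List.mem_sublists] at hJ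
  obtain ⟨hs, hne, h0⟩ := hJ
  rw [dif_pos (I.2.sublist hs)]
  refine h.dvd (I := ⟨J, I.2.sublist hs⟩) (fun K hK0 hKs => ?_) h0
  refine D_dvd hK0 ?_ (hKs.trans hs)
  rintro rfl
  exact hne (hs.eq_of_length (le_antisymm hs.length_le hKs.length_le))

/-- The modulus is itself built from coefficients on proper non-empty subsequences, so the two
moduli divide each other, and `Tri` with `d` equal to the modulus is the required congruence. -/
theorem Tri.residue_eq {W W' : Lam ι} (h : Tri W W') (I : NRSeq ι) :
    W.residue I = W'.residue I := by
  have key : ∀ {V V' : Lam ι}, Tri V V' → V'.residue I ⊆ V.residue I := by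
    intro V V' h z hz
    have h1 : V.D I ∣ V'.coeff I - V.coeff I := h I _ fun J h0 h1 h2 => D_dvd h0 h1 h2
    have h2 : V.D I ∣ z - V'.coeff I := (h.D_dvd_D I).trans hz
    have := dvd_add h2 h1
    simpa [residue] using this
  exact (key h.symm).antisymm (key h)

/-- Each factor `y j` needs a letter `j` in the monomial, and these letters must occur in order; at
`I = L` the only contributing splitting gives one letter to each factor. -/
theorem prod_map_coeff {y : ι → Lam ι} (h0 : ∀ j I, j ∉ I.1 → (y j).coeff I = 0)
    (h1 : ∀ j I, I.1 = [j] → (y j).coeff I = 1) (L : List ι) :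
    (∀ I : NRSeq ι, ¬ L.Sublist I.1 → ((L.map y).prod).coeff I = 0) ∧
    (∀ I : NRSeq ι, I.1 = L → ((L.map y).prod).coeff I = 1) := by
  induction L with
  | nil => exact ⟨fun I h => absurd (List.nil_sublist _) h, fun I h => by simp [one_coeff, h]⟩
  | cons j L ih =>
    simp only [List.map_cons, List.prod_cons, mul_coeff]
    constructor
    · intro I hI
      refine Finset.sum_eq_zero fun k _ => ?_
      by_cases hj : j ∈ (I.take k).1
      · rw [ih.1 (I.drop k), mul_zero]
        intro hL
        apply hI
        have := (List.singleton_sublist.2 hj).append hL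
        simpa [NRSeq.take, NRSeq.drop] using this
      · rw [h0 _ _ hj, zero_mul]
    · intro I hI
      rw [Finset.sum_eq_single 1]
      · rw [h1 _ _ (by simp [NRSeq.take, hI]), ih.2 _ (by simp [NRSeq.drop, hI]), mul_one]
      · intro k hk hk1
        rcases Nat.eq_zero_or_pos k with rfl | hk0
        · rw [h0 _ _ (by simp [NRSeq.take]), zero_mul]
        · rw [ih.1, mul_zero]
          intro hL
          have := hL.length_le
          simp [NRSeq.drop, hI] at this hk
          omega
      · simp [hI]

/-- By `prod_map_coeff`, only subsequences of `I` contribute to the coefficient at `I`, and `I`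
itself contributes with factor `1`. The empty one contributes nothing at a non-empty `I`, which is
why the constant term may be excluded in `Tri`. -/
theorem tri_subst [Fintype ι] {y : ι → Lam ι} (h0 : ∀ j I, j ∉ I.1 → (y j).coeff I = 0)
    (h1 : ∀ j I, I.1 = [j] → (y j).coeff I = 1) (W : Lam ι) : Tri W (subst y W) := by
  intro I d hd
  have e : (subst y W).coeff I = ∑ J : NRSeq ι, W.coeff J * ((J.1.map y).prod).coeff I := by
    simp only [subst, coeff_sum, coeff_smul]
  rw [e, ← Finset.add_sum_erase _ _ (Finset.mem_univ I), (prod_map_coeff h0 h1 I.1).2 I rfl,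
    mul_one, add_sub_cancel_left]
  refine Finset.dvd_sum fun J hJ => ?_
  have hne : J ≠ I := Finset.ne_of_mem_erase hJ
  by_cases hs : J.1.Sublist I.1
  · by_cases hJ0 : J.1 = []
    · rw [hJ0]
      simp only [List.map_nil, List.prod_nil, one_coeff]
      rw [if_neg, mul_zero]
      · exact dvd_zero d
      · exact fun hI => hne (Subtype.ext (hJ0.trans hI.symm))
    · exact Dvd.dvd.mul_right (hd J hJ0 hne hs) _
  · rw [(prod_map_coeff h0 h1 J.1).1 I hs, mul_zero]
    exact dvd_zero d

end Lam

section BasisConj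

variable {ι : Type*}

theorem magnusUnits_rgen (j : ι) : magnusUnits ι (rgen j) = Lam.unitX j := reducedLift_rgen _ j

theorem magnus_rgen (j : ι) : magnus ι (rgen j) = 1 + Lam.X j := by
  have : magnus ι (rgen j) = ((magnusUnits ι (rgen j) : (Lam ι)ˣ) : Lam ι) := rfl
  rw [this, magnusUnits_rgen]; rfl

theorem magnus_mul_inv (x : ReducedFreeGroup ι) : magnus ι x * magnus ι x⁻¹ = 1 := by
  rw [← map_mul, mul_inv_cancel, map_one]

theorem magnus_inv_mul (x : ReducedFreeGroup ι) : magnus ι x⁻¹ * magnus ι x = 1 := by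
  rw [← map_mul, inv_mul_cancel, map_one]

/-- Endomorphisms of the reduced free group that conjugate each generator. -/
def IsBasisConj (θ : ReducedFreeGroup ι →* ReducedFreeGroup ι) : Prop :=
  ∀ j, ∃ g, θ (rgen j) = g⁻¹ * rgen j * g

theorem magnus_nil (x : ReducedFreeGroup ι) (I : NRSeq ι) (hI : I.1 = []) :
    (magnus ι x).coeff I = 1 := by
  let f : Lam ι →* ℤ :=
    { toFun := fun W => W.coeff I
      map_one' := by simp [Lam.one_coeff, hI]
      map_mul' := fun V W => by
        have h1 : I.take 0 = I := Subtype.ext (by simp [NRSeq.take, hI])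
        have h2 : I.drop 0 = I := Subtype.ext (by simp [NRSeq.drop, hI])
        simp [Lam.mul_coeff, hI, h1, h2] }
  have : f.comp (magnus ι) = 1 := ReducedFreeGroup.hom_ext fun j => by
    simp [f, magnus_rgen, Lam.add_coeff, Lam.one_coeff, Lam.X_coeff, hI]
  exact DFunLike.congr_fun this x

/-- A basis-conjugating endomorphism acts on Magnus expansions by a triangular substitution. -/
theorem IsBasisConj.exists_subst [Fintype ι] {θ : ReducedFreeGroup ι →* ReducedFreeGroup ι}
    (hθ : IsBasisConj θ) : ∃ y : ι → Lam ι,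
      (∀ j I, j ∉ I.1 → (y j).coeff I = 0) ∧ (∀ j I, I.1 = [j] → (y j).coeff I = 1) ∧
      ∀ x, magnus ι (θ x) = Lam.subst y (magnus ι x) := by
  choose g hg using hθ
  -- Forced by `θ (rgen j) = (g j)⁻¹ * rgen j * g j`, whose expansion is `1` plus this element; it
  -- inherits `y j * f * y j = 0` from `X j`.
  set y : ι → Lam ι := fun j => magnus ι (g j)⁻¹ * Lam.X j * magnus ι (g j) with hy
  have hyy : ∀ j f, y j * f * y j = 0 := by
    intro j f
    have := Lam.X_mul_mul_X j (magnus ι (g j) * f * magnus ι (g j)⁻¹)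
    calc y j * f * y j = magnus ι (g j)⁻¹ * (Lam.X j * (magnus ι (g j) * f * magnus ι (g j)⁻¹) *
          Lam.X j) * magnus ι (g j) := by simp only [hy, mul_assoc]
      _ = 0 := by rw [this]; simp
  have hθj : ∀ j, magnus ι (θ (rgen j)) = 1 + y j := by
    intro j
    rw [hg, map_mul, map_mul, magnus_rgen, mul_add, add_mul, mul_one, magnus_inv_mul]
  refine ⟨y, ?_, ?_, ?_⟩
  · intro j I hj
    simp only [hy, mul_assoc, Lam.mul_coeff]
    refine Finset.sum_eq_zero fun k _ => mul_eq_zero_of_right _ (Finset.sum_eq_zero fun m _ => ?_)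
    rw [Lam.X_coeff, if_neg, zero_mul]
    intro h
    have : j ∈ ((I.drop k).take m).1 := by rw [h]; simp
    exact hj (List.mem_of_mem_drop (List.mem_of_mem_take this))
  · intro j I hI
    have hn : ∀ (x : ReducedFreeGroup ι) (I : NRSeq ι), I.1 = [] → (magnus ι x).coeff I = 1 :=
      magnus_nil
    simp only [hy, mul_assoc]
    rw [Lam.mul_coeff, Finset.sum_eq_single 0]
    · rw [hn _ _ (by simp [NRSeq.take]), one_mul, Lam.mul_coeff, Finset.sum_eq_single 1]
      · rw [hn _ _ (by simp [NRSeq.drop, hI]), Lam.X_coeff,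
          if_pos (by simp [NRSeq.take, NRSeq.drop, hI]), mul_one]
      · intro k hk hk1
        rw [Lam.X_coeff, if_neg, zero_mul]
        simp only [NRSeq.drop, hI, List.drop_zero, List.length_singleton, Finset.mem_range] at hk
        have : k = 0 := by omega
        simp [this, NRSeq.take]
      · simp [NRSeq.drop, hI]
    · intro k hk hk1
      rw [hI] at hk
      simp only [List.length_singleton, Finset.mem_range] at hk
      have hk : k = 1 := by omega
      refine mul_eq_zero_of_right _ ?_
      rw [Lam.mul_coeff]
      refine Finset.sum_eq_zero fun m _ => ?_
      rw [Lam.X_coeff, if_neg, zero_mul]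
      simp [NRSeq.take, NRSeq.drop, hI, hk]
    · simp
  -- Only right multiplication by a variable is controlled so far, so an arbitrary left factor `W`
  -- is carried along while `x` is built from generators; inverses come from applying the claim to
  -- `W * magnus ι a⁻¹`.
  · have key : ∀ x : ReducedFreeGroup ι, ∀ W : Lam ι,
        Lam.subst y (W * magnus ι x) = Lam.subst y W * magnus ι (θ x) := by
      intro x
      have hx : x ∈ Subgroup.closure (Set.range (rgen : ι → ReducedFreeGroup ι)) := by
        rw [closure_range_rgen]; trivial
      induction hx using Subgroup.closure_induction with
      | mem x hx =>
        obtain ⟨j, rfl⟩ := hx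
        intro W
        rw [magnus_rgen, hθj, mul_add, mul_one, Lam.subst_add, Lam.subst_mul_X hyy, mul_add,
          mul_one]
      | one => simp
      | mul a b _ _ ha hb =>
        intro W
        rw [map_mul, map_mul, map_mul, ← mul_assoc, hb, ha, mul_assoc]
      | inv a _ ha =>
        intro W
        have := ha (W * magnus ι a⁻¹)
        rw [mul_assoc, magnus_inv_mul, mul_one] at this
        rw [this, mul_assoc, ← map_mul, ← map_mul, mul_inv_cancel, map_one, map_one, mul_one]
    intro x
    simpa [Lam.subst_one] using (key x 1).symm

theorem IsBasisConj.tri_magnus [Fintype ι] {θ : ReducedFreeGroup ι →* ReducedFreeGroup ι}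
    (hθ : IsBasisConj θ) (x : ReducedFreeGroup ι) :
    Lam.Tri (magnus ι x) (magnus ι (θ x)) := by
  obtain ⟨y, h0, h1, h⟩ := hθ.exists_subst
  rw [h]
  exact Lam.tri_subst h0 h1 _

/-- The substitution of `exists_subst` is additive and fixes `1`, so it carries the whole sum for
`ξ` to the one for its image. This is the version needed for the sum over pairs. -/
theorem IsBasisConj.tri_magnusRing [Fintype ι] {θ : ReducedFreeGroup ι →* ReducedFreeGroup ι}
    (hθ : IsBasisConj θ) (ξ : ReducedFreeGroup ι →₀ ℤ) :
    Lam.Tri (ξ.sum fun x c => c • (magnus ι x - 1))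
      ((ξ.mapDomain θ).sum fun x c => c • (magnus ι x - 1)) := by
  obtain ⟨y, h0, h1, h⟩ := hθ.exists_subst
  let f : Lam ι →+ Lam ι := AddMonoidHom.mk' (Lam.subst y) (Lam.subst_add y)
  have hf1 : f 1 = 1 := Lam.subst_one y
  have hf : ∀ x, f (magnus ι x) = magnus ι (θ x) := fun x => (h x).symm
  have e : ((ξ.mapDomain θ).sum fun x c => c • (magnus ι x - 1)) =
      Lam.subst y (ξ.sum fun x c => c • (magnus ι x - 1)) := by
    change _ = f _
    rw [Finsupp.sum_mapDomain_index (by simp) (by simp [add_smul]), Finsupp.sum, Finsupp.sum,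
      map_sum]
    refine Finset.sum_congr rfl fun x _ => ?_
    rw [map_zsmul, map_sub, hf1, hf]
  rw [e]
  exact Lam.tri_subst h0 h1 _

/-- Take `d = 0` in `Tri`: below the leading monomial every non-constant coefficient vanishes, so up
to and including that monomial the two expansions have the same non-constant coefficients. -/
theorem IsPositive.of_tri [LT ι] {x x' : ReducedFreeGroup ι} (hx : IsPositive x)
    (h : Lam.Tri (magnus ι x) (magnus ι x')) (h1 : x = 1 → x' = 1) : IsPositive x' := by
  rcases hx with hx | ⟨I, hI, hpos, hlt⟩
  · exact Or.inl (h1 hx)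
  · have hz : ∀ J : NRSeq ι, (monomialLT J I ∨ J = I) →
        (magnus ι x').coeff J = (magnus ι x).coeff J := by
      intro J hJ
      have := h J 0 fun K hK0 hK hKs => by
        have hl := Lam.length_lt_of_sublist hKs hK
        rw [hlt K hK0]
        rcases hJ with hJ | rfl
        · refine Or.inl (lt_of_lt_of_le hl ?_)
          rcases hJ with hJ | hJ
          exacts [hJ.le, hJ.1.le]
        · exact Or.inl hl
      rwa [zero_dvd_iff, sub_eq_zero] at this
    refine Or.inr ⟨I, hI, ?_, fun J hJ hJI => ?_⟩
    · rwa [hz I (Or.inr rfl)]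
    · rw [hz J (Or.inl hJI), hlt J hJ hJI]

end BasisConj

/-! ## Injectivity of the reduced Magnus expansion -/

section MagnusInjective

variable {ι : Type*}

theorem IsReducedFamily.commute_of_mem {G : Type*} [Group G] {x : ι → G} (hx : IsReducedFamily x)
    {j : ι} {z : G} (hz : z ∈ killed x {j}) : Commute z (x j) := by
  change z ∈ Subgroup.closure _ at hz
  induction hz using Subgroup.closure_induction with
  | mem z hz =>
    obtain ⟨_, ⟨k, hk, rfl⟩, hz⟩ := Group.mem_conjugatesOfSet_iff.1 hz
    obtain ⟨c, rfl⟩ := isConj_iff.1 hz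
    obtain rfl : k = j := hk
    simpa using (hx k c⁻¹).symm
  | one => exact Commute.one_left _
  | mul a b _ _ ha hb => exact ha.mul_left hb
  | inv a _ ha => exact ha.inv_left

/-- The normal closure of a single member is thus abelian, which later allows its elements to be
written as products of powers. -/
theorem IsReducedFamily.commute_of_mem_of_mem {G : Type*} [Group G] {x : ι → G}
    (hx : IsReducedFamily x) {j : ι} {z w : G} (hz : z ∈ killed x {j}) (hw : w ∈ killed x {j}) :
    Commute z w := by
  change w ∈ Subgroup.closure _ at hw
  induction hw using Subgroup.closure_induction with
  | mem w hw =>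
    obtain ⟨_, ⟨k, hk, rfl⟩, hw⟩ := Group.mem_conjugatesOfSet_iff.1 hw
    obtain ⟨c, rfl⟩ := isConj_iff.1 hw
    obtain rfl : k = j := hk
    have h1 : c⁻¹ * z * c ∈ killed x {k} := by
      simpa [killed] using Subgroup.normalClosure_normal.conj_mem z hz c⁻¹
    have := (hx.commute_of_mem h1).map (MulAut.conj c).toMonoidHom
    simpa [mul_assoc] using this
  | one => exact Commute.one_right _
  | mul a b _ _ ha hb => exact ha.mul_right hb
  | inv a _ ha => exact ha.inv_right

/-- The multiplicative map of `Λ` that kills the variables outside `T`. -/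
def Lam.restrict (T : Set ι) : Lam ι →* Lam ι where
  toFun W := fun I => if ∀ j ∈ I.1, j ∈ T then W.coeff I else 0
  map_one' := by
    ext I
    change (if ∀ j ∈ I.1, j ∈ T then (1 : Lam ι).coeff I else 0) = (1 : Lam ι).coeff I
    split_ifs with h
    · rfl
    · rw [Lam.one_coeff, if_neg]
      rintro hI
      exact h (by simp [hI])
  map_mul' V W := by
    ext I
    change (if ∀ j ∈ I.1, j ∈ T then (V * W).coeff I else 0) =
      ∑ k ∈ Finset.range (I.1.length + 1),
        (if ∀ j ∈ (I.take k).1, j ∈ T then V.coeff (I.take k) else 0) *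
          (if ∀ j ∈ (I.drop k).1, j ∈ T then W.coeff (I.drop k) else 0)
    by_cases h : ∀ j ∈ I.1, j ∈ T
    · rw [if_pos h, Lam.mul_coeff]
      refine Finset.sum_congr rfl fun k _ => ?_
      have h1 : ∀ j ∈ (I.take k).1, j ∈ T := fun j hj => h j (List.mem_of_mem_take hj)
      have h2 : ∀ j ∈ (I.drop k).1, j ∈ T := fun j hj => h j (List.mem_of_mem_drop hj)
      rw [if_pos h1, if_pos h2]
    · rw [if_neg h]
      refine (Finset.sum_eq_zero fun k _ => ?_).symm
      by_cases h1 : ∀ j ∈ (I.take k).1, j ∈ T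
      · suffices h3 : ¬ ∀ j ∈ (I.drop k).1, j ∈ T by rw [if_neg h3, mul_zero]
        refine fun h2 => h fun j hj => ?_
        rw [← List.take_append_drop k I.1, List.mem_append] at hj
        exact hj.elim (h1 j) (h2 j)
      · rw [if_neg h1, zero_mul]

theorem Lam.restrict_coeff (T : Set ι) (W : Lam ι) (I : NRSeq ι) :
    (Lam.restrict T W).coeff I = if ∀ j ∈ I.1, j ∈ T then W.coeff I else 0 := rfl

/-- The retraction of the reduced free group that kills the generators outside `T`. -/
def collapse (T : Set ι) : ReducedFreeGroup ι →* ReducedFreeGroup ι :=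
  reducedLift (fun j => if j ∈ T then rgen j else 1) (by
    intro j g
    rw [relator_eq_one_iff]
    split_ifs
    · exact isReducedFamily_rgen j g
    · exact Commute.one_left _)

theorem collapse_rgen (T : Set ι) (j : ι) :
    collapse T (rgen j) = if j ∈ T then rgen j else 1 := reducedLift_rgen _ j

theorem magnus_collapse (T : Set ι) (x : ReducedFreeGroup ι) :
    magnus ι (collapse T x) = Lam.restrict T (magnus ι x) := by
  have : (magnus ι).comp (collapse T) = (Lam.restrict T).comp (magnus ι) := by
    refine ReducedFreeGroup.hom_ext fun j => ?_
    ext I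
    simp only [MonoidHom.comp_apply, collapse_rgen, magnus_rgen, Lam.restrict_coeff,
      Lam.add_coeff]
    by_cases hj : j ∈ T
    · rw [if_pos hj, magnus_rgen, Lam.add_coeff]
      split_ifs with h
      · rfl
      · rw [Lam.one_coeff, Lam.X_coeff, if_neg, if_neg, add_zero]
        · rintro hI; exact h (by simpa [hI] using hj)
        · rintro hI; exact h (by simp [hI])
    · rw [if_neg hj, map_one]
      split_ifs with h
      · rw [Lam.X_coeff, if_neg, add_zero]
        rintro hI; exact hj (h j (by simp [hI]))
      · rw [Lam.one_coeff, if_neg]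
        rintro hI; exact h (by simp [hI])
  exact DFunLike.congr_fun this x

theorem collapse_compl_eq_one {j : ι} {z : ReducedFreeGroup ι}
    (hz : z ∈ killed rgen {j}) : collapse ({j}ᶜ) z = 1 := by
  have : killed rgen {j} ≤ (collapse ({j}ᶜ : Set ι)).ker := by
    refine Subgroup.normalClosure_le_normal ?_
    rintro _ ⟨k, rfl, rfl⟩
    simp [MonoidHom.mem_ker, collapse_rgen]
  exact this hz

/-- Modulo `x_j` the retraction that removes `x_j` is the identity, so its kernel lies in the normal
closure of `x_j`. -/
theorem mem_killed_of_collapse_eq_one {j : ι} {z : ReducedFreeGroup ι}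
    (hz : collapse ({j}ᶜ) z = 1) : z ∈ killed rgen {j} := by
  have : (QuotientGroup.mk' (killed rgen {j})).comp (collapse ({j}ᶜ : Set ι)) =
      QuotientGroup.mk' (killed (rgen (ι := ι)) {j}) := by
    refine ReducedFreeGroup.hom_ext fun k => ?_
    rw [MonoidHom.comp_apply, collapse_rgen]
    split_ifs with h
    · rfl
    · obtain rfl : k = j := by simpa using h
      rw [map_one, eq_comm, QuotientGroup.mk'_apply, QuotientGroup.eq_one_iff]
      exact Subgroup.subset_normalClosure ⟨k, rfl, rfl⟩
  have := DFunLike.congr_fun this z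
  rw [MonoidHom.comp_apply, hz, map_one, eq_comm, QuotientGroup.mk'_apply,
    QuotientGroup.eq_one_iff] at this
  exact this

theorem magnus_coeff_of_mem_killed {j : ι} {z : ReducedFreeGroup ι} (hz : z ∈ killed rgen {j})
    {I : NRSeq ι} (hI : j ∉ I.1) : (magnus ι z).coeff I = (1 : Lam ι).coeff I := by
  have := congrArg (fun W => Lam.coeff W I) (magnus_collapse ({j}ᶜ) z)
  simp only [collapse_compl_eq_one hz, map_one, Lam.restrict_coeff] at this
  rw [this, if_pos]
  rintro k hk rfl
  exact hI hk

/-- The left-normed commutators `[…[x_j, x_{k_1}], …, x_{k_r}]`. -/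
def nestedComm (j : ι) (L : List ι) : ReducedFreeGroup ι :=
  L.foldl (fun c k => c⁻¹ * ((rgen k)⁻¹ * c * rgen k)) (rgen j)

theorem nestedComm_append (j k : ι) (L : List ι) : nestedComm j (L ++ [k]) =
    (nestedComm j L)⁻¹ * ((rgen k)⁻¹ * nestedComm j L * rgen k) := by
  simp [nestedComm]

/-- A commutator lies in every normal subgroup that contains one of its two entries. Hence
`nestedComm j L` commutes with all letters that it involves, and further bracketing with one of them
is trivial. -/
theorem nestedComm_mem (j : ι) (L : List ι) :
    ∀ k ∈ j :: L, nestedComm j L ∈ killed rgen {k} := by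
  induction L using List.reverseRecOn with
  | nil =>
    intro k hk
    obtain rfl : k = j := by simpa using hk
    exact Subgroup.subset_normalClosure ⟨k, rfl, rfl⟩
  | append_singleton L l ih =>
    intro k hk
    rw [nestedComm_append]
    have hN : (killed (rgen (ι := ι)) {k}).Normal := Subgroup.normalClosure_normal
    by_cases hkL : k ∈ j :: L
    · have h1 := ih k hkL
      have h2 := hN.conj_mem _ h1 (rgen l)⁻¹
      rw [inv_inv] at h2
      exact mul_mem (inv_mem h1) h2
    · obtain rfl : k = l := by
        simp only [List.mem_cons, List.mem_append, not_or, List.not_mem_nil, or_false] at hk hkL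
        tauto
      have h1 : rgen k ∈ killed (rgen (ι := ι)) {k} := Subgroup.subset_normalClosure ⟨k, rfl, rfl⟩
      have h2 := hN.conj_mem _ (inv_mem h1) (nestedComm j L)⁻¹
      have := mul_mem h2 h1
      simpa [mul_assoc] using this

/-- The indices of a basis of the normal closure of `x_j`. -/
abbrev CommIdx (j : ι) : Type _ := {K : NRSeq ι // j ∉ K.1}

/-- The sequence `j, K`. -/
def CommIdx.cons {j : ι} (K : CommIdx j) : NRSeq ι :=
  ⟨j :: K.1.1, List.nodup_cons.2 ⟨K.2, K.1.2⟩⟩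

/-- The span of the nested commutators is stable under conjugation by each generator `x_k`: either
`k` already occurs and nothing changes, or the conjugate is the commutator times the one extended by
`k` (or its inverse). Being normal and containing `x_j`, the span contains the normal closure. -/
theorem killed_le_closure_nestedComm (j : ι) : killed rgen {j} ≤
    Subgroup.closure (Set.range fun K : CommIdx j => nestedComm j K.1.1) := by
  set M := Subgroup.closure (Set.range fun K : CommIdx j => nestedComm j K.1.1)
  have hgen : ∀ (k : ι) (K : CommIdx j),
      (rgen k)⁻¹ * nestedComm j K.1.1 * rgen k ∈ M ∧
        rgen k * nestedComm j K.1.1 * (rgen k)⁻¹ ∈ M := by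
    intro k K
    have hc : nestedComm j K.1.1 ∈ M := Subgroup.subset_closure ⟨K, rfl⟩
    by_cases hk : k ∈ j :: K.1.1
    · have := isReducedFamily_rgen.commute_of_mem (nestedComm_mem j K.1.1 k hk)
      rw [mul_assoc, this.eq, inv_mul_cancel_left, ← this.eq, mul_inv_cancel_right]
      exact ⟨hc, hc⟩
    · have hnd : (K.1.1 ++ [k]).Nodup := by
        rw [List.nodup_append]
        refine ⟨K.1.2, by simp, ?_⟩
        rintro a ha b hb rfl
        simp only [List.mem_singleton] at hb
        exact hk (by simp [← hb, ha])
      have hj : j ∉ K.1.1 ++ [k] := by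
        have := K.2
        simp only [List.mem_cons, not_or] at hk
        simp [this, Ne.symm hk.1]
      have hd : nestedComm j (K.1.1 ++ [k]) ∈ M :=
        Subgroup.subset_closure ⟨⟨⟨_, hnd⟩, hj⟩, rfl⟩
      have hcomm := isReducedFamily_rgen.commute_of_mem
        (nestedComm_mem j (K.1.1 ++ [k]) k (by simp))
      have e1 : (rgen k)⁻¹ * nestedComm j K.1.1 * rgen k =
          nestedComm j K.1.1 * nestedComm j (K.1.1 ++ [k]) := by
        rw [nestedComm_append]; group
      -- Conjugation in the other direction inverts the correction factor, because that factor
      -- commutes with `rgen k`.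
      have e2 : rgen k * nestedComm j K.1.1 * (rgen k)⁻¹ =
          nestedComm j K.1.1 * (nestedComm j (K.1.1 ++ [k]))⁻¹ := by
        have h1 := e1
        rw [mul_assoc, inv_mul_eq_iff_eq_mul] at h1
        rw [mul_inv_eq_iff_eq_mul, mul_assoc, hcomm.inv_left.eq, ← mul_assoc, h1]
        group
      rw [e1, e2]
      exact ⟨mul_mem hc hd, mul_mem hc (inv_mem hd)⟩
  have hgen' : ∀ (k : ι), ∀ m ∈ M, (rgen k)⁻¹ * m * rgen k ∈ M ∧ rgen k * m * (rgen k)⁻¹ ∈ M := by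
    intro k m hm
    induction hm using Subgroup.closure_induction with
    | mem m hm => obtain ⟨K, rfl⟩ := hm; exact hgen k K
    | one => simp
    | mul a b _ _ ha hb =>
      constructor
      · simpa [mul_assoc] using mul_mem ha.1 hb.1
      · simpa [mul_assoc] using mul_mem ha.2 hb.2
    | inv a _ ha =>
      constructor
      · simpa [mul_assoc] using inv_mem ha.1
      · simpa [mul_assoc] using inv_mem ha.2
  have hall : ∀ g : ReducedFreeGroup ι, ∀ m ∈ M, g⁻¹ * m * g ∈ M ∧ g * m * g⁻¹ ∈ M := by
    intro g
    have hg : g ∈ Subgroup.closure (Set.range (rgen : ι → ReducedFreeGroup ι)) := by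
      rw [closure_range_rgen]; trivial
    induction hg using Subgroup.closure_induction with
    | mem g hg => obtain ⟨k, rfl⟩ := hg; exact hgen' k
    | one => simp
    | mul a b _ _ ha hb =>
      intro m hm
      have h1 := (hb _ (ha m hm).1).1
      have h2 := (ha _ (hb m hm).2).2
      exact ⟨by simpa [mul_assoc] using h1, by simpa [mul_assoc] using h2⟩
    | inv a _ ha =>
      intro m hm
      rw [inv_inv]
      exact (ha m hm).symm
  have : M.Normal := ⟨fun m hm g => (hall g m hm).2⟩
  refine Subgroup.normalClosure_le_normal ?_
  rintro _ ⟨k, rfl, rfl⟩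
  exact Subgroup.subset_closure ⟨⟨⟨[], List.nodup_nil⟩, by simp⟩, rfl⟩

/-- A proper right part of `j, K` omits `j`, where an element of the normal closure of `x_j` has
only its constant term. So the mixed terms of the product vanish and the coefficient is additive. -/
theorem magnus_mul_coeff_cons {j : ι} {z w : ReducedFreeGroup ι} (hw : w ∈ killed rgen {j})
    (K : CommIdx j) : (magnus ι (z * w)).coeff K.cons =
      (magnus ι z).coeff K.cons + (magnus ι w).coeff K.cons := by
  rw [map_mul, Lam.mul_coeff, Finset.sum_range_succ, Finset.sum_eq_single 0]
  · have e1 : K.cons.take K.cons.1.length = K.cons := Subtype.ext (by simp [NRSeq.take])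
    have e2 : K.cons.drop 0 = K.cons := Subtype.ext (by simp [NRSeq.drop])
    rw [e1, e2, magnus_nil _ (K.cons.take 0) (by simp [NRSeq.take]),
      magnus_nil _ (K.cons.drop _) (by simp [NRSeq.drop]), one_mul, mul_one, add_comm]
  · intro k hk hk0
    rw [magnus_coeff_of_mem_killed hw, Lam.one_coeff, if_neg, mul_zero]
    · intro h
      have := congrArg List.length h
      simp only [NRSeq.drop, List.length_drop, List.length_nil, Finset.mem_range] at this hk
      omega
    · obtain ⟨k, rfl⟩ := Nat.exists_eq_succ_of_ne_zero hk0
      intro h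
      exact K.2 (List.mem_of_mem_drop (by simpa [NRSeq.drop, CommIdx.cons] using h))
  · intro h
    simp [CommIdx.cons] at h

/-- In `(1 - X_k) E(z) (1 + X_k)`, terms with `X_k` on the left start with `k` and do not contribute
to a sequence that starts with `j ≠ k`. -/
theorem magnus_conj_coeff_cons {j k : ι} (hk : k ≠ j) (z : ReducedFreeGroup ι) (K : CommIdx j) :
    (magnus ι ((rgen k)⁻¹ * z * rgen k)).coeff K.cons =
      (magnus ι z).coeff K.cons + (magnus ι z * Lam.X k).coeff K.cons := by
  have e : magnus ι (rgen k)⁻¹ = 1 + -Lam.X k := by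
    have h1 := magnus_inv_mul (rgen k)
    rw [magnus_rgen] at h1
    have h2 : (1 + Lam.X k) * (1 + -Lam.X k) = 1 := by
      have := Lam.X_mul_X k
      simp [mul_add, add_mul, this]
    calc magnus ι (rgen k)⁻¹ = magnus ι (rgen k)⁻¹ * ((1 + Lam.X k) * (1 + -Lam.X k)) := by
          rw [h2, mul_one]
      _ = _ := by rw [← mul_assoc, h1, one_mul]
  have hX : ∀ V : Lam ι, (Lam.X k * V).coeff K.cons = 0 := by
    intro V
    rw [Lam.mul_coeff]
    refine Finset.sum_eq_zero fun m _ => ?_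
    rw [Lam.X_coeff, if_neg, zero_mul]
    intro h
    cases m with
    | zero => simp [NRSeq.take] at h
    | succ m =>
      simp only [NRSeq.take, CommIdx.cons, List.take_succ_cons, List.cons.injEq] at h
      exact hk h.1.symm
  rw [map_mul, map_mul, e, magnus_rgen, mul_assoc, add_mul, one_mul, neg_mul, Lam.add_coeff,
    Lam.neg_coeff, hX, neg_zero, add_zero, mul_add, mul_one, Lam.add_coeff]

/-- Bracketing with `x_k` multiplies by `X_k` on the right, as seen by the coefficients starting
with `j`. The nested commutators are thus dual to these coefficients. -/
theorem magnus_nestedComm_coeff (j : ι) (L : List ι) (hL : (j :: L).Nodup) (K : CommIdx j) :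
    (magnus ι (nestedComm j L)).coeff K.cons = if K.1.1 = L then 1 else 0 := by
  induction L using List.reverseRecOn generalizing K with
  | nil =>
    change (magnus ι (rgen j)).coeff _ = _
    rw [magnus_rgen, Lam.add_coeff, Lam.one_coeff, Lam.X_coeff]
    simp [CommIdx.cons]
  | append_singleton L k ih =>
    have hL' : (j :: L).Nodup := hL.sublist (by simp)
    have hk : k ≠ j := by
      rintro rfl
      simp at hL
    have hmem := nestedComm_mem j L j (by simp)
    have hN : (killed (rgen (ι := ι)) {j}).Normal := Subgroup.normalClosure_normal
    have hmem2 := hN.conj_mem _ hmem (rgen k)⁻¹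
    rw [inv_inv] at hmem2
    have h0 := magnus_mul_coeff_cons (z := (nestedComm j L)⁻¹) hmem K
    rw [inv_mul_cancel, map_one, Lam.one_coeff, if_neg (by simp [CommIdx.cons])] at h0
    rw [nestedComm_append, magnus_mul_coeff_cons hmem2, magnus_conj_coeff_cons hk, ← add_assoc,
      ← h0, zero_add]
    split_ifs with h
    · have hnd : L.Nodup := (List.nodup_cons.1 hL').2
      have hj : j ∉ L := (List.nodup_cons.1 hL').1
      have := ih hL' ⟨⟨L, hnd⟩, hj⟩
      rw [if_pos rfl] at this
      rw [← this]
      exact Lam.mul_X_coeff_append (by simp [CommIdx.cons, h])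
    · by_cases h2 : ∃ J, K.1.1 = J ++ [k]
      · obtain ⟨J, hJ⟩ := h2
        have hnd : J.Nodup := K.1.2.sublist (by rw [hJ]; exact List.sublist_append_left _ _)
        have hj : j ∉ J := fun hj => K.2 (by rw [hJ]; simp [hj])
        rw [Lam.mul_X_coeff_append (J := CommIdx.cons ⟨⟨J, hnd⟩, hj⟩)
          (by simp [CommIdx.cons, hJ]), ih hL', if_neg]
        rintro rfl
        exact h hJ
      · refine Lam.mul_X_coeff_eq_zero fun J hJ => ?_
        cases J with
        | nil => simp [CommIdx.cons] at hJ; exact hk hJ.1.symm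
        | cons a J =>
          simp only [CommIdx.cons, List.cons_append, List.cons.injEq] at hJ
          exact h2 ⟨J, hJ.2⟩

/-- In the abelian normal closure of `x_j`, write `z` as a product of powers of nested commutators;
by duality each exponent is a Magnus coefficient of `z`, hence zero. -/
theorem eq_one_of_mem_killed_of_magnus [Fintype ι] {j : ι} {z : ReducedFreeGroup ι}
    (hz : z ∈ killed rgen {j}) (h : magnus ι z = 1) : z = 1 := by
  let A : CommGroup (killed (rgen (ι := ι)) {j}) :=
    { (inferInstance : Group (killed (rgen (ι := ι)) {j})) with
      mul_comm := fun a b =>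
        Subtype.ext (isReducedFamily_rgen.commute_of_mem_of_mem a.2 b.2) }
  let c : CommIdx j → killed (rgen (ι := ι)) {j} := fun K =>
    ⟨nestedComm j K.1.1, nestedComm_mem j _ j (by simp)⟩
  let lead : CommIdx j → killed (rgen (ι := ι)) {j} →* Multiplicative ℤ := fun K =>
    MonoidHom.mk' (fun m => Multiplicative.ofAdd ((magnus ι m.1).coeff K.cons))
      fun a b => congrArg Multiplicative.ofAdd (magnus_mul_coeff_cons b.2 K)
  have hlead : ∀ K L, lead K (c L) = if L = K then Multiplicative.ofAdd 1 else 1 := by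
    intro K L
    have := magnus_nestedComm_coeff j L.1.1 (List.nodup_cons.2 ⟨L.2, L.1.2⟩) K
    change Multiplicative.ofAdd ((magnus ι (nestedComm j L.1.1)).coeff K.cons) = _
    rw [this]
    by_cases hKL : L = K
    · simp [hKL]
    · rw [if_neg hKL, if_neg, ofAdd_zero]
      exact fun e => hKL (Subtype.ext (Subtype.ext e.symm))
  have key : ∀ m ∈ Subgroup.closure (Set.range fun K : CommIdx j => nestedComm j K.1.1),
      ∃ (hm : m ∈ killed rgen {j}) (a : CommIdx j → ℤ),
        (⟨m, hm⟩ : killed (rgen (ι := ι)) {j}) = ∏ K, c K ^ a K := by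
    intro m hm
    induction hm using Subgroup.closure_induction with
    | mem m hm =>
      obtain ⟨K, rfl⟩ := hm
      refine ⟨(c K).2, fun L => if L = K then 1 else 0, ?_⟩
      rw [Finset.prod_eq_single K]
      · simp [c]
      · intro L _ hL; simp [hL]
      · simp
    | one => exact ⟨one_mem _, 0, by simp⟩
    | mul x y _ _ hx hy =>
      obtain ⟨h1, a, ha⟩ := hx
      obtain ⟨h2, b, hb⟩ := hy
      refine ⟨mul_mem h1 h2, a + b, ?_⟩
      simp only [Pi.add_apply, zpow_add, Finset.prod_mul_distrib, ← ha, ← hb]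
      rfl
    | inv x _ hx =>
      obtain ⟨h1, a, ha⟩ := hx
      refine ⟨inv_mem h1, -a, ?_⟩
      simp only [Pi.neg_apply, zpow_neg, Finset.prod_inv_distrib, ← ha]
      rfl
  obtain ⟨hm, a, ha⟩ := key z (killed_le_closure_nestedComm j hz)
  have ha0 : ∀ K, a K = 0 := by
    intro K
    have h1 := congrArg (lead K) ha
    rw [map_prod, Finset.prod_eq_single K] at h1
    · rw [map_zpow, hlead, if_pos rfl] at h1
      change Multiplicative.ofAdd ((magnus ι z).coeff K.cons) = _ at h1
      rw [h, Lam.one_coeff, if_neg (by simp [CommIdx.cons]), ← ofAdd_zsmul] at h1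
      simpa using h1.symm
    · intro L _ hL
      rw [map_zpow, hlead, if_neg hL, one_zpow]
    · simp
  have : (⟨z, hm⟩ : killed (rgen (ι := ι)) {j}) = 1 := by
    rw [ha]
    exact Finset.prod_eq_one fun K _ => by rw [ha0, zpow_zero]
  exact congrArg Subtype.val this

/-- The reduced Magnus expansion is injective. -/
theorem eq_one_of_magnus_eq_one [Fintype ι] {x : ReducedFreeGroup ι} (h : magnus ι x = 1) :
    x = 1 := by
  have hcomp : ∀ (S T : Set ι), (collapse S).comp (collapse T) = collapse (S ∩ T) := by
    intro S T
    refine ReducedFreeGroup.hom_ext fun j => ?_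
    rw [MonoidHom.comp_apply, collapse_rgen, collapse_rgen]
    by_cases h1 : j ∈ T <;> by_cases h2 : j ∈ S <;> simp [h1, h2, collapse_rgen]
  -- Generators are restored one at a time. If `x` is trivial over `T`, then over `insert j T` it
  -- lies in the normal closure of `x_j`, and its expansion is still `1`, so the previous lemma
  -- applies.
  have key : ∀ T : Finset ι, collapse (T : Set ι) x = 1 := by
    intro T
    induction T using Finset.induction_on with
    | empty =>
      have : collapse ((∅ : Finset ι) : Set ι) = 1 := ReducedFreeGroup.hom_ext fun j => by
        simp [collapse_rgen]
      rw [this]; rfl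
    | insert j T hj ih =>
      refine eq_one_of_mem_killed_of_magnus (j := j) (mem_killed_of_collapse_eq_one ?_) ?_
      · have e : ({j}ᶜ : Set ι) ∩ ((insert j T : Finset ι) : Set ι) = (T : Set ι) := by
          ext k
          by_cases hk : k = j <;> simp [hk, hj]
        rw [← MonoidHom.comp_apply, hcomp, e, ih]
      · rw [magnus_collapse, h, map_one]
  have h1 := key Finset.univ
  have h2 : collapse ((Finset.univ : Finset ι) : Set ι) = MonoidHom.id _ :=
    ReducedFreeGroup.hom_ext fun j => by simp [collapse_rgen]
  rwa [h2] at h1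

end MagnusInjective

/-! ## Basis-conjugating automorphisms and positive elements -/

section Positive

variable {ι : Type*}

/-- If `θ x = 1`, the triangular change can be inverted from `1`, which has no non-constant
coefficients; so the expansion of `x` is `1`. -/
theorem IsBasisConj.injective [Fintype ι] {θ : ReducedFreeGroup ι →* ReducedFreeGroup ι}
    (hθ : IsBasisConj θ) : Function.Injective θ := by
  rw [injective_iff_map_eq_one]
  intro x hx
  refine eq_one_of_magnus_eq_one (Lam.ext fun I => ?_)
  have h := (hθ.tri_magnus x).symm
  rw [hx, map_one] at h
  have := h I 0 fun J hJ _ _ => by rw [Lam.one_coeff, if_neg hJ]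
  rwa [zero_dvd_iff, sub_eq_zero] at this

/-- The images of the generators form a reduced family that normally generates the group, and such a
finite family generates. -/
theorem IsBasisConj.surjective [Fintype ι] {θ : ReducedFreeGroup ι →* ReducedFreeGroup ι}
    (hθ : IsBasisConj θ) : Function.Surjective θ := by
  choose g hg using id hθ
  have hr : IsReducedFamily (fun j => θ (rgen j)) := by
    have := (isReducedFamily_rgen (ι := ι)).conj g
    simpa only [← hg] using this
  have htop : Subgroup.normalClosure (Set.range fun j => θ (rgen j)) = ⊤ := by
    rw [eq_top_iff, ← closure_range_rgen, Subgroup.closure_le]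
    rintro _ ⟨j, rfl⟩
    have h1 : θ (rgen j) ∈ Subgroup.normalClosure (Set.range fun j => θ (rgen j)) :=
      Subgroup.subset_normalClosure ⟨j, rfl⟩
    have := Subgroup.normalClosure_normal.conj_mem _ h1 (g j)
    rw [hg] at this
    simpa [mul_assoc] using this
  rw [← MonoidHom.range_eq_top, eq_top_iff, ← hr.closure_eq_top htop, Subgroup.closure_le]
  rintro _ ⟨j, rfl⟩
  exact ⟨_, rfl⟩

theorem IsBasisConj.comp {θ θ' : ReducedFreeGroup ι →* ReducedFreeGroup ι}
    (hθ : IsBasisConj θ) (hθ' : IsBasisConj θ') : IsBasisConj (θ.comp θ') := by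
  intro j
  obtain ⟨g, hg⟩ := hθ' j
  obtain ⟨c, hc⟩ := hθ j
  refine ⟨c * θ g, ?_⟩
  rw [MonoidHom.comp_apply, hg, map_mul, map_mul, hc, map_inv]
  group

theorem IsBasisConj.conj (c : ReducedFreeGroup ι) :
    IsBasisConj (MulAut.conj c).toMonoidHom := fun j => ⟨c⁻¹, by simp⟩

theorem IsBasisConj.exists_inverse [Fintype ι] {θ : ReducedFreeGroup ι →* ReducedFreeGroup ι}
    (hθ : IsBasisConj θ) : ∃ θ' : ReducedFreeGroup ι →* ReducedFreeGroup ι,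
      IsBasisConj θ' ∧ ∀ x, θ' (θ x) = x := by
  let e := MulEquiv.ofBijective θ ⟨hθ.injective, hθ.surjective⟩
  have he : ∀ x, e.symm (θ x) = x := fun x => e.symm_apply_apply x
  refine ⟨e.symm.toMonoidHom, fun j => ?_, he⟩
  obtain ⟨g, hg⟩ := hθ j
  refine ⟨(e.symm g)⁻¹, ?_⟩
  have h2 : rgen j = g * θ (rgen j) * g⁻¹ := by rw [hg]; group
  conv_lhs => rw [h2]
  change e.symm _ = _
  rw [map_mul, map_mul, he, map_inv, inv_inv]

theorem IsBasisConj.isPositive_iff [Fintype ι] [LT ι]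
    {θ : ReducedFreeGroup ι →* ReducedFreeGroup ι} (hθ : IsBasisConj θ)
    (x : ReducedFreeGroup ι) : IsPositive (θ x) ↔ IsPositive x :=
  ⟨fun h => h.of_tri (hθ.tri_magnus x).symm fun e => hθ.injective (by rw [e, map_one]),
    fun h => h.of_tri (hθ.tri_magnus x) fun e => by rw [e, map_one]⟩

/-- The positive one among `g` and `g⁻¹`. -/
def posn [LT ι] (g : ReducedFreeGroup ι) : ReducedFreeGroup ι := if IsPositive g then g else g⁻¹

theorem IsBasisConj.posn [Fintype ι] [LT ι]
    {θ : ReducedFreeGroup ι →* ReducedFreeGroup ι} (hθ : IsBasisConj θ)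
    (x : ReducedFreeGroup ι) : posn (θ x) = θ (posn x) := by
  unfold CutDiag.posn
  rw [hθ.isPositive_iff]
  split_ifs <;> simp

theorem posn_one [LT ι] : posn (1 : ReducedFreeGroup ι) = 1 := by
  unfold posn
  split_ifs <;> simp

/-- Linearity of the order on indices makes the leading monomial unique, so positivity can be tested
at any monomial known to be leading. -/
theorem isPositive_iff_of_leading [LinearOrder ι] {x : ReducedFreeGroup ι} (hx : x ≠ 1)
    {I : NRSeq ι} (hI : I.1 ≠ []) (h0 : (magnus ι x).coeff I ≠ 0)
    (hlt : ∀ J : NRSeq ι, J.1 ≠ [] → monomialLT J I → (magnus ι x).coeff J = 0) :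
    IsPositive x ↔ 0 < (magnus ι x).coeff I := by
  constructor
  · rintro (h | ⟨J, hJ, hpos, hJlt⟩)
    · exact absurd h hx
    · have hnot : ¬ monomialLT J I := fun h => hpos.ne' (hlt J hJ h)
      have hnot' : ¬ monomialLT I J := fun h => h0 (hJlt I hI h)
      have : J = I := by
        simp only [monomialLT, not_or, not_and] at hnot hnot'
        have hl : J.1.length = I.1.length := by omega
        exact Subtype.ext (le_antisymm (not_lt.1 (hnot'.2 hl.symm)) (not_lt.1 (hnot.2 hl)))
      rwa [← this]
  · exact fun h => Or.inr ⟨I, hI, h, hlt⟩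

/-- A non-trivial element has a leading monomial by injectivity of the expansion, and its inverse
has the same leading monomial with the opposite coefficient. -/
theorem isPositive_inv_iff [Fintype ι] [LinearOrder ι] {x : ReducedFreeGroup ι} (hx : x ≠ 1) :
    IsPositive x⁻¹ ↔ ¬ IsPositive x := by
  have hne : (Finset.univ.filter fun I : NRSeq ι =>
      I.1 ≠ [] ∧ (magnus ι x).coeff I ≠ 0).Nonempty := by
    by_contra h
    rw [Finset.not_nonempty_iff_eq_empty, Finset.filter_eq_empty_iff] at h
    refine hx (eq_one_of_magnus_eq_one (Lam.ext fun I => ?_))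
    rw [Lam.one_coeff]
    split_ifs with hI
    · exact magnus_nil x I hI
    · by_contra h2
      exact h (Finset.mem_univ I) ⟨hI, h2⟩
  obtain ⟨I, hI, hmin⟩ := Finset.exists_min_image _
    (fun I : NRSeq ι => toLex (I.1.length, I.1)) hne
  simp only [Finset.mem_filter, Finset.mem_univ, true_and] at hI hmin
  have hlt : ∀ J : NRSeq ι, J.1 ≠ [] → monomialLT J I → (magnus ι x).coeff J = 0 := by
    intro J hJ hJI
    by_contra h
    refine absurd (hmin J ⟨hJ, h⟩) (not_le.2 ?_)
    rw [Prod.Lex.toLex_lt_toLex]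
    exact hJI
  -- Compare coefficients in `E(x) E(x⁻¹) = 1`: the mixed terms involve non-constant coefficients of
  -- `E(x)` in degree below the leading one, which vanish.
  have hinv : ∀ J : NRSeq ι, J.1 ≠ [] → J.1.length ≤ I.1.length →
      (magnus ι x⁻¹).coeff J = -(magnus ι x).coeff J := by
    intro J hJ hl
    have h1 := congrArg (fun W => Lam.coeff W J) (magnus_mul_inv x)
    simp only [Lam.mul_coeff, Lam.one_coeff, if_neg hJ] at h1
    have hpos : 0 < J.1.length := List.length_pos_iff.2 hJ
    have e1 : J.take J.1.length = J := Subtype.ext (by simp [NRSeq.take])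
    have e2 : J.drop 0 = J := Subtype.ext (by simp [NRSeq.drop])
    rw [Finset.sum_range_succ, Finset.sum_eq_single 0, e1, e2,
      magnus_nil _ (J.take 0) (by simp [NRSeq.take]),
      magnus_nil _ (J.drop _) (by simp [NRSeq.drop]), one_mul, mul_one] at h1
    · omega
    · intro k hk hk0
      rw [Finset.mem_range] at hk
      rw [hlt (J.take k), zero_mul]
      · intro h
        have := Lam.length_take_lt hk
        rw [h, List.length_nil] at this
        omega
      · refine Or.inl ?_
        rw [Lam.length_take_lt hk]
        omega
    · exact fun h => absurd (Finset.mem_range.2 hpos) h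
  have hI' := hinv I hI.1 le_rfl
  rw [isPositive_iff_of_leading hx hI.1 hI.2 hlt,
    isPositive_iff_of_leading (x := x⁻¹) (inv_ne_one.2 hx) hI.1 (by rw [hI']; simpa using hI.2)
      (fun J hJ hJI => by
        rw [hinv J hJ (by rcases hJI with h | h; exacts [h.le, h.1.le]), hlt J hJ hJI, neg_zero]),
    hI']
  have := hI.2
  omega

theorem posn_inv [Fintype ι] [LinearOrder ι] (x : ReducedFreeGroup ι) : posn x⁻¹ = posn x := by
  by_cases hx : x = 1
  · simp [hx]
  · unfold posn
    by_cases h : IsPositive x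
    · rw [if_pos h, if_neg (by rw [isPositive_inv_iff hx]; exact not_not.2 h), inv_inv]
    · rw [if_neg h, if_pos ((isPositive_inv_iff hx).2 h)]

end Positive

/-! ## Regions and potentials -/

theorem width_succ {w : List Slice} {t : ℕ} {s : Slice} (h : w[t]? = some s) :
    width w (t + 1) = width w t - s.piece.bot + s.piece.top := by
  simp [width, List.take_add_one, h]

namespace CutData

variable {n : ℕ} (C : CutData n) {H K : Type*} [Group H] [Group K]

theorem reg_eq {j : Fin n} {t g : ℕ} (ht : t ≤ (C.word j).length) (hg : g ≤ width (C.word j) t) :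
    C.reg j t g = Quot.mk _ ⟨(j, t, g), ht, hg⟩ := by
  unfold reg region
  congr 1
  apply Subtype.ext
  simp [min_eq_left ht, min_eq_left hg]

theorem comp_reg (j : Fin n) (t g : ℕ) : (C.reg j t g).comp = j := rfl

theorem exists_reg (A : Region C.word) : ∃ j t g, t ≤ (C.word j).length ∧
    g ≤ width (C.word j) t ∧ A = C.reg j t g := by
  induction A using Quot.ind with
  | mk a => exact ⟨_, _, _, a.2.1, a.2.2, (C.reg_eq a.2.1 a.2.2).symm⟩

theorem comp_leftReg (j : Fin n) (t p : ℕ) : (C.leftReg j t p).comp = j := by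
  unfold leftReg; split_ifs <;> rfl

theorem comp_rightReg (j : Fin n) (t p : ℕ) : (C.rightReg j t p).comp = j := by
  unfold rightReg; split_ifs <;> rfl

/-- The contribution of a strand that is crossed from its left on the page to its right. -/
def crossVal (v : Region C.word → H) (j : Fin n) (t p : ℕ) : H :=
  if C.up j t p then v (C.label j t p) else (v (C.label j t p))⁻¹

/-- The contribution of the first `g` strands at level `t` of the `j`-th sphere. -/
def leftProd (v : Region C.word → H) (j : Fin n) (t g : ℕ) : H :=
  ((List.range g).map (C.crossVal v j t)).prod

variable {C}

theorem leftProd_zero (v : Region C.word → H) (j : Fin n) (t : ℕ) : C.leftProd v j t 0 = 1 := rfl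

theorem leftProd_succ (v : Region C.word → H) (j : Fin n) (t g : ℕ) :
    C.leftProd v j t (g + 1) = C.leftProd v j t g * C.crossVal v j t g := by
  simp [leftProd, List.range_succ]

theorem map_crossVal (f : H →* K) (v : Region C.word → H) (j : Fin n) (t p : ℕ) :
    f (C.crossVal v j t p) = C.crossVal (fun A => f (v A)) j t p := by
  unfold crossVal; split_ifs <;> simp

theorem map_leftProd (f : H →* K) (v : Region C.word → H) (j : Fin n) (t g : ℕ) :
    f (C.leftProd v j t g) = C.leftProd (fun A => f (v A)) j t g := by
  induction g with
  | zero => simp [leftProd_zero]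
  | succ g ih => rw [leftProd_succ, leftProd_succ, map_mul, ih, map_crossVal]

theorem SameStrand.crossVal_eq {j : Fin n} {t p t' p' : ℕ} (h : C.SameStrand j t p t' p')
    (v : Region C.word → H) : C.crossVal v j t p = C.crossVal v j t' p' := by
  unfold crossVal; rw [h.1, h.2]

theorem leftProd_congr {v : Region C.word → H} {j : Fin n} {t t' g : ℕ}
    (h : ∀ p < g, C.crossVal v j t p = C.crossVal v j t' p) :
    C.leftProd v j t g = C.leftProd v j t' g := by
  unfold leftProd
  congr 1
  exact List.map_congr_left fun p hp => h p (List.mem_range.1 hp)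

/-- The values of `v` satisfy the relations of the group of the diagram. -/
def IsSol (C : CutData n) (v : Region C.word → H) : Prop :=
  ∀ A B L, C.Adjacent A B L → v B = (v L)⁻¹ * v A * v L

theorem IsSol.map {v : Region C.word → H} (hv : C.IsSol v) (f : H →* K) :
    C.IsSol (fun A => f (v A)) := by
  intro A B L h
  simp only [hv A B L h, map_mul, map_inv]

/-- Walking from the outer gap to the right, each strand conjugates by its signed label. Nothing has
to be killed here, since the path is the horizontal one. -/
theorem IsSol.reg_conj {v : Region C.word → H} (hv : C.IsSol v) (j : Fin n) (t g : ℕ)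
    (hg : g ≤ width (C.word j) t) :
    v (C.reg j t g) = (C.leftProd v j t g)⁻¹ * v (C.reg j t 0) * C.leftProd v j t g := by
  induction g with
  | zero => simp [leftProd_zero]
  | succ g ih =>
    have h := hv _ _ _ ⟨j, t, g, hg, rfl, rfl, rfl⟩
    have ih := ih (Nat.le_of_succ_le hg)
    rw [leftProd_succ]
    unfold crossVal
    unfold leftReg rightReg at h
    split_ifs at h ⊢ with hup
    · rw [h, ih]; group
    · have h2 : v (C.reg j t (g + 1)) =
          v (C.label j t g) * v (C.reg j t g) * (v (C.label j t g))⁻¹ := by rw [h]; group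
      rw [h2, ih]; group

end CutData

namespace CutDiagram

variable {n : ℕ} {C : CutDiagram n} {H K : Type*} [Group H] [Group K]

theorem width_succ_ge {j : Fin n} {t : ℕ} {s : Slice} (h : (C.word j)[t]? = some s) :
    s.pos + s.piece.bot ≤ width (C.word j) t ∧
      width (C.word j) (t + 1) + s.piece.bot = width (C.word j) t + s.piece.top := by
  have h1 := C.fits j t s h
  have h2 := width_succ h
  omega

theorem le_length_of_isStrand {j : Fin n} {t p : ℕ} (h : C.IsStrand j t p) :
    t ≤ (C.word j).length := by
  by_contra hlt
  push Not at hlt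
  have h1 : width (C.word j) t = width (C.word j) (C.word j).length := by
    simp [width, List.take_of_length_le hlt.le]
  have h2 := C.closed j
  unfold CutData.IsStrand at h
  omega

theorem reg_left {j : Fin n} {t g : ℕ} {s : Slice} (h : (C.word j)[t]? = some s)
    (hg : g ≤ s.pos) : C.reg j t g = C.reg j (t + 1) g := by
  have ht := (List.getElem?_eq_some_iff.1 h).1
  have hw := width_succ_ge h
  rw [C.reg_eq (by omega) (by omega), C.reg_eq (by omega) (by omega)]
  exact Quot.sound ⟨rfl, rfl, s, h, Or.inl ⟨rfl, hg⟩⟩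

theorem reg_zero {j : Fin n} {t : ℕ} (ht : t ≤ (C.word j).length) :
    C.reg j t 0 = C.reg j 0 0 := by
  induction t with
  | zero => rfl
  | succ t ih =>
    rw [← ih (by omega)]
    exact (reg_left (List.getElem?_eq_getElem (by omega : t < (C.word j).length))
      (Nat.zero_le _)).symm

theorem comp_of_tip {c : Color} {j : Fin n} {t : ℕ} {A L : Region C.word} {ε : Bool}
    (h : C.Tip c j t A L ε) : A.comp = j := by cases h <;> rfl

/-- For `•` the label is the region of the end point; for `∘` it is the region of its partner.
Either way it lies on the same sphere, hence dies when that sphere is killed, and turning around an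
end point costs nothing. -/
theorem comp_label_of_tip {c : Color} {j : Fin n} {t : ℕ} {A L : Region C.word} {ε : Bool}
    (h : C.Tip c j t A L ε) : L.comp = j := by
  cases c with
  | black => rw [C.black_rule j t A L ε h]; exact comp_of_tip h
  | white => exact comp_of_tip (C.white_rule j t A L ε h).2.2

section Potential

variable {v : Region C.word → H} {j : Fin n}

theorem leftProd_left {t g : ℕ} {s : Slice} (h : (C.word j)[t]? = some s) (hg : g ≤ s.pos) :
    C.leftProd v j t g = C.leftProd v j (t + 1) g :=
  CutData.leftProd_congr fun p hp =>
    (C.strand_left j t s h p (lt_of_lt_of_le hp hg)).crossVal_eq v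

/-- The local monodromy is trivial around each piece: opposite orientations cancel at extrema, the
labeling rule at a crossing is the conjugation relation for the under-arcs, and at an end point the
label is killed. -/
theorem leftProd_piece (hv : C.IsSol v) (hk : ∀ A : Region C.word, A.comp = j → v A = 1)
    {t : ℕ} {s : Slice} (h : (C.word j)[t]? = some s) :
    C.leftProd v j t (s.pos + s.piece.bot) = C.leftProd v j (t + 1) (s.pos + s.piece.top) := by
  have h0 := leftProd_left (v := v) h le_rfl
  have hp := C.piece_rule j t s h
  obtain ⟨k, P⟩ := s
  cases P with
  | cup =>
    simp only [Piece.bot, Piece.top, CutData.PieceRule, add_zero] at hp h0 ⊢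
    rw [CutData.leftProd_succ v j (t + 1) (k + 1), CutData.leftProd_succ, h0, mul_assoc]
    unfold CutData.crossVal
    rw [hp.2]
    cases h1 : C.up j (t + 1) k <;> cases h2 : C.up j (t + 1) (k + 1) <;> simp_all
  | cap =>
    simp only [Piece.bot, Piece.top, CutData.PieceRule, add_zero] at hp h0 ⊢
    rw [CutData.leftProd_succ v j t (k + 1), CutData.leftProd_succ, ← h0, mul_assoc]
    unfold CutData.crossVal
    rw [hp.2]
    cases h1 : C.up j t k <;> cases h2 : C.up j t (k + 1) <;> simp_all
  | cross b =>
    simp only [Piece.bot, Piece.top] at hp h0 ⊢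
    rw [CutData.leftProd_succ v j t (k + 1), CutData.leftProd_succ,
      CutData.leftProd_succ v j (t + 1) (k + 1), CutData.leftProd_succ, ← h0, mul_assoc, mul_assoc]
    congr 1
    cases b with
    | true =>
      obtain ⟨h1, h2, h3⟩ := hp
      rw [h1.crossVal_eq v]
      unfold CutData.crossVal
      rw [h1.1, h1.2] at h3
      rw [h2]
      split_ifs at h3 ⊢
      all_goals (try rw [hv _ _ _ h3]; try group)
    | false =>
      obtain ⟨h1, h2, h3⟩ := hp
      rw [h1.crossVal_eq v]
      unfold CutData.crossVal
      rw [h1.1, h1.2] at h3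
      rw [h2]
      split_ifs at h3 ⊢
      all_goals (try rw [hv _ _ _ h3]; try group)
  | birth c =>
    simp only [Piece.bot, Piece.top, add_zero] at h0 ⊢
    have : v (C.label j (t + 1) k) = 1 := hk _ (comp_label_of_tip (CutData.Tip.birth (c := c) k h))
    rw [CutData.leftProd_succ, h0]
    simp [CutData.crossVal, this]
  | death c =>
    simp only [Piece.bot, Piece.top, add_zero] at h0 ⊢
    have : v (C.label j t k) = 1 := hk _ (comp_label_of_tip (CutData.Tip.death (c := c) k h))
    rw [CutData.leftProd_succ, h0]
    simp [CutData.crossVal, this]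

theorem leftProd_right (hv : C.IsSol v) (hk : ∀ A : Region C.word, A.comp = j → v A = 1)
    {t r : ℕ} {s : Slice} (h : (C.word j)[t]? = some s)
    (hr : s.pos + s.piece.bot + r ≤ width (C.word j) t) :
    C.leftProd v j t (s.pos + s.piece.bot + r) =
      C.leftProd v j (t + 1) (s.pos + s.piece.top + r) := by
  induction r with
  | zero => exact leftProd_piece hv hk h
  | succ r ih =>
    rw [← add_assoc, ← add_assoc, CutData.leftProd_succ, CutData.leftProd_succ,
      ih (by omega), (C.strand_right j t s h r (by omega)).crossVal_eq v]

/-- If `v` kills the regions of the `j`-th sphere, then the product of the contributions of the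
strands on the left of a gap only depends on the region of that gap. -/
theorem leftProd_eq_of_reg_eq (hv : C.IsSol v)
    (hk : ∀ A : Region C.word, A.comp = j → v A = 1) {t g t' g' : ℕ}
    (ht : t ≤ (C.word j).length) (hg : g ≤ width (C.word j) t)
    (ht' : t' ≤ (C.word j).length) (hg' : g' ≤ width (C.word j) t')
    (h : C.reg j t g = C.reg j t' g') : C.leftProd v j t g = C.leftProd v j t' g' := by
  -- The default value `1` on the other spheres lets the potential descend to all regions at once.
  let f : Region C.word → H := Quot.lift
    (fun x => if x.1.1 = j then C.leftProd v j x.1.2.1 x.1.2.2 else 1) (by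
      rintro ⟨⟨j₁, t₁, g₁⟩, h₁⟩ ⟨⟨j₂, t₂, g₂⟩, h₂⟩ ⟨e1, e2, s, hs, hor⟩
      dsimp only at e1 e2 hs hor h₁ h₂ ⊢
      subst e1 e2
      split_ifs with hj
      · subst hj
        rcases hor with ⟨rfl, hle⟩ | ⟨hb, htop, he⟩
        · exact leftProd_left hs hle
        · obtain ⟨r, rfl⟩ := Nat.exists_eq_add_of_le hb
          obtain rfl : g₂ = s.pos + s.piece.top + r := by omega
          exact leftProd_right hv hk hs h₁.2
      · rfl)
  have := congrArg f h
  rw [C.reg_eq ht hg, C.reg_eq ht' hg'] at this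
  simpa [f] using this

end Potential

/-- The potential of a region: the contribution of the strands on the left of some gap in it. -/
def pot (v : Region C.word → H) (A : Region C.word) : H :=
  C.leftProd v A.comp (Quot.out A).1.2.1 (Quot.out A).1.2.2

theorem map_pot (f : H →* K) (v : Region C.word → H) (A : Region C.word) :
    f (pot v A) = pot (fun A => f (v A)) A := CutData.map_leftProd f v _ _ _

theorem pot_reg {v : Region C.word → H} {j : Fin n} (hv : C.IsSol v)
    (hk : ∀ A : Region C.word, A.comp = j → v A = 1) {t g : ℕ}
    (ht : t ≤ (C.word j).length) (hg : g ≤ width (C.word j) t) :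
    pot v (C.reg j t g) = C.leftProd v j t g := by
  unfold pot
  rw [C.comp_reg]
  have h1 := Quot.out_eq (C.reg j t g)
  set x := Quot.out (C.reg j t g) with hx
  have hj : x.1.1 = j := congrArg Region.comp h1
  obtain ⟨⟨j₁, t₁, g₁⟩, hb⟩ := x
  dsimp only at hj hb
  subst hj
  refine leftProd_eq_of_reg_eq hv hk hb.1 hb.2 ht hg ?_
  rw [← h1, C.reg_eq hb.1 hb.2]

/-- This is the defining property of the potential. Conjugating a generator by such a function
solves the relations at the strands of the sphere. -/
theorem pot_rightReg {v : Region C.word → H} {j : Fin n} (hv : C.IsSol v)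
    (hk : ∀ A : Region C.word, A.comp = j → v A = 1) {t p : ℕ} (h : C.IsStrand j t p) :
    pot v (C.rightReg j t p) = pot v (C.leftReg j t p) * v (C.label j t p) := by
  have ht := le_length_of_isStrand h
  have h' : p < width (C.word j) t := h
  have h1 := CutData.leftProd_succ v j t p
  unfold CutData.rightReg CutData.leftReg
  unfold CutData.crossVal at h1
  split_ifs at h1 ⊢
  · rw [pot_reg hv hk ht (by omega), pot_reg hv hk ht (by omega), h1]
  · rw [pot_reg hv hk ht (by omega), pot_reg hv hk ht (by omega), h1]; group

/-! ## Representations of the group of a cut-diagram -/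

theorem isSol_meridian : C.IsSol C.meridian := by
  intro A B L h
  have : (PresentedGroup.mk C.relators) ((FreeGroup.of B)⁻¹ *
      ((FreeGroup.of L)⁻¹ * FreeGroup.of A * FreeGroup.of L)) = 1 :=
    PresentedGroup.one_of_mem ⟨A, B, L, h, rfl⟩
  simp only [map_mul, map_inv] at this
  exact inv_mul_eq_one.1 this

/-- The homomorphism from the group of the diagram given by a solution of its relations. -/
def homOfSol (v : Region C.word → H) (hv : C.IsSol v) : C.Grp →* H :=
  PresentedGroup.toGroup (f := v) (by
    rintro _ ⟨A, B, L, h, rfl⟩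
    simp [hv A B L h, mul_assoc])

theorem homOfSol_meridian (v : Region C.word → H) (hv : C.IsSol v) (A : Region C.word) :
    homOfSol v hv (C.meridian A) = v A := PresentedGroup.toGroup.of _

/-- Both meridians are conjugate to that of the outer region of their sphere. -/
theorem meridian_conj {A B : Region C.word} (h : A.comp = B.comp) :
    ∃ g, C.meridian A = g⁻¹ * C.meridian B * g := by
  obtain ⟨j, t, g, ht, hg, rfl⟩ := C.exists_reg A
  obtain ⟨j', t', g', ht', hg', rfl⟩ := C.exists_reg B
  obtain rfl : j = j' := h
  refine ⟨(C.leftProd C.meridian j t' g')⁻¹ * C.leftProd C.meridian j t g, ?_⟩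
  rw [isSol_meridian.reg_conj j t g hg, isSol_meridian.reg_conj j t' g' hg', reg_zero ht,
    reg_zero ht']
  group

/-! ### Solving the relations of a diagram by successive approximation -/

section Approx

variable (b : C.Basing) (x : Fin n → H)

/-- Successive approximations of the meridians in terms of those of the basing. -/
def approx : ℕ → Region C.word → H
  | 0, A => x A.comp
  | q + 1, A => ((pot (approx q) (b.reg A.comp))⁻¹ * pot (approx q) A)⁻¹ * x A.comp *
      ((pot (approx q) (b.reg A.comp))⁻¹ * pot (approx q) A)

variable {b x}

theorem mk_approx_eq_one {J : Set (Fin n)} {A : Region C.word} (hA : A.comp ∈ J) (q : ℕ) :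
    QuotientGroup.mk' (killed x J) (approx b x q A) = 1 := by
  cases q with
  | zero => simpa [approx] using mk_killed_eq_one (x := x) hA 1
  | succ q => exact mk_killed_eq_one hA _

theorem insert_compl_erase {s : Finset (Fin n)} {j : Fin n} (hj : j ∈ s) :
    ((s.erase j : Finset (Fin n)) : Set (Fin n))ᶜ = insert j (s : Set (Fin n))ᶜ := by
  ext k
  by_cases hk : k = j <;> simp [hk, hj]

/-- With at most `q` surviving generators the approximations are stationary from step `q` on. To
compare values on a sphere `j` of `s`, `conj_congr` needs the previous potentials only after `x j`
is killed as well, which leaves one survivor fewer. -/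
theorem mk_approx_succ (hx : IsReducedFamily x) (q : ℕ) (s : Finset (Fin n)) (hs : s.card ≤ q)
    (A : Region C.word) :
    QuotientGroup.mk' (killed x (s : Set (Fin n))ᶜ) (approx b x (q + 1) A) =
      QuotientGroup.mk' (killed x (s : Set (Fin n))ᶜ) (approx b x q A) := by
  induction q generalizing s A with
  | zero =>
    have : s = ∅ := Finset.card_eq_zero.1 (Nat.le_zero.1 hs)
    rw [mk_approx_eq_one (by simp [this]), mk_approx_eq_one (by simp [this])]
  | succ q ih =>
    by_cases hj : A.comp ∈ s
    · refine hx.conj_congr ?_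
      rw [← insert_compl_erase hj]
      have ih' := fun B : Region C.word => ih (s.erase A.comp) (by
        rw [Finset.card_erase_of_mem hj]; omega) B
      simp only [map_mul, map_inv, map_pot, ih']
    · rw [mk_approx_eq_one (by simpa using hj), mk_approx_eq_one (by simpa using hj)]

/-- Assume the relations hold at step `q` with one survivor fewer. There the regions of the sphere
`j` are killed, so the potential exists and jumps by the label across a strand; `conj_congr` turns
this into the conjugation relation at step `q + 1`. -/
theorem isSol_mk_approx (hx : IsReducedFamily x) (q : ℕ) (s : Finset (Fin n)) (hs : s.card ≤ q) :
    C.IsSol fun A => QuotientGroup.mk' (killed x (s : Set (Fin n))ᶜ) (approx b x q A) := by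
  induction q generalizing s with
  | zero =>
    intro A B L _
    have : s = ∅ := Finset.card_eq_zero.1 (Nat.le_zero.1 hs)
    simp only
    rw [mk_approx_eq_one (by simp [this]), mk_approx_eq_one (by simp [this]),
      mk_approx_eq_one (by simp [this])]
    simp
  | succ q ih =>
    rintro _ _ _ ⟨j, t, p, hst, rfl, rfl, rfl⟩
    simp only
    by_cases hj : j ∈ s
    · have hcard : (s.erase j).card ≤ q := by rw [Finset.card_erase_of_mem hj]; omega
      have ih' := ih (s.erase j) hcard
      have hp := pot_rightReg ih' (fun A hA => mk_approx_eq_one (by simp [hA]) q) hst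
      -- The jump of the potential is the label at step `q`, whereas the relation to be proved uses
      -- its value at step `q + 1`; the two agree with so few survivors.
      rw [← map_pot, ← map_pot, ← mk_approx_succ hx q _ hcard (C.label j t p),
        insert_compl_erase hj, ← map_mul] at hp
      set L := approx b x (q + 1) (C.label j t p) with hL
      simp only [approx, C.comp_leftReg, C.comp_rightReg]
      rw [← map_inv, ← map_mul, ← map_mul]
      set c := (pot (approx b x q) (b.reg j))⁻¹
      have e : L⁻¹ * ((c * pot (approx b x q) (C.leftReg j t p))⁻¹ * x j *
          (c * pot (approx b x q) (C.leftReg j t p))) * L =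
          (c * (pot (approx b x q) (C.leftReg j t p) * L))⁻¹ * x j *
            (c * (pot (approx b x q) (C.leftReg j t p) * L)) := by group
      rw [e]
      refine hx.conj_congr ?_
      rw [map_mul, hp, ← map_mul]
    · rw [mk_approx_eq_one (A := C.rightReg j t p) (by simpa [C.comp_rightReg] using hj),
        mk_approx_eq_one (A := C.leftReg j t p) (by simpa [C.comp_leftReg] using hj)]
      simp

/-- Any reduced family is realized by the meridians of the basing. -/
theorem exists_hom (b : C.Basing) (hx : IsReducedFamily x) :
    ∃ h : C.Grp →* H, ∀ j, h (C.meridian (b.reg j)) = x j := by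
  have hK : ((Finset.univ : Finset (Fin n)) : Set (Fin n))ᶜ = ∅ := by simp
  -- Since all `n` generators survive, any step from `n` on solves the relations; a successor is
  -- used so that the value on the basing is visibly a conjugate by `1`.
  have hsol : C.IsSol (approx b x (n + 1)) := by
    intro A B L h
    have := isSol_mk_approx (b := b) hx (n + 1) Finset.univ (by simp) A B L h
    simp only [← map_inv, ← map_mul] at this
    exact eq_of_mk_killed_empty hK this
  refine ⟨homOfSol _ hsol, fun j => ?_⟩
  rw [homOfSol_meridian]
  simp [approx, b.comp_reg]

end Approx
end CutDiagram

/-! ## The reduced group of a cut-diagram -/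

/-- The generator `x_j` of the reduced free group, with `x_i = 1`. -/
def xgen {n : ℕ} (i j : Fin n) : ReducedFreeGroup (CutDiagram.Idx i) :=
  if h : j ≠ i then rgen ⟨j, h⟩ else 1

theorem xgen_self {n : ℕ} (i : Fin n) : xgen i i = 1 := by simp [xgen]

theorem xgen_coe {n : ℕ} {i : Fin n} (j : CutDiagram.Idx i) : xgen i j.1 = rgen j := by
  simp [xgen, j.2]

theorem isReducedFamily_xgen {n : ℕ} (i : Fin n) : IsReducedFamily (xgen i) := by
  intro j g
  unfold xgen
  split_ifs with h
  · exact isReducedFamily_rgen _ g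
  · exact Commute.one_left _

namespace CutDiagram

variable {n : ℕ} {C : CutDiagram n} {i : Fin n}

theorem proj_meridian_of_comp (b : C.Basing) {A : Region C.word} (hA : A.comp = i) :
    proj b i (C.meridian A) = 1 :=
  (QuotientGroup.eq_one_iff _).2 (Subgroup.subset_normalClosure ⟨A, hA, rfl⟩)

theorem psi_rgen (b : C.Basing) (j : Idx i) :
    psi b i (rgen j) = proj b i (C.meridian (b.reg j.1)) := reducedLift_rgen _ j

/-- A homomorphism that maps each meridian to a conjugate of a generator of the same index. -/
def IsMarking (i : Fin n) (h : C.Grp →* ReducedFreeGroup (Idx i)) : Prop :=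
  ∀ A, ∃ g, h (C.meridian A) = g⁻¹ * xgen i A.comp * g

theorem isMarking_of_basing (b : C.Basing) {h : C.Grp →* ReducedFreeGroup (Idx i)}
    (hb : ∀ j, h (C.meridian (b.reg j)) = xgen i j) : IsMarking i h := by
  intro A
  obtain ⟨g, hg⟩ := meridian_conj (A := A) (B := b.reg A.comp) (b.comp_reg _).symm
  exact ⟨h g, by rw [hg, map_mul, map_mul, map_inv, hb]⟩

theorem IsMarking.meridian_eq_one {h : C.Grp →* ReducedFreeGroup (Idx i)} (hh : IsMarking i h)
    {A : Region C.word} (hA : A.comp = i) : h (C.meridian A) = 1 := by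
  obtain ⟨g, hg⟩ := hh A
  rw [hg, hA, xgen_self]
  simp

/-- Conjugates of the `x_j` still form a reduced family and `x_i` is replaced by `1`, so both
quotients that define `RGrpAt` are respected, for any basing. -/
theorem IsMarking.exists_factor {h : C.Grp →* ReducedFreeGroup (Idx i)} (hh : IsMarking i h)
    (b : C.Basing) : ∃ f : RGrpAt b i →* ReducedFreeGroup (Idx i), ∀ z, f (proj b i z) = h z := by
  have h1 : Subgroup.normalClosure (reducedRelators (fun j => C.meridian (b.reg j))) ≤ h.ker := by
    refine Subgroup.normalClosure_le_normal ?_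
    rintro _ ⟨j, g, rfl⟩
    obtain ⟨c, hc⟩ := hh (b.reg j)
    rw [SetLike.mem_coe, MonoidHom.mem_ker]
    simp only [map_mul, map_inv, hc]
    have := (isReducedFamily_xgen i).conj (fun _ => c) (b.reg j).comp (h g)
    rw [← relator_eq_one_iff] at this
    simpa using this
  let f₁ : RGrp b →* ReducedFreeGroup (Idx i) := QuotientGroup.lift _ h h1
  have h2 : Subgroup.normalClosure (meridiansAt b i) ≤ f₁.ker := by
    refine Subgroup.normalClosure_le_normal ?_
    rintro _ ⟨A, hA, rfl⟩
    exact hh.meridian_eq_one hA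
  exact ⟨QuotientGroup.lift _ f₁ h2, fun z => rfl⟩

/-- Meridians on one sphere are conjugate, so the basing meridians normally generate, and being a
finite reduced family they generate; the `i`-th one is trivial. -/
theorem range_psi (b : C.Basing) (i : Fin n) : Function.Surjective (psi b i) := by
  set y : Fin n → RGrpAt b i := fun j => proj b i (C.meridian (b.reg j))
  have hy : IsReducedFamily y := fun j g => by
    rw [← relator_eq_one_iff]; exact proj_relator b i j g
  have htop : Subgroup.normalClosure (Set.range y) = ⊤ := by
    rw [eq_top_iff]
    have h1 : (⊤ : Subgroup C.Grp) ≤ (Subgroup.normalClosure (Set.range y)).comap (proj b i) := by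
      rw [← PresentedGroup.closure_range_of, Subgroup.closure_le]
      rintro _ ⟨A, rfl⟩
      obtain ⟨g, hg⟩ := meridian_conj (A := A) (B := b.reg A.comp) (b.comp_reg _).symm
      change proj b i (C.meridian A) ∈ Subgroup.normalClosure (Set.range y)
      rw [hg, map_mul, map_mul, map_inv]
      have := Subgroup.normalClosure_normal.conj_mem (y A.comp)
        (Subgroup.subset_normalClosure (Set.mem_range_self A.comp)) (proj b i g)⁻¹
      rwa [inv_inv] at this
    intro x _
    obtain ⟨z, rfl⟩ := proj_surjective b i x
    exact h1 (Subgroup.mem_top z)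
  rw [← MonoidHom.range_eq_top, eq_top_iff, ← hy.closure_eq_top htop, Subgroup.closure_le]
  rintro _ ⟨j, rfl⟩
  by_cases hj : j = i
  · have : y j = 1 := proj_meridian_of_comp b (by rw [b.comp_reg, hj])
    rw [this]
    exact one_mem _
  · exact ⟨rgen ⟨j, hj⟩, psi_rgen b ⟨j, hj⟩⟩

/-- For injectivity, the representation of `exists_hom` that sends the basing meridians to the free
generators factors through `RGrpAt` and is a left inverse. -/
theorem psi_bijective (b : C.Basing) (i : Fin n) : Function.Bijective (psi b i) := by
  refine ⟨?_, range_psi b i⟩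
  obtain ⟨h, hh⟩ := exists_hom b (isReducedFamily_xgen i)
  obtain ⟨f, hf⟩ := (isMarking_of_basing b hh).exists_factor b
  have : f.comp (psi b i) = MonoidHom.id _ := ReducedFreeGroup.hom_ext fun j => by
    rw [MonoidHom.comp_apply, psi_rgen, hf, hh, xgen_coe]; rfl
  exact Function.LeftInverse.injective (g := f) fun x => DFunLike.congr_fun this x

theorem psi_phi (b : C.Basing) (i : Fin n) (x : RGrpAt b i) : psi b i (phi b i x) = x := by
  rw [phi, dif_pos (psi_bijective b i)]
  exact (MulEquiv.ofBijective (psi b i) (psi_bijective b i)).apply_symm_apply x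

theorem phi_psi (b : C.Basing) (i : Fin n) (x : ReducedFreeGroup (Idx i)) :
    phi b i (psi b i x) = x :=
  (psi_bijective b i).1 (psi_phi b i _)

theorem phi_injective (b : C.Basing) (i : Fin n) : Function.Injective (phi b i) :=
  Function.LeftInverse.injective (psi_phi b i)

/-- The homomorphism from the group of the diagram to the reduced free group that is
associated with a basing. -/
def basingHom (b : C.Basing) (i : Fin n) : C.Grp →* ReducedFreeGroup (Idx i) :=
  (phi b i).comp (proj b i)

theorem basingHom_reg (b : C.Basing) (i j : Fin n) :
    basingHom b i (C.meridian (b.reg j)) = xgen i j := by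
  rw [basingHom, MonoidHom.comp_apply]
  by_cases hj : j = i
  · rw [proj_meridian_of_comp b (by rw [b.comp_reg, hj]), map_one, hj, xgen_self]
  · have := psi_rgen b (i := i) ⟨j, hj⟩
    rw [← this, phi_psi, ← xgen_coe]

theorem isMarking_basingHom (b : C.Basing) (i : Fin n) : IsMarking i (basingHom b i) :=
  isMarking_of_basing b (basingHom_reg b i)

/-- Every marking factors through the isomorphism given by a basing, and what remains conjugates
each generator. This is how the choice of basing is controlled. -/
theorem IsMarking.eq_comp_basingHom {h : C.Grp →* ReducedFreeGroup (Idx i)} (hh : IsMarking i h)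
    (b : C.Basing) : ∃ θ, IsBasisConj θ ∧ h = θ.comp (basingHom b i) := by
  obtain ⟨f, hf⟩ := hh.exists_factor b
  refine ⟨f.comp (psi b i), fun j => ?_, ?_⟩
  · obtain ⟨g, hg⟩ := hh (b.reg j.1)
    refine ⟨g, ?_⟩
    rw [MonoidHom.comp_apply, psi_rgen, hf, hg, b.comp_reg, xgen_coe]
  · ext1 z
    simp only [MonoidHom.comp_apply, basingHom, psi_phi, hf]

/-! ## The invariants in terms of a marking -/

/-- The region of the end point that is the `t`-th slice of the `i`-th sphere. -/
def tipReg (C : CutDiagram n) (i : Fin n) (t : ℕ) : Region C.word :=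
  match (C.word i)[t]? with
  | some ⟨k, .birth _⟩ => C.reg i t k
  | some ⟨k, .death _⟩ => C.reg i (t + 1) k
  | _ => C.reg i 0 0

theorem tipReg_of_tip {c : Color} {t : ℕ} {A L : Region C.word} {ε : Bool}
    (h : C.Tip c i t A L ε) : C.tipReg i t = A := by
  cases h with
  | birth k hk => simp [tipReg, hk]
  | death k hk => simp [tipReg, hk]

/-- The `t`-th slice of the `i`-th sphere is an end point `∘`. -/
def IsWhite (C : CutDiagram n) (i : Fin n) (t : ℕ) : Prop := ∃ A L ε, C.Tip .white i t A L ε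

theorem IsWhite.pair {t : ℕ} (h : C.IsWhite i t) : C.IsWhite i (C.pair i t) := by
  obtain ⟨A, L, ε, h⟩ := h
  exact ⟨_, _, _, (C.white_rule _ _ _ _ _ h).2.2⟩

theorem IsWhite.pair_pair {t : ℕ} (h : C.IsWhite i t) : C.pair i (C.pair i t) = t := by
  obtain ⟨A, L, ε, h⟩ := h
  exact (C.white_rule _ _ _ _ _ h).2.1

theorem IsWhite.pair_ne {t : ℕ} (h : C.IsWhite i t) : C.pair i t ≠ t := by
  obtain ⟨A, L, ε, h⟩ := h
  exact (C.white_rule _ _ _ _ _ h).1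

theorem tip_sign_unique {c : Color} {t : ℕ} {A L A' L' : Region C.word} {ε ε' : Bool}
    (h : C.Tip c i t A L ε) (h' : C.Tip c i t A' L' ε') : ε = ε' := by
  cases h with
  | birth k hk =>
    cases h' with
    | birth k' hk' =>
      rw [hk] at hk'
      obtain rfl : k = k' := by simpa using hk'
      rfl
    | death k' hk' => rw [hk] at hk'; simp at hk'
  | death k hk =>
    cases h' with
    | birth k' hk' => rw [hk] at hk'; simp at hk'
    | death k' hk' =>
      rw [hk] at hk'
      obtain rfl : k = k' := by simpa using hk'
      rfl

theorem sign_of_tip {t : ℕ} {A L : Region C.word} {ε : Bool} (h : C.Tip .white i t A L ε) :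
    C.sign i t = if ε then 1 else -1 := by
  unfold sign
  congr 1
  rw [eq_iff_iff]
  constructor
  · rintro ⟨A', L', h'⟩
    exact tip_sign_unique h h'
  · rintro rfl
    exact ⟨A, L, h⟩

theorem IsWhite.sign_pair {t : ℕ} (h : C.IsWhite i t) : C.sign i (C.pair i t) = C.sign i t := by
  obtain ⟨A, L, ε, h⟩ := h
  rw [sign_of_tip h, sign_of_tip (C.white_rule _ _ _ _ _ h).2.2]

theorem IsWhite.lt {t : ℕ} (h : C.IsWhite i t) : t < (C.word i).length := by
  obtain ⟨A, L, ε, h⟩ := h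
  cases h with
  | birth k hk => exact (List.getElem?_eq_some_iff.1 hk).1
  | death k hk => exact (List.getElem?_eq_some_iff.1 hk).1

/-- The value of the path from the outer region to an end point. -/
def tipPot (h : C.Grp →* ReducedFreeGroup (Idx i)) (t : ℕ) : ReducedFreeGroup (Idx i) :=
  pot (fun A => h (C.meridian A)) (C.tipReg i t)

/-- The contribution of an end point. -/
def kirkTerm (h : C.Grp →* ReducedFreeGroup (Idx i)) (t : ℕ) : ReducedFreeGroup (Idx i) →₀ ℤ :=
  if C.IsWhite i t then
    Finsupp.single (posn (tipPot h t * (tipPot h (C.pair i t))⁻¹)) (C.sign i t)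
  else 0

/-- The sum of the contributions of all end points: each pair is counted twice. -/
def kirk (h : C.Grp →* ReducedFreeGroup (Idx i)) : ReducedFreeGroup (Idx i) →₀ ℤ :=
  ∑ t ∈ Finset.range (C.word i).length, kirkTerm h t

theorem kirkTerm_comp (h : C.Grp →* ReducedFreeGroup (Idx i))
    {θ : ReducedFreeGroup (Idx i) →* ReducedFreeGroup (Idx i)} (hθ : IsBasisConj θ) (t : ℕ) :
    kirkTerm (θ.comp h) t = (kirkTerm h t).mapDomain θ := by
  have : ∀ t, tipPot (θ.comp h) t = θ (tipPot h t) := fun t => by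
    rw [tipPot, tipPot, map_pot]; rfl
  unfold kirkTerm
  split_ifs
  · rw [Finsupp.mapDomain_single, this, this, ← map_inv, ← map_mul, hθ.posn]
  · simp

theorem kirk_comp (h : C.Grp →* ReducedFreeGroup (Idx i))
    {θ : ReducedFreeGroup (Idx i) →* ReducedFreeGroup (Idx i)} (hθ : IsBasisConj θ) :
    kirk (θ.comp h) = (kirk h).mapDomain θ := by
  simp only [kirk, kirkTerm_comp h hθ, Finsupp.mapDomain_finsetSum]

/-- The two points of a pair contribute equally: exchanging them inverts the group element, which
`posn` does not see, and their signs agree. -/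
theorem kirk_eq_two_smul (h : C.Grp →* ReducedFreeGroup (Idx i)) :
    kirk h = (2 : ℤ) • ∑ t ∈ C.whitePairs i, kirkTerm h t := by
  have h1 : kirk h = ∑ t ∈ C.whites i, kirkTerm h t := by
    rw [kirk, whites, Finset.sum_filter]
    refine Finset.sum_congr rfl fun t _ => ?_
    by_cases ht : C.IsWhite i t
    · exact (if_pos ht).symm
    · exact (if_neg ht).trans (if_neg ht).symm
  have hw : ∀ t, t ∈ C.whites i ↔ C.IsWhite i t := fun t => by
    simp only [whites, Finset.mem_filter, Finset.mem_range]
    exact ⟨fun h => h.2, fun h => ⟨h.lt, h⟩⟩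
  have h2 : ∑ t ∈ C.whites i with ¬ t < C.pair i t, kirkTerm h t =
      ∑ t ∈ C.whitePairs i, kirkTerm h t := by
    refine Finset.sum_bij' (fun t _ => C.pair i t) (fun t _ => C.pair i t) ?_ ?_ ?_ ?_ ?_
    · intro t ht
      simp only [Finset.mem_filter, hw, whitePairs] at ht ⊢
      have := ht.1.pair_ne
      exact ⟨ht.1.pair, by rw [ht.1.pair_pair]; omega⟩
    · intro t ht
      simp only [Finset.mem_filter, hw, whitePairs] at ht ⊢
      exact ⟨ht.1.pair, by rw [ht.1.pair_pair]; omega⟩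
    · intro t ht
      simp only [Finset.mem_filter, hw] at ht
      exact ht.1.pair_pair
    · intro t ht
      simp only [Finset.mem_filter, hw, whitePairs] at ht
      exact ht.1.pair_pair
    · intro t ht
      simp only [Finset.mem_filter, hw] at ht
      rw [kirkTerm, kirkTerm, if_pos ht.1, if_pos ht.1.pair, ht.1.pair_pair, ht.1.sign_pair,
        ← posn_inv, mul_inv_rev, inv_inv]
  rw [h1, ← Finset.sum_filter_add_sum_filter_not _ (fun t => t < C.pair i t), h2, two_smul]
  rfl

theorem pathWord_comp {A B : Region C.word} {w : C.Grp} (h : C.PathWord A B w) :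
    B.comp = A.comp := by
  induction h with
  | nil => rfl
  | pos j t p w hs _ ih => rw [← ih, C.comp_leftReg, C.comp_rightReg]
  | neg j t p w hs _ ih => rw [← ih, C.comp_leftReg, C.comp_rightReg]

/-- Each crossing on the path changes the potential by the corresponding letter of the word, so only
the end regions matter and the choice of paths is irrelevant. -/
theorem IsMarking.map_pathWord {h : C.Grp →* ReducedFreeGroup (Idx i)} (hh : IsMarking i h)
    {A B : Region C.word} (hA : A.comp = i) {w : C.Grp} (hw : C.PathWord A B w) :
    h w = (pot (fun A => h (C.meridian A)) A)⁻¹ * pot (fun A => h (C.meridian A)) B := by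
  have hsol : C.IsSol fun A => h (C.meridian A) := isSol_meridian.map h
  have hk : ∀ A : Region C.word, A.comp = i → h (C.meridian A) = 1 :=
    fun A hA => hh.meridian_eq_one hA
  induction hw with
  | nil => simp
  | pos j t p w hs hp ih =>
    obtain rfl : j = i := by rw [← hA, ← pathWord_comp hp, C.comp_leftReg]
    rw [map_mul, ih, pot_rightReg hsol hk hs, mul_assoc]
  | neg j t p w hs hp ih =>
    obtain rfl : j = i := by rw [← hA, ← pathWord_comp hp, C.comp_rightReg]
    rw [map_mul, ih, pot_rightReg hsol hk hs, map_inv]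
    group

/-! ### Comparison up to basis-conjugating automorphisms -/

/-- Equality up to a basis-conjugating automorphism. -/
def Sim {ι : Type*} (ρ ρ' : ReducedFreeGroup ι →₀ ℤ) : Prop :=
  ∃ θ : ReducedFreeGroup ι →* ReducedFreeGroup ι, IsBasisConj θ ∧ ρ' = ρ.mapDomain θ

theorem Sim.refl {ι : Type*} (ρ : ReducedFreeGroup ι →₀ ℤ) : Sim ρ ρ :=
  ⟨MonoidHom.id _, fun j => ⟨1, by simp⟩, by simp [Finsupp.mapDomain_id]⟩

theorem Sim.symm {ι : Type*} [Fintype ι] {ρ ρ' : ReducedFreeGroup ι →₀ ℤ} (h : Sim ρ ρ') :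
    Sim ρ' ρ := by
  obtain ⟨θ, hθ, rfl⟩ := h
  obtain ⟨θ', hθ', hinv⟩ := hθ.exists_inverse
  refine ⟨θ', hθ', ?_⟩
  rw [← Finsupp.mapDomain_comp]
  have : (θ' ∘ θ : ReducedFreeGroup ι → ReducedFreeGroup ι) = id := funext hinv
  rw [this, Finsupp.mapDomain_id]

theorem Sim.trans {ι : Type*} {ρ ρ' ρ'' : ReducedFreeGroup ι →₀ ℤ} (h : Sim ρ ρ')
    (h' : Sim ρ' ρ'') : Sim ρ ρ'' := by
  obtain ⟨θ, hθ, rfl⟩ := h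
  obtain ⟨θ', hθ', rfl⟩ := h'
  exact ⟨θ'.comp θ, hθ'.comp hθ, by rw [← Finsupp.mapDomain_comp]; rfl⟩

theorem erase_one_mapDomain {ι : Type*} [Fintype ι] {θ : ReducedFreeGroup ι →* ReducedFreeGroup ι}
    (hθ : IsBasisConj θ) (ρ : ReducedFreeGroup ι →₀ ℤ) :
    (ρ.mapDomain θ).erase 1 = (ρ.erase 1).mapDomain θ := by
  ext x
  obtain ⟨x, rfl⟩ := hθ.surjective x
  rw [Finsupp.mapDomain_apply hθ.injective]
  by_cases hx : x = 1
  · subst hx; simp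
  · rw [Finsupp.erase_ne hx, Finsupp.erase_ne, Finsupp.mapDomain_apply hθ.injective]
    exact fun h => hx (hθ.injective (by rw [h, map_one]))

theorem Sim.erase_one {ι : Type*} [Fintype ι] {ρ ρ' : ReducedFreeGroup ι →₀ ℤ} (h : Sim ρ ρ') :
    Sim (ρ.erase 1) (ρ'.erase 1) := by
  obtain ⟨θ, hθ, rfl⟩ := h
  exact ⟨θ, hθ, erase_one_mapDomain hθ ρ⟩

/-- Two markings of a diagram give the same invariant up to basis-conjugating automorphisms. -/
theorem IsMarking.sim_kirk (b : C.Basing) {h h' : C.Grp →* ReducedFreeGroup (Idx i)}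
    (hh : IsMarking i h) (hh' : IsMarking i h') : Sim (kirk h) (kirk h') := by
  obtain ⟨θ, hθ, rfl⟩ := hh.eq_comp_basingHom b
  obtain ⟨θ', hθ', rfl⟩ := hh'.eq_comp_basingHom b
  have h1 : Sim (kirk (basingHom b i)) (kirk (θ.comp (basingHom b i))) :=
    ⟨θ, hθ, kirk_comp _ hθ⟩
  have h2 : Sim (kirk (basingHom b i)) (kirk (θ'.comp (basingHom b i))) :=
    ⟨θ', hθ', kirk_comp _ hθ'⟩
  exact h1.symm.trans h2

/-- The coefficients `ρ_C`, transported to the reduced free group, without the one of `1`. -/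
def reducedRho (b : C.Basing) (i : Fin n) (a : Paths b i) : ReducedFreeGroup (Idx i) →₀ ℤ :=
  ((rho b i a).mapDomain (phi b i)).erase 1

theorem phi_w (b : C.Basing) (i : Fin n) (a : Paths b i) (t : ℕ) :
    phi b i (w b i a t) =
      posn (basingHom b i (a.val t) * (basingHom b i (a.val (C.pair i t)))⁻¹) := by
  have e : phi b i (proj b i (a.val t * (a.val (C.pair i t))⁻¹)) =
      basingHom b i (a.val t) * (basingHom b i (a.val (C.pair i t)))⁻¹ := by simp [basingHom]
  have e' : phi b i (proj b i (a.val (C.pair i t) * (a.val t)⁻¹)) =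
      (basingHom b i (a.val t) * (basingHom b i (a.val (C.pair i t)))⁻¹)⁻¹ := by simp [basingHom]
  rw [posn, ← e', ← e, w]
  split_ifs <;> rfl

/-- Potentials are measured from the outer region and paths from the basing region. The two differ
by a constant left factor, which conjugates all the elements of the pairs simultaneously. -/
theorem sim_two_smul_rho (b : C.Basing) (i : Fin n) (a : Paths b i) :
    Sim (kirk (basingHom b i)) ((2 : ℤ) • (rho b i a).mapDomain (phi b i)) := by
  set c := pot (fun A => basingHom b i (C.meridian A)) (b.reg i) with hc
  have hmem : ∀ t ∈ C.whitePairs i, C.IsWhite i t := fun t ht => by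
    simp only [whitePairs, whites, Finset.mem_filter] at ht
    exact ht.1.2
  have hval : ∀ t, C.IsWhite i t → basingHom b i (a.val t) = c⁻¹ * tipPot (basingHom b i) t := by
    rintro t ⟨A, L, ε, ht⟩
    rw [(isMarking_basingHom b i).map_pathWord (b.comp_reg i) (a.isPath t A L ε ht), tipPot,
      tipReg_of_tip ht]
  refine ⟨_, IsBasisConj.conj c⁻¹, ?_⟩
  rw [kirk_eq_two_smul, Finsupp.mapDomain_smul, Finsupp.mapDomain_finsetSum, rho,
    Finsupp.mapDomain_finsetSum]
  congr 1
  refine Finset.sum_congr rfl fun t ht => ?_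
  have hw := hmem t ht
  rw [Finsupp.mapDomain_single, kirkTerm, if_pos hw, Finsupp.mapDomain_single, phi_w,
    hval t hw, hval _ hw.pair, ← (IsBasisConj.conj c⁻¹).posn]
  congr 2
  simp [mul_assoc]

theorem Sim.of_two_smul {ι : Type*} {ρ ρ' : ReducedFreeGroup ι →₀ ℤ}
    (h : Sim ((2 : ℤ) • ρ) ((2 : ℤ) • ρ')) : Sim ρ ρ' := by
  obtain ⟨θ, hθ, h⟩ := h
  refine ⟨θ, hθ, ?_⟩
  rw [Finsupp.mapDomain_smul] at h
  exact smul_right_injective _ (two_ne_zero : (2 : ℤ) ≠ 0) h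

theorem Sim.residue_eq {ι : Type*} [Fintype ι] {ρ ρ' : ReducedFreeGroup ι →₀ ℤ} (h : Sim ρ ρ')
    (I : NRSeq ι) : (ρ.sum fun x c => c • (magnus ι x - 1)).residue I =
      (ρ'.sum fun x c => c • (magnus ι x - 1)).residue I := by
  obtain ⟨θ, hθ, rfl⟩ := h
  exact (hθ.tri_magnusRing ρ).residue_eq I

/-- The automorphism permutes the support bijectively and keeps coefficients, and the residues of `θ
x` are those of `x` by triangularity. -/
theorem Sim.multiset_eq {ι : Type*} [Fintype ι] {ρ ρ' : ReducedFreeGroup ι →₀ ℤ} (h : Sim ρ ρ') :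
    ρ.support.val.map (fun x => (ρ x, fun I => (magnus ι x).residue I)) =
      ρ'.support.val.map (fun x => (ρ' x, fun I => (magnus ι x).residue I)) := by
  obtain ⟨θ, hθ, rfl⟩ := h
  rw [Finsupp.mapDomain_support_of_injective hθ.injective,
    Finset.image_val_of_injOn hθ.injective.injOn, Multiset.map_map]
  refine Multiset.map_congr rfl fun x _ => ?_
  rw [Function.comp_apply, Finsupp.mapDomain_apply hθ.injective]
  congr 1
  funext I
  exact (hθ.tri_magnus x).residue_eq I

/-- The term at `1` is a multiple of `E(1) - 1 = 0`, so erasing it loses nothing for the first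
invariant; the second one excludes it by definition. -/
theorem sum_erase_one {ι : Type*} (ρ : ReducedFreeGroup ι →₀ ℤ) :
    ((ρ.erase 1).sum fun x c => c • (magnus ι x - 1)) = ρ.sum fun x c => c • (magnus ι x - 1) := by
  conv_rhs => rw [← Finsupp.single_add_erase 1 ρ]
  rw [Finsupp.sum_add_index (by simp) (by simp [add_smul]), Finsupp.sum_single_index (by simp)]
  simp

theorem kappa_eq (b : C.Basing) (i : Fin n) (a : Paths b i) (I : NRSeq (Idx i)) :
    kappa b i a I = ((reducedRho b i a).sum fun x c => c • (magnus (Idx i) x - 1)).residue I := by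
  rw [reducedRho, sum_erase_one, kappa]
  congr 1
  rw [Finsupp.sum_mapDomain_index (by simp) (by simp [add_smul]), rho,
    ← Finsupp.sum_finsetSum_index (by simp) (by simp [add_smul]), S, map_sum]
  refine Finset.sum_congr rfl fun t _ => ?_
  rw [Finsupp.sum_single_index (by simp), map_zsmul, map_sub, map_one]
  congr 2
  simp [magnusRing]

theorem K_eq (b : C.Basing) (i : Fin n) (a : Paths b i) :
    K b i a = (reducedRho b i a).support.val.map
      (fun x => (reducedRho b i a x, fun I => (magnus (Idx i) x).residue I)) := by
  have hs : (reducedRho b i a).support = ((rho b i a).support.erase 1).image (phi b i) := by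
    rw [reducedRho, Finsupp.support_erase,
      Finsupp.mapDomain_support_of_injective (phi_injective b i),
      Finset.image_erase (phi_injective b i), map_one]
  rw [hs, Finset.image_val_of_injOn (phi_injective b i).injOn, Multiset.map_map, K]
  refine Multiset.map_congr rfl fun x hx => ?_
  have hx1 : x ≠ 1 := Finset.ne_of_mem_erase hx
  rw [Function.comp_apply, reducedRho, Finsupp.erase_ne,
    Finsupp.mapDomain_apply (phi_injective b i)]
  exact fun h => hx1 (phi_injective b i (by rw [h, map_one]))

/-- The two invariants agree if the sums of the contributions of the end points do. -/
theorem kappa_eq_and_K_eq {C' : CutDiagram n} {b : C.Basing} {b' : C'.Basing}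
    (h : Sim ((kirk (basingHom b i)).erase 1) ((kirk (basingHom b' i)).erase 1))
    (a : Paths b i) (a' : Paths b' i) :
    (∀ I, kappa b i a I = kappa b' i a' I) ∧ K b i a = K b' i a' := by
  have h1 := (sim_two_smul_rho b i a).erase_one
  have h2 := (sim_two_smul_rho b' i a').erase_one
  have h3 := (h1.symm.trans h).trans h2
  have he : ∀ ρ : ReducedFreeGroup (Idx i) →₀ ℤ,
      ((2 : ℤ) • ρ).erase 1 = (2 : ℤ) • ρ.erase 1 := fun ρ => by
    ext x
    by_cases hx : x = 1
    · subst hx; simp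
    · simp [Finsupp.erase_ne hx]
  rw [he, he] at h3
  have h4 : Sim (reducedRho b i a) (reducedRho b' i a') := h3.of_two_smul
  refine ⟨fun I => ?_, ?_⟩
  · rw [kappa_eq, kappa_eq, h4.residue_eq]
  · rw [K_eq, K_eq, h4.multiset_eq]

/-! ### Reduction of the theorem to single moves -/

/-- The basing by the outer regions. -/
def outerBasing (C : CutDiagram n) : C.Basing := ⟨fun j => C.reg j 0 0, fun _ => rfl⟩

/-- The diagrams have the same invariants at the `i`-th sphere. -/
def KirkSim (i : Fin n) (C C' : CutDiagram n) : Prop :=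
  ∀ (b : C.Basing) (b' : C'.Basing),
    Sim ((kirk (basingHom b i)).erase 1) ((kirk (basingHom b' i)).erase 1)

/-- It suffices to find one convenient marking on each side, since any two markings of one diagram
give similar sums. -/
theorem KirkSim.of_markings {C' : CutDiagram n} {h : C.Grp →* ReducedFreeGroup (Idx i)}
    {h' : C'.Grp →* ReducedFreeGroup (Idx i)} (hh : IsMarking i h) (hh' : IsMarking i h')
    (hs : Sim ((kirk h).erase 1) ((kirk h').erase 1)) : KirkSim i C C' := fun b b' =>
  (((isMarking_basingHom b i).sim_kirk b hh).erase_one.trans hs).trans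
    (hh'.sim_kirk b' (isMarking_basingHom b' i)).erase_one

theorem KirkSim.refl (i : Fin n) (C : CutDiagram n) : KirkSim i C C :=
  KirkSim.of_markings (isMarking_basingHom C.outerBasing i) (isMarking_basingHom C.outerBasing i)
    (Sim.refl _)

theorem KirkSim.of_eqvGen {C C' : CutDiagram n} (hmove : ∀ C C', Move C C' → KirkSim i C C')
    (h : SelfSingularEquiv C C') : KirkSim i C C' := by
  induction h with
  | rel C C' h => exact hmove C C' h
  | refl C => exact KirkSim.refl i C
  | symm C C' _ ih => exact fun b b' => (ih b' b).symm
  | trans C₁ C₂ C₃ _ _ ih ih' => exact fun b b' =>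
      (ih b C₂.outerBasing).trans (ih' C₂.outerBasing b')

end CutDiagram

/-! ## Comparison of two diagrams that agree outside supporting disks -/

open CutDiagram

theorem width_succ_eq_foldl (w : List Slice) (t : ℕ) : width w (t + 1) =
    (w[t]?).toList.foldl (fun m s => m - s.piece.bot + s.piece.top) (width w t) := by
  simp [width, List.take_add_one]

theorem width_eq_of_getElem?_eq {w w' : List Slice} {a a' m : ℕ}
    (h : ∀ r < m, w[a + r]? = w'[a' + r]?) (h0 : width w a = width w' a') :
    ∀ r ≤ m, width w (a + r) = width w' (a' + r) := by
  intro r hr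
  induction r with
  | zero => exact h0
  | succ r ih =>
    rw [← add_assoc, ← add_assoc, width_succ_eq_foldl, width_succ_eq_foldl, h r (by omega),
      ih (by omega)]

theorem CutDiagram.reg_zero' {n : ℕ} (C : CutDiagram n) (j : Fin n) (t : ℕ) :
    C.reg j t 0 = C.reg j 0 0 := by
  rcases le_total t (C.word j).length with h | h
  · exact reg_zero h
  · rw [← reg_zero (C := C) (j := j) le_rfl]
    unfold CutData.reg region
    congr 1
    apply Subtype.ext
    simp [h]

/-- The identification of the levels is compatible with the widths and with the strands that are
inserted on the left. -/
structure Coherent {n : ℕ} (M : Matching n) (C C' : CutDiagram n) : Prop where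
  agree : M.Agree C C'
  width_le : ∀ j t t', M.level j t t' →
    width (C.word j) t + M.shift j ≤ width (C'.word j) t'
  inserted : ∀ j t₁ t₁' t₂ t₂', M.level j t₁ t₁' → M.level j t₂ t₂' → ∀ p < M.shift j,
    C'.SameStrand j t₁' p t₂' p

namespace Coherent

variable {n : ℕ} {M : Matching n} {C C' : CutDiagram n} {H : Type*} [Group H]

theorem crossVal_eq (hM : Coherent M C C') {v : Region C.word → H} {v' : Region C'.word → H}
    (hv : ∀ A A', M.SameRegion C C' A A' → v A = v' A') {j : Fin n} {t t' p : ℕ}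
    (h : M.level j t t') (hp : p < width (C.word j) t) :
    C.crossVal v j t p = C'.crossVal v' j t' (p + M.shift j) := by
  have hw := hM.width_le j t t' h
  have ha : M.SameArc C C' j t p t' (p + M.shift j) :=
    ⟨h, rfl, hp, by change _ < width _ _; omega⟩
  unfold CutData.crossVal
  rw [hM.agree.up_eq _ _ _ _ _ ha, hv _ _ (hM.agree.label_same _ _ _ _ _ ha)]

/-- Corresponding strands have equal orientations and label values; the strands inserted on the left
only contribute a common prefix. -/
theorem leftProd_eq (hM : Coherent M C C') {v : Region C.word → H} {v' : Region C'.word → H}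
    (hv : ∀ A A', M.SameRegion C C' A A' → v A = v' A') {j : Fin n} {t t' g : ℕ}
    (h : M.level j t t') (hg : g ≤ width (C.word j) t) :
    C'.leftProd v' j t' (g + M.shift j) =
      C'.leftProd v' j t' (M.shift j) * C.leftProd v j t g := by
  induction g with
  | zero => simp [CutData.leftProd_zero]
  | succ g ih =>
    rw [add_right_comm, CutData.leftProd_succ, CutData.leftProd_succ, ih (by omega), mul_assoc,
      hM.crossVal_eq hv h (by omega)]

theorem leftProd_shift_eq (hM : Coherent M C C') (v' : Region C'.word → H) {j : Fin n}
    {t₁ t₁' t₂ t₂' : ℕ} (h₁ : M.level j t₁ t₁') (h₂ : M.level j t₂ t₂') :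
    C'.leftProd v' j t₁' (M.shift j) = C'.leftProd v' j t₂' (M.shift j) :=
  CutData.leftProd_congr fun p hp => (hM.inserted j _ _ _ _ h₁ h₂ p hp).crossVal_eq v'

/-- Solutions of the relations of the two diagrams that agree on the basing agree on all regions
that have a common gap. -/
theorem sol_eq (hM : Coherent M C C') {x : Fin n → H} (hx : IsReducedFamily x)
    {v : Region C.word → H} {v' : Region C'.word → H} (hv : C.IsSol v) (hv' : C'.IsSol v')
    (hbase : ∀ j, ∃ t t', M.level j t t' ∧ v (C.reg j t 0) = x j ∧
      v' (C'.reg j t' (M.shift j)) = x j)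
    {A : Region C.word} {A' : Region C'.word} (h : M.SameRegion C C' A A') : v A = v' A' := by
  -- The set of surviving generators grows; the full set gives equality in the group itself.
  have key : ∀ (s : Finset (Fin n)) (A : Region C.word) (A' : Region C'.word),
      M.SameRegion C C' A A' → QuotientGroup.mk' (killed x (s : Set (Fin n))ᶜ) (v A) =
        QuotientGroup.mk' (killed x (s : Set (Fin n))ᶜ) (v' A') := by
    intro s
    induction s using Finset.strongInduction with
    | H s ih =>
      rintro _ _ ⟨j, t, t', g, hl, hg, hg', rfl, rfl⟩
      obtain ⟨t₀, t₀', hl₀, hb, hb'⟩ := hbase j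
      have hw₀ := hM.width_le j _ _ hl₀
      have e1 : v (C.reg j t g) = (C.leftProd v j t g)⁻¹ * x j * C.leftProd v j t g := by
        rw [hv.reg_conj j t g hg, C.reg_zero', ← hb, C.reg_zero' j t₀]
      set l := C'.leftProd v' j t' (M.shift j) with hl_def
      -- The conjugator is measured from the base gap just to the right of the inserted strands, so
      -- their prefix `l`, the same at all matched levels, is divided out.
      have e2 : v' (C'.reg j t' (g + M.shift j)) =
          (l⁻¹ * C'.leftProd v' j t' (g + M.shift j))⁻¹ * x j *
            (l⁻¹ * C'.leftProd v' j t' (g + M.shift j)) := by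
        rw [hv'.reg_conj j t' _ hg', C'.reg_zero', ← hb', hv'.reg_conj j t₀' _ (by omega),
          C'.reg_zero' j t₀', ← hM.leftProd_shift_eq v' hl hl₀]
        simp [hl_def, mul_assoc]
      rw [e1, e2]
      by_cases hj : j ∈ s
      -- The conjugators are products of values of labels on corresponding strands, and these agree
      -- by induction once `x j` is killed too.
      · refine hx.conj_congr ?_
        rw [← insert_compl_erase hj]
        have := hM.leftProd_eq (ih _ (Finset.erase_ssubset hj)) hl hg
        rw [map_mul, map_inv, CutData.map_leftProd, hl_def, CutData.map_leftProd,
          CutData.map_leftProd, this, inv_mul_cancel_left]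
      · rw [mk_killed_eq_one (by simpa using hj), mk_killed_eq_one (by simpa using hj)]
  exact eq_of_mk_killed_empty (by simp) (key Finset.univ A A' h)

end Coherent

/-! ## Corresponding end points -/

section Tips

variable {n : ℕ} {C C' : CutDiagram n} {i : Fin n}

theorem isWhite_iff {t : ℕ} : C.IsWhite i t ↔
    ∃ k, (C.word i)[t]? = some ⟨k, .birth .white⟩ ∨ (C.word i)[t]? = some ⟨k, .death .white⟩ := by
  constructor
  · rintro ⟨A, L, ε, h⟩
    cases h with
    | birth k hk => exact ⟨k, Or.inl hk⟩
    | death k hk => exact ⟨k, Or.inr hk⟩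
  · rintro ⟨k, hk | hk⟩
    · exact ⟨_, _, _, .birth k hk⟩
    · exact ⟨_, _, _, .death k hk⟩

theorem sign_birth {t k : ℕ} (h : (C.word i)[t]? = some ⟨k, .birth .white⟩) :
    C.sign i t = if C.up i (t + 1) k then 1 else -1 := sign_of_tip (.birth k h)

theorem sign_death {t k : ℕ} (h : (C.word i)[t]? = some ⟨k, .death .white⟩) :
    C.sign i t = if !C.up i t k then 1 else -1 := sign_of_tip (.death k h)

variable {h : C.Grp →* ReducedFreeGroup (Idx i)} {h' : C'.Grp →* ReducedFreeGroup (Idx i)}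

theorem CutDiagram.IsMarking.pot_reg (hh : IsMarking i h) {t g : ℕ} (ht : t ≤ (C.word i).length)
    (hg : g ≤ width (C.word i) t) : pot (fun A => h (C.meridian A)) (C.reg i t g) =
      C.leftProd (fun A => h (C.meridian A)) i t g :=
  CutDiagram.pot_reg (isSol_meridian.map h) (fun _ hA => hh.meridian_eq_one hA) ht hg

theorem CutDiagram.IsMarking.leftProd_right (hh : IsMarking i h) {t r : ℕ} {s : Slice}
    (hs : (C.word i)[t]? = some s) (hr : s.pos + s.piece.bot + r ≤ width (C.word i) t) :
    C.leftProd (fun A => h (C.meridian A)) i t (s.pos + s.piece.bot + r) =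
      C.leftProd (fun A => h (C.meridian A)) i (t + 1) (s.pos + s.piece.top + r) :=
  CutDiagram.leftProd_right (isSol_meridian.map h)
    (fun _ hA => hh.meridian_eq_one hA) hs hr

theorem CutDiagram.IsMarking.tipPot_birth (hh : IsMarking i h) {t k : ℕ} {c : Color}
    (hk : (C.word i)[t]? = some ⟨k, .birth c⟩) :
    tipPot h t = C.leftProd (fun A => h (C.meridian A)) i t k := by
  have ht := (List.getElem?_eq_some_iff.1 hk).1
  have hw := (width_succ_ge hk).1
  rw [tipPot, tipReg_of_tip (.birth k hk), hh.pot_reg ht.le (by simpa [Piece.bot] using hw)]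

theorem CutDiagram.IsMarking.tipPot_death (hh : IsMarking i h) {t k : ℕ} {c : Color}
    (hk : (C.word i)[t]? = some ⟨k, .death c⟩) :
    tipPot h t = C.leftProd (fun A => h (C.meridian A)) i t k := by
  have ht := (List.getElem?_eq_some_iff.1 hk).1
  have hw := width_succ_ge hk
  simp only [Piece.bot, Piece.top] at hw
  rw [tipPot, tipReg_of_tip (.death k hk), ← reg_left (s := ⟨k, .death c⟩) hk le_rfl]
  exact hh.pot_reg ht.le (show k ≤ _ by omega)

/-- The slices `t` and `t'` are corresponding end points `∘`, up to a common factor for the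
potentials, or both are none. -/
structure TipMatch (h : C.Grp →* ReducedFreeGroup (Idx i))
    (h' : C'.Grp →* ReducedFreeGroup (Idx i)) (l : ReducedFreeGroup (Idx i)) (t t' : ℕ) :
    Prop where
  white_iff : C.IsWhite i t ↔ C'.IsWhite i t'
  tipPot_eq : C.IsWhite i t → tipPot h' t' = l * tipPot h t
  sign_eq : C.IsWhite i t → C.sign i t = C'.sign i t'

theorem TipMatch.of_not {l : ReducedFreeGroup (Idx i)} {t t' : ℕ} (h1 : ¬ C.IsWhite i t)
    (h2 : ¬ C'.IsWhite i t') : TipMatch h h' l t t' :=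
  ⟨iff_of_false h1 h2, fun h => absurd h h1, fun h => absurd h h1⟩

/-- A common left factor `l` on both potentials of a pair conjugates their quotient by `l`, and
`posn` commutes with conjugation. -/
theorem TipMatch.kirkTerm_eq {l : ReducedFreeGroup (Idx i)} {t t' : ℕ}
    (hm : TipMatch h h' l t t')
    (hp : C.IsWhite i t → TipMatch h h' l (C.pair i t) (C'.pair i t')) :
    kirkTerm h' t' = (kirkTerm h t).mapDomain (MulAut.conj l).toMonoidHom := by
  unfold kirkTerm
  by_cases hw : C.IsWhite i t
  · rw [if_pos hw, if_pos (hm.white_iff.1 hw), Finsupp.mapDomain_single, hm.tipPot_eq hw,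
      (hp hw).tipPot_eq hw.pair, hm.sign_eq hw, ← (IsBasisConj.conj l).posn]
    congr 2
    simp [mul_assoc]
  · rw [if_neg hw, if_neg (fun h => hw (hm.white_iff.2 h)), Finsupp.mapDomain_zero]

theorem mapDomain_conj_one {G : Type*} [Group G] (ρ : G →₀ ℤ) :
    ρ.mapDomain (MulAut.conj (1 : G)).toMonoidHom = ρ := by
  have : ((MulAut.conj (1 : G)).toMonoidHom : G → G) = id := by funext x; simp
  rw [this, Finsupp.mapDomain_id]

/-- The same slice at corresponding levels. -/
theorem TipMatch.of_coherent {M : Matching n} (hM : Coherent M C C') (hh : IsMarking i h)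
    (hh' : IsMarking i h')
    (hv : ∀ A A', M.SameRegion C C' A A' → h (C.meridian A) = h' (C'.meridian A')) {t t' : ℕ}
    (hl : M.level i t t') (hl' : M.level i (t + 1) (t' + 1))
    (he : (C'.word i)[t']? = ((C.word i)[t]?).map fun s => ⟨s.pos + M.shift i, s.piece⟩) :
    TipMatch h h' (C'.leftProd (fun A => h' (C'.meridian A)) i t' (M.shift i)) t t' := by
  cases hs : (C.word i)[t]? with
  | none =>
    rw [hs] at he
    exact .of_not (by simp [isWhite_iff, hs]) (by simp [isWhite_iff, he])
  | some s =>
    obtain ⟨k, P⟩ := s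
    rw [hs] at he
    have hw := width_succ_ge hs
    by_cases hP : P = .birth .white
    · subst hP
      simp only [Piece.bot, Piece.top, Option.map_some] at hw he
      refine ⟨by simp [isWhite_iff, hs, he], fun _ => ?_, fun _ => ?_⟩
      · rw [hh.tipPot_birth hs, hh'.tipPot_birth he, hM.leftProd_eq hv hl (by omega)]
      · have hw' := hM.width_le i _ _ hl'
        rw [sign_birth hs, sign_birth he,
          hM.agree.up_eq i (t + 1) k (t' + 1) (k + M.shift i) ⟨hl', rfl,
            by change _ < width _ _; omega, by change _ < width _ _; omega⟩]
    by_cases hP : P = .death .white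
    · subst hP
      simp only [Piece.bot, Piece.top, Option.map_some] at hw he
      refine ⟨by simp [isWhite_iff, hs, he], fun _ => ?_, fun _ => ?_⟩
      · rw [hh.tipPot_death hs, hh'.tipPot_death he, hM.leftProd_eq hv hl (by omega)]
      · have hw' := hM.width_le i _ _ hl
        rw [sign_death hs, sign_death he,
          hM.agree.up_eq i t k t' (k + M.shift i) ⟨hl, rfl,
            by change _ < width _ _; omega, by change _ < width _ _; omega⟩]
    · refine .of_not ?_ ?_ <;> simp_all [isWhite_iff]

end Tips

/-! ## Replacements at two places -/

theorem getElem?_block {α : Type*} {w P Q R : List α} (h : w = P ++ Q ++ R) {r : ℕ}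
    (hr : r < Q.length) : w[P.length + r]? = Q[r]? := by
  subst h
  rw [List.append_assoc, List.getElem?_append_right (by omega), Nat.add_sub_cancel_left,
    List.getElem?_append_left hr]

theorem sum_range_blocks {M : Type*} [AddCommMonoid M] (f : ℕ → M) (a b c d e : ℕ) :
    ∑ t ∈ Finset.range (a + b + c + d + e), f t =
      ∑ t ∈ Finset.range a, f t + ∑ t ∈ Finset.range b, f (a + t) +
        ∑ t ∈ Finset.range c, f (a + b + t) + ∑ t ∈ Finset.range d, f (a + b + c + t) +
          ∑ t ∈ Finset.range e, f (a + b + c + d + t) := by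
  simp only [Finset.sum_range_add]

namespace Sites.Replaces

variable {n : ℕ} {S : Sites n} {C C' : CutDiagram n}

theorem src_A (hR : S.Replaces C C') {r : ℕ} (hr : r < S.A.length) :
    (C.word S.comp)[r]? = S.A[r]? := by
  have := getElem?_block (P := []) (Q := S.A) (R := S.u₁ ++ S.B ++ S.u₂ ++ S.D)
    (w := C.word S.comp) (by rw [hR.1]; simp) hr
  simpa using this

theorem tgt_A (hR : S.Replaces C C') {r : ℕ} (hr : r < S.A.length) :
    (C'.word S.comp)[r]? = S.A[r]? := by
  have := getElem?_block (P := []) (Q := S.A) (R := S.v₁ ++ S.B ++ S.v₂ ++ S.D)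
    (w := C'.word S.comp) (by rw [hR.2.1]; simp) hr
  simpa using this

theorem src_u₁ (hR : S.Replaces C C') {r : ℕ} (hr : r < S.u₁.length) :
    (C.word S.comp)[S.A.length + r]? = S.u₁[r]? :=
  getElem?_block (R := S.B ++ S.u₂ ++ S.D) (by rw [hR.1]; simp) hr

theorem tgt_v₁ (hR : S.Replaces C C') {r : ℕ} (hr : r < S.v₁.length) :
    (C'.word S.comp)[S.A.length + r]? = S.v₁[r]? :=
  getElem?_block (R := S.B ++ S.v₂ ++ S.D) (by rw [hR.2.1]; simp) hr

theorem src_B (hR : S.Replaces C C') {r : ℕ} (hr : r < S.B.length) :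
    (C.word S.comp)[S.A.length + S.u₁.length + r]? = S.B[r]? := by
  have := getElem?_block (P := S.A ++ S.u₁) (Q := S.B) (R := S.u₂ ++ S.D)
    (w := C.word S.comp) (by rw [hR.1]; simp) hr
  simpa using this

theorem tgt_B (hR : S.Replaces C C') {r : ℕ} (hr : r < S.B.length) :
    (C'.word S.comp)[S.A.length + S.v₁.length + r]? = S.B[r]? := by
  have := getElem?_block (P := S.A ++ S.v₁) (Q := S.B) (R := S.v₂ ++ S.D)
    (w := C'.word S.comp) (by rw [hR.2.1]; simp) hr
  simpa using this

theorem src_u₂ (hR : S.Replaces C C') {r : ℕ} (hr : r < S.u₂.length) :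
    (C.word S.comp)[S.src₂ + r]? = S.u₂[r]? := by
  have := getElem?_block (P := S.A ++ S.u₁ ++ S.B) (Q := S.u₂) (R := S.D)
    (w := C.word S.comp) (by rw [hR.1]) hr
  simpa [Sites.src₂, add_assoc] using this

theorem tgt_v₂ (hR : S.Replaces C C') {r : ℕ} (hr : r < S.v₂.length) :
    (C'.word S.comp)[S.tgt₂ + r]? = S.v₂[r]? := by
  have := getElem?_block (P := S.A ++ S.v₁ ++ S.B) (Q := S.v₂) (R := S.D)
    (w := C'.word S.comp) (by rw [hR.2.1]) hr
  simpa [Sites.tgt₂, add_assoc] using this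

theorem src_D (hR : S.Replaces C C') {r : ℕ} (hr : r < S.D.length) :
    (C.word S.comp)[S.src₂ + S.u₂.length + r]? = S.D[r]? := by
  have := getElem?_block (P := S.A ++ S.u₁ ++ S.B ++ S.u₂) (Q := S.D) (R := [])
    (w := C.word S.comp) (by rw [hR.1]; simp) hr
  simpa [Sites.src₂, add_assoc] using this

theorem tgt_D (hR : S.Replaces C C') {r : ℕ} (hr : r < S.D.length) :
    (C'.word S.comp)[S.tgt₂ + S.v₂.length + r]? = S.D[r]? := by
  have := getElem?_block (P := S.A ++ S.v₁ ++ S.B ++ S.v₂) (Q := S.D) (R := [])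
    (w := C'.word S.comp) (by rw [hR.2.1]; simp) hr
  simpa [Sites.tgt₂, add_assoc] using this

theorem width_A (hR : S.Replaces C C') {t : ℕ} (ht : t ≤ S.A.length) :
    width (C.word S.comp) t = width (C'.word S.comp) t := by
  have := width_eq_of_getElem?_eq (w := C.word S.comp) (w' := C'.word S.comp) (a := 0) (a' := 0)
    (m := S.A.length) (fun r hr => by rw [zero_add, hR.src_A hr, hR.tgt_A hr]) rfl _ ht
  simpa using this

theorem width_B (hR : S.Replaces C C') (h : width (C.word S.comp) (S.A.length + S.u₁.length) =
    width (C'.word S.comp) (S.A.length + S.v₁.length)) {r : ℕ} (hr : r ≤ S.B.length) :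
    width (C.word S.comp) (S.A.length + S.u₁.length + r) =
      width (C'.word S.comp) (S.A.length + S.v₁.length + r) :=
  width_eq_of_getElem?_eq (m := S.B.length) (fun r hr => by rw [hR.src_B hr, hR.tgt_B hr]) h _ hr

end Sites.Replaces

/-- A replacement that does not change the widths outside, together with markings of the two
diagrams that agree on the outer regions. -/
structure Replacement {n : ℕ} (S : Sites n) (C C' : CutDiagram n) (i : Fin n)
    (h : C.Grp →* ReducedFreeGroup (Idx i)) (h' : C'.Grp →* ReducedFreeGroup (Idx i)) : Prop where
  replaces : S.Replaces C C'
  width₁ : width (C.word S.comp) (S.A.length + S.u₁.length) =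
    width (C'.word S.comp) (S.A.length + S.v₁.length)
  width₂ : width (C.word S.comp) (S.src₂ + S.u₂.length) =
    width (C'.word S.comp) (S.tgt₂ + S.v₂.length)
  outer : ∀ j, h (C.meridian (C.reg j 0 0)) = xgen i j
  outer' : ∀ j, h' (C'.meridian (C'.reg j 0 0)) = xgen i j

namespace Replacement

variable {n : ℕ} {S : Sites n} {C C' : CutDiagram n} {i : Fin n}
  {h : C.Grp →* ReducedFreeGroup (Idx i)} {h' : C'.Grp →* ReducedFreeGroup (Idx i)}

theorem width_eq (hR : Replacement S C C' i h h') {j : Fin n} {t t' : ℕ}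
    (hl : S.matching.level j t t') :
    width (C.word j) t = width (C'.word j) t' := by
  simp only [Sites.matching] at hl
  split_ifs at hl with hj
  · subst hj
    rcases hl with ⟨ht, rfl⟩ | ⟨r, hr, rfl, rfl⟩ | ⟨r, hr, rfl, rfl⟩
    · exact hR.replaces.width_A ht
    · exact hR.replaces.width_B hR.width₁ hr
    · exact width_eq_of_getElem?_eq (m := S.D.length)
        (fun r hr => by rw [hR.replaces.src_D hr, hR.replaces.tgt_D hr]) hR.width₂ _ hr
  · rw [hl, hR.replaces.2.2.1 j hj]

theorem coherent (hR : Replacement S C C' i h h') : Coherent S.matching C C' where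
  agree := hR.replaces.2.2.2
  width_le _ _ _ hl := (hR.width_eq hl).le
  inserted _ _ _ _ _ _ _ p hp := absurd hp (Nat.not_lt_zero p)

theorem isMarking (hR : Replacement S C C' i h h') : IsMarking i h :=
  isMarking_of_basing C.outerBasing hR.outer

theorem isMarking' (hR : Replacement S C C' i h h') : IsMarking i h' :=
  isMarking_of_basing C'.outerBasing hR.outer'

/-- Level `0` precedes both disks, so the outer regions serve as a common base. This replaces any
move-by-move computation of the group. -/
theorem sol_eq (hR : Replacement S C C' i h h') {A : Region C.word} {A' : Region C'.word}
    (hA : S.matching.SameRegion C C' A A') :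
    h (C.meridian A) = h' (C'.meridian A') := by
  refine hR.coherent.sol_eq (isReducedFamily_xgen i) (isSol_meridian.map h)
    (isSol_meridian.map h') (fun j => ⟨0, 0, ?_, hR.outer j, hR.outer' j⟩) hA
  simp only [Sites.matching]
  split_ifs
  simp

theorem leftProd_eq (hR : Replacement S C C' i h h') {j : Fin n} {t t' g : ℕ}
    (hl : S.matching.level j t t')
    (hg : g ≤ width (C.word j) t) : C'.leftProd (fun A => h' (C'.meridian A)) j t' g =
      C.leftProd (fun A => h (C.meridian A)) j t g := by
  have := hR.coherent.leftProd_eq (fun A A' => hR.sol_eq) hl hg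
  simpa [Sites.matching, CutData.leftProd_zero] using this

theorem up_eq (hR : Replacement S C C' i h h') {j : Fin n} {t t' p : ℕ}
    (hl : S.matching.level j t t')
    (hp : p < width (C.word j) t) : C.up j t p = C'.up j t' p :=
  hR.replaces.2.2.2.up_eq j t p t' p ⟨hl, rfl, hp, by
    change _ < width _ _; rw [← hR.width_eq hl]; exact hp⟩

theorem tipMatch_of_level (hR : Replacement S C C' i h h') {t t' : ℕ} (hl : S.matching.level i t t')
    (hl' : S.matching.level i (t + 1) (t' + 1)) (he : (C.word i)[t]? = (C'.word i)[t']?) :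
    TipMatch h h' 1 t t' := by
  have := TipMatch.of_coherent hR.coherent hR.isMarking hR.isMarking' (fun A A' => hR.sol_eq)
    hl hl' (by rw [← he]; simp [Sites.matching])
  simpa [Sites.matching, CutData.leftProd_zero] using this

theorem tipMatch_A (hR : Replacement S C C' i h h') (hi : i = S.comp) {t : ℕ}
    (ht : t < S.A.length) : TipMatch h h' 1 t t := by
  subst hi
  refine hR.tipMatch_of_level ?_ ?_ (by rw [hR.replaces.src_A ht, hR.replaces.tgt_A ht])
  · simp only [Sites.matching, if_true]; exact Or.inl ⟨ht.le, by simp⟩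
  · simp only [Sites.matching, if_true]; exact Or.inl ⟨ht, by simp⟩

theorem tipMatch_B (hR : Replacement S C C' i h h') (hi : i = S.comp) {r : ℕ}
    (hr : r < S.B.length) :
    TipMatch h h' 1 (S.A.length + S.u₁.length + r) (S.A.length + S.v₁.length + r) := by
  subst hi
  refine hR.tipMatch_of_level ?_ ?_ (by rw [hR.replaces.src_B hr, hR.replaces.tgt_B hr])
  · simp only [Sites.matching, if_true]; exact Or.inr (Or.inl ⟨r, hr.le, rfl, rfl⟩)
  · simp only [Sites.matching, if_true]; exact Or.inr (Or.inl ⟨r + 1, hr, rfl, rfl⟩)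

theorem tipMatch_D (hR : Replacement S C C' i h h') (hi : i = S.comp) {r : ℕ}
    (hr : r < S.D.length) :
    TipMatch h h' 1 (S.src₂ + S.u₂.length + r) (S.tgt₂ + S.v₂.length + r) := by
  subst hi
  refine hR.tipMatch_of_level ?_ ?_ (by rw [hR.replaces.src_D hr, hR.replaces.tgt_D hr])
  · simp only [Sites.matching, if_true]; exact Or.inr (Or.inr ⟨r, hr.le, rfl, rfl⟩)
  · simp only [Sites.matching, if_true]; exact Or.inr (Or.inr ⟨r + 1, hr, rfl, rfl⟩)

theorem pair_slice (hR : Replacement S C C' i h h') {t t' : ℕ} (hs : S.matching.slice i t t')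
    (hw : C.IsWhite i t) :
    S.matching.slice i (C.pair i t) (C'.pair i t') :=
  hR.replaces.2.2.2.pair_same i t t' hs hw

theorem tipMatch_of_slice (hR : Replacement S C C' i h h') (hi : i = S.comp)
    (hm₁ : ∀ x ∈ S.m₁, TipMatch h h' 1 (S.A.length + x.1) (S.A.length + x.2))
    (hm₂ : ∀ x ∈ S.m₂, TipMatch h h' 1 (S.src₂ + x.1) (S.tgt₂ + x.2)) {t t' : ℕ}
    (hs : S.matching.slice i t t') : TipMatch h h' 1 t t' := by
  simp only [Sites.matching, if_pos hi] at hs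
  rcases hs with ⟨ht, rfl⟩ | ⟨x, hx, rfl, rfl⟩ | ⟨r, hr, rfl, rfl⟩ | ⟨x, hx, rfl, rfl⟩ |
    ⟨r, hr, rfl, rfl⟩
  · exact hR.tipMatch_A hi ht
  · exact hm₁ x hx
  · exact hR.tipMatch_B hi hr
  · exact hm₂ x hx
  · exact hR.tipMatch_D hi hr

theorem kirkTerm_eq_of_slice (hR : Replacement S C C' i h h') (hi : i = S.comp)
    (hm₁ : ∀ x ∈ S.m₁, TipMatch h h' 1 (S.A.length + x.1) (S.A.length + x.2))
    (hm₂ : ∀ x ∈ S.m₂, TipMatch h h' 1 (S.src₂ + x.1) (S.tgt₂ + x.2)) {t t' : ℕ}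
    (hs : S.matching.slice i t t') : kirkTerm h' t' = kirkTerm h t := by
  rw [(hR.tipMatch_of_slice hi hm₁ hm₂ hs).kirkTerm_eq fun hw =>
    hR.tipMatch_of_slice hi hm₁ hm₂ (hR.pair_slice hs hw), mapDomain_conj_one]

theorem kirkSim_of_ne (hR : Replacement S C C' i h h') (hi : i ≠ S.comp) : KirkSim i C C' := by
  refine KirkSim.of_markings hR.isMarking hR.isMarking' ?_
  have hword := hR.replaces.2.2.1 i hi
  have hm : ∀ t, TipMatch h h' 1 t t := fun t =>
    hR.tipMatch_of_level (by simp [Sites.matching, hi]) (by simp [Sites.matching, hi])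
      (by rw [hword])
  have : kirk h' = kirk h := by
    unfold kirk
    rw [← hword]
    refine Finset.sum_congr rfl fun t _ => ?_
    rw [(hm t).kirkTerm_eq fun hw => ?_, mapDomain_conj_one]
    have := hR.pair_slice (t := t) (t' := t) (by simp [Sites.matching, hi]) hw
    simp only [Sites.matching, if_neg hi] at this
    rw [← this]
    exact hm _
  rw [this]
  exact Sim.refl _

/-- The sums of the contributions at the two places determine whether the invariants agree. -/
theorem kirkSim_of_blocks (hR : Replacement S C C' i h h') (hi : i = S.comp)
    (hA : ∀ t < S.A.length, kirkTerm h' t = kirkTerm h t)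
    (hB : ∀ r < S.B.length, kirkTerm h' (S.A.length + S.v₁.length + r) =
      kirkTerm h (S.A.length + S.u₁.length + r))
    (hD : ∀ r < S.D.length, kirkTerm h' (S.tgt₂ + S.v₂.length + r) =
      kirkTerm h (S.src₂ + S.u₂.length + r))
    (hsum : (∑ r ∈ Finset.range S.v₁.length, kirkTerm h' (S.A.length + r) +
        ∑ r ∈ Finset.range S.v₂.length, kirkTerm h' (S.tgt₂ + r)).erase 1 =
      (∑ r ∈ Finset.range S.u₁.length, kirkTerm h (S.A.length + r) +
        ∑ r ∈ Finset.range S.u₂.length, kirkTerm h (S.src₂ + r)).erase 1) :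
    KirkSim i C C' := by
  refine KirkSim.of_markings hR.isMarking hR.isMarking' ?_
  have e1 : (C.word i).length =
      S.A.length + S.u₁.length + S.B.length + S.u₂.length + S.D.length := by
    rw [hi, hR.replaces.1]; simp [add_assoc]
  have e2 : (C'.word i).length =
      S.A.length + S.v₁.length + S.B.length + S.v₂.length + S.D.length := by
    rw [hi, hR.replaces.2.1]; simp [add_assoc]
  have hadd : ∀ ρ ρ' : ReducedFreeGroup (Idx i) →₀ ℤ,
      (ρ + ρ').erase 1 = ρ.erase 1 + ρ'.erase 1 := fun ρ ρ' => Finsupp.erase_add 1 ρ ρ'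
  have hfin : (kirk h').erase 1 = (kirk h).erase 1 := by
    unfold kirk
    rw [e1, e2, sum_range_blocks, sum_range_blocks]
    have h1 := Finset.sum_congr rfl fun t ht => hA t (Finset.mem_range.1 ht)
    have h2 := Finset.sum_congr rfl fun t ht => hB t (Finset.mem_range.1 ht)
    have h3 := Finset.sum_congr rfl fun t ht => hD t (Finset.mem_range.1 ht)
    simp only [Sites.src₂, Sites.tgt₂] at h3 hsum
    rw [h1, h2, h3]
    simp only [hadd] at hsum ⊢
    rw [add_right_comm _ (Finsupp.erase 1 (∑ t ∈ Finset.range S.B.length, _)),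
      add_assoc (Finsupp.erase 1 (∑ t ∈ Finset.range S.A.length, _)), hsum]
    abel
  rw [hfin]
  exact Sim.refl _

/-- End points outside the disks keep their terms as soon as matched end points inside do, because
partners are matched too; what remains is the balance of the two replaced blocks. -/
theorem kirkSim_of_tipMatch (hR : Replacement S C C' i h h') (hm₁ : i = S.comp →
      ∀ x ∈ S.m₁, TipMatch h h' 1 (S.A.length + x.1) (S.A.length + x.2))
    (hm₂ : i = S.comp → ∀ x ∈ S.m₂, TipMatch h h' 1 (S.src₂ + x.1) (S.tgt₂ + x.2))
    (hsum : i = S.comp →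
      (∀ x ∈ S.m₁, kirkTerm h' (S.A.length + x.2) = kirkTerm h (S.A.length + x.1)) →
      (∑ r ∈ Finset.range S.v₁.length, kirkTerm h' (S.A.length + r) +
        ∑ r ∈ Finset.range S.v₂.length, kirkTerm h' (S.tgt₂ + r)).erase 1 =
      (∑ r ∈ Finset.range S.u₁.length, kirkTerm h (S.A.length + r) +
        ∑ r ∈ Finset.range S.u₂.length, kirkTerm h (S.src₂ + r)).erase 1) :
    KirkSim i C C' := by
  by_cases hi : i = S.comp
  · have hs := fun t t' => hR.kirkTerm_eq_of_slice hi (hm₁ hi) (hm₂ hi) (t := t) (t' := t')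
    refine hR.kirkSim_of_blocks hi (fun t ht => hs _ _ ?_) (fun r hr => hs _ _ ?_)
      (fun r hr => hs _ _ ?_) (hsum hi fun x hx => hs _ _ ?_)
    all_goals simp only [Sites.matching, if_pos hi]
    · exact Or.inl ⟨ht, by simp⟩
    · exact Or.inr (Or.inr (Or.inl ⟨r, hr, rfl, rfl⟩))
    · exact Or.inr (Or.inr (Or.inr (Or.inr ⟨r, hr, rfl, rfl⟩)))
    · exact Or.inr (Or.inl ⟨x, hx, rfl, rfl⟩)
  · exact hR.kirkSim_of_ne hi

end Replacement

/-! ## Invariance under the moves in one disk -/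

section Single

variable {n : ℕ} {C C' : CutDiagram n} {i j : Fin n} {A u v D : List Slice} {m : List (ℕ × ℕ)}

theorem single_src (hr : (Sites.single j A u v m D).Replaces C C') (r : ℕ) {s : Slice}
    (hs : u[r]? = some s) : (C.word j)[A.length + r]? = some s := by
  rw [← hs]
  exact hr.src_u₁ (S := Sites.single j A u v m D) (List.getElem?_eq_some_iff.1 hs).1

theorem single_tgt (hr : (Sites.single j A u v m D).Replaces C C') (r : ℕ) {s : Slice}
    (hs : v[r]? = some s) : (C'.word j)[A.length + r]? = some s := by
  rw [← hs]
  exact hr.tgt_v₁ (S := Sites.single j A u v m D) (List.getElem?_eq_some_iff.1 hs).1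

theorem single_width (hr : (Sites.single j A u v m D).Replaces C C') :
    width (C.word j) A.length = width (C'.word j) A.length :=
  hr.width_A (S := Sites.single j A u v m D) le_rfl

/-- The relation between the widths before and after a slice. -/
theorem width_step (C : CutDiagram n) {t k : ℕ} {P : Piece} (h : (C.word j)[t]? = some ⟨k, P⟩) :
    k + P.bot ≤ width (C.word j) t ∧
      width (C.word j) (t + 1) + P.bot = width (C.word j) t + P.top := width_succ_ge h

theorem kirkTerm_eq_zero {h : C.Grp →* ReducedFreeGroup (Idx i)} {t k : ℕ} {P : Piece}
    (hs : (C.word i)[t]? = some ⟨k, P⟩) (h1 : P ≠ .birth .white) (h2 : P ≠ .death .white) :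
    kirkTerm h t = 0 := by
  rw [kirkTerm, if_neg]
  simp [isWhite_iff, hs, h1, h2]

/-- A replacement in one disk that matches the end points preserves the invariants. -/
theorem kirkSim_single (hr : (Sites.single j A u v m D).Replaces C C')
    (hw : width (C.word j) (A.length + u.length) = width (C'.word j) (A.length + v.length))
    (hm : ∀ {h : C.Grp →* ReducedFreeGroup (Idx j)} {h' : C'.Grp →* ReducedFreeGroup (Idx j)},
      Replacement (Sites.single j A u v m D) C C' j h h' →
        ∀ x ∈ m, TipMatch h h' 1 (A.length + x.1) (A.length + x.2))
    (hsum : ∀ {h : C.Grp →* ReducedFreeGroup (Idx j)} {h' : C'.Grp →* ReducedFreeGroup (Idx j)},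
      (∀ x ∈ m, kirkTerm h' (A.length + x.2) = kirkTerm h (A.length + x.1)) →
      (∑ r ∈ Finset.range v.length, kirkTerm h' (A.length + r)).erase 1 =
        (∑ r ∈ Finset.range u.length, kirkTerm h (A.length + r)).erase 1) (i : Fin n) :
    KirkSim i C C' := by
  have hR : Replacement (Sites.single j A u v m D) C C' i (basingHom C.outerBasing i)
      (basingHom C'.outerBasing i) :=
    ⟨hr, hw, by simpa [Sites.single, Sites.src₂, Sites.tgt₂] using hw,
      basingHom_reg _ i, basingHom_reg _ i⟩
  refine hR.kirkSim_of_tipMatch ?_ ?_ ?_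
  · rintro rfl
    exact hm hR
  · rintro - x hx
    simp [Sites.single] at hx
  · rintro rfl hx
    have := hsum hx
    simpa [Sites.single] using this

theorem kirkSim_single_of_no_white (hr : (Sites.single j A u v [] D).Replaces C C')
    (hw : width (C.word j) (A.length + u.length) = width (C'.word j) (A.length + v.length))
    (hu : ∀ s ∈ u, s.piece ≠ .birth .white ∧ s.piece ≠ .death .white)
    (hv : ∀ s ∈ v, s.piece ≠ .birth .white ∧ s.piece ≠ .death .white) (i : Fin n) :
    KirkSim i C C' := by
  refine kirkSim_single hr hw (by simp) (fun _ => ?_) i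
  rw [Finset.sum_eq_zero, Finset.sum_eq_zero]
  · intro r hr'
    have := List.getElem?_eq_getElem (Finset.mem_range.1 hr')
    have hm := hu _ (List.getElem_mem (Finset.mem_range.1 hr'))
    exact kirkTerm_eq_zero (single_src hr r this) hm.1 hm.2
  · intro r hr'
    have := List.getElem?_eq_getElem (Finset.mem_range.1 hr')
    have hm := hv _ (List.getElem_mem (Finset.mem_range.1 hr'))
    exact kirkTerm_eq_zero (single_tgt hr r this) hm.1 hm.2

/-- No `∘` lies in the supporting disk, so it suffices that the number of strands leaving it is
unchanged; the values outside are then handled by `Replacement.sol_eq`. -/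
theorem kirkSim_topological (hT : Topological u v)
    (hr : (Sites.single j A u v [] D).Replaces C C') (i : Fin n) : KirkSim i C C' := by
  have hw := single_width hr
  cases hT with
  | branch_pair k =>
    refine kirkSim_single_of_no_white hr ?_ (by simp) (by simp) i
    have h0 := width_step C' (single_tgt hr 0 rfl)
    have h1 := width_step C' (single_tgt hr 1 rfl)
    simp only [Piece.bot, Piece.top, List.length_cons, List.length_nil, add_zero, zero_add,
      add_assoc, Nat.reduceAdd] at *
    omega
  | circle k =>
    refine kirkSim_single_of_no_white hr ?_ (by simp) (by simp) i
    have h0 := width_step C' (single_tgt hr 0 rfl)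
    have h1 := width_step C' (single_tgt hr 1 rfl)
    simp only [Piece.bot, Piece.top, List.length_cons, List.length_nil, add_zero, zero_add,
      add_assoc, Nat.reduceAdd] at *
    omega
  | kink_right k b =>
    refine kirkSim_single_of_no_white hr ?_ (by simp) (by simp) i
    have h0 := width_step C' (single_tgt hr 0 rfl)
    have h1 := width_step C' (single_tgt hr 1 rfl)
    have h2 := width_step C' (single_tgt hr 2 rfl)
    simp only [Piece.bot, Piece.top, List.length_cons, List.length_nil, add_zero, zero_add,
      add_assoc, Nat.reduceAdd] at *
    omega
  | kink_left k b =>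
    refine kirkSim_single_of_no_white hr ?_ (by simp) (by simp) i
    have h0 := width_step C' (single_tgt hr 0 rfl)
    have h1 := width_step C' (single_tgt hr 1 rfl)
    have h2 := width_step C' (single_tgt hr 2 rfl)
    simp only [Piece.bot, Piece.top, List.length_cons, List.length_nil, add_zero, zero_add,
      add_assoc, Nat.reduceAdd] at *
    omega
  | branch_right k =>
    refine kirkSim_single_of_no_white hr ?_ (by simp) (by simp) i
    have h0 := width_step C' (single_tgt hr 0 rfl)
    have h1 := width_step C' (single_tgt hr 1 rfl)
    have h2 := width_step C (single_src hr 0 rfl)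
    simp only [Piece.bot, Piece.top, List.length_cons, List.length_nil, add_zero, zero_add,
      add_assoc, Nat.reduceAdd] at *
    omega
  | branch_left k =>
    refine kirkSim_single_of_no_white hr ?_ (by simp) (by simp) i
    have h0 := width_step C' (single_tgt hr 0 rfl)
    have h1 := width_step C' (single_tgt hr 1 rfl)
    have h2 := width_step C (single_src hr 0 rfl)
    simp only [Piece.bot, Piece.top, List.length_cons, List.length_nil, add_zero, zero_add,
      add_assoc, Nat.reduceAdd] at *
    omega
  | bigon k b =>
    refine kirkSim_single_of_no_white hr ?_ (by simp) (by simp) i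
    have h0 := width_step C' (single_tgt hr 0 rfl)
    have h1 := width_step C' (single_tgt hr 1 rfl)
    simp only [Piece.bot, Piece.top, List.length_cons, List.length_nil, add_zero, zero_add,
      add_assoc, Nat.reduceAdd] at *
    omega
  | triangle k a b c habc =>
    refine kirkSim_single_of_no_white hr ?_ (by simp) (by simp) i
    have h0 := width_step C' (single_tgt hr 0 rfl)
    have h1 := width_step C' (single_tgt hr 1 rfl)
    have h2 := width_step C' (single_tgt hr 2 rfl)
    have h3 := width_step C (single_src hr 0 rfl)
    have h4 := width_step C (single_src hr 1 rfl)
    have h5 := width_step C (single_src hr 2 rfl)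
    simp only [Piece.bot, Piece.top, List.length_cons, List.length_nil, add_zero, zero_add,
      add_assoc, Nat.reduceAdd] at *
    omega

theorem kirkSim_saddle (hS : Saddle C C') (i : Fin n) : KirkSim i C C' := by
  obtain ⟨j, A, D, k, hr, -⟩ := hS
  refine kirkSim_single_of_no_white hr ?_ (by simp) (by simp) i
  have hw := single_width hr
  have h0 := width_step C' (single_tgt hr 0 rfl)
  have h1 := width_step C' (single_tgt hr 1 rfl)
  simp only [Piece.bot, Piece.top, List.length_cons, List.length_nil, add_zero, zero_add,
    add_assoc, Nat.reduceAdd] at *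
  omega

/-- The disk contains one crossing and no `∘`. Both diagrams satisfy their own labeling rules, and
their markings are compared outside the disk. -/
theorem kirkSim_singularCrossing (hS : SingularCrossing C C') (i : Fin n) : KirkSim i C C' := by
  obtain ⟨j, A, D, k, b, X, Y, hr, -⟩ := hS
  refine kirkSim_single_of_no_white hr ?_ (by simp) (by simp) i
  have hw := single_width hr
  have h0 := width_step C' (single_tgt hr 0 rfl)
  have h1 := width_step C (single_src hr 0 rfl)
  simp only [Piece.bot, Piece.top, List.length_cons, List.length_nil, add_zero, zero_add] at *
  omega

/-- The two new `∘` lie in the same region and are paired, so their terms sit at `1` and disappear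
when that coefficient is erased. -/
theorem kirkSim_cusp (hS : Cusp C C') (i : Fin n) : KirkSim i C C' := by
  obtain ⟨j, A, D, k, hr, hp⟩ := hS
  have hs0 := single_src hr 0 rfl
  have ht0 := single_tgt hr 0 rfl
  have ht1 := single_tgt hr 1 rfl
  have ht2 := single_tgt hr 2 rfl
  refine kirkSim_single hr ?_ (by simp) (fun {h h'} _ => ?_) i
  · have hw := single_width hr
    have h0 := width_step C' ht0
    have h1 := width_step C' ht1
    have h2 := width_step C' ht2
    have h3 := width_step C hs0
    simp only [Piece.bot, Piece.top, List.length_cons, List.length_nil, add_zero, zero_add,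
      add_assoc, Nat.reduceAdd] at *
    omega
  · have e0 : tipPot h' (A.length + 0) = tipPot h' (A.length + 2) := by
      rw [tipPot, tipPot, tipReg_of_tip (.birth k ht0), tipReg_of_tip (.birth k ht2)]
      congr 1
      rw [reg_left ht0 le_rfl]
      exact reg_left ht1 le_rfl
    have hw0 : C'.IsWhite j (A.length + 0) := isWhite_iff.2 ⟨k, Or.inl ht0⟩
    have hw2 : C'.IsWhite j (A.length + 2) := isWhite_iff.2 ⟨k, Or.inl ht2⟩
    have hp0 : C'.pair j (A.length + 0) = A.length + 2 := hp
    have hp2 : C'.pair j (A.length + 2) = A.length + 0 := by rw [← hp0, hw0.pair_pair]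
    have k0 : (kirkTerm h' (A.length + 0)).erase 1 = 0 := by
      rw [kirkTerm, if_pos hw0, hp0, e0, mul_inv_cancel, posn_one, Finsupp.erase_single]
    have k2 : (kirkTerm h' (A.length + 2)).erase 1 = 0 := by
      rw [kirkTerm, if_pos hw2, hp2, e0, mul_inv_cancel, posn_one, Finsupp.erase_single]
    have k1 : kirkTerm h' (A.length + 1) = 0 := kirkTerm_eq_zero ht1 (by simp) (by simp)
    have k3 : kirkTerm h (A.length + 0) = 0 := kirkTerm_eq_zero hs0 (by simp) (by simp)
    simp only [add_zero] at k0 k3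
    simp only [List.length_cons, List.length_nil, Finset.sum_range_succ, Finset.sum_range_zero,
      zero_add, k1, k3, add_zero, Finsupp.erase_add, k0, k2]
    simp

end Single

/-! ### Isotopies -/

section Isotopies

variable {n : ℕ} {C C' : CutDiagram n} {j : Fin n}
  {h : C.Grp →* ReducedFreeGroup (Idx j)} {h' : C'.Grp →* ReducedFreeGroup (Idx j)}
  {t t' k k' : ℕ} {c : Color}

/-- An end point enters `kirk` only through its potential and its sign. This lemma and the next
three cover both directions of the incident strand before and after an isotopy, a sign being the
orientation for a `birth` and its negation for a `death`. -/
theorem tipMatch_birth_birth (hh : IsMarking j h) (hh' : IsMarking j h')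
    (hs : (C.word j)[t]? = some ⟨k, .birth c⟩) (hs' : (C'.word j)[t']? = some ⟨k', .birth c⟩)
    (hpot : C'.leftProd (fun A => h' (C'.meridian A)) j t' k' =
      C.leftProd (fun A => h (C.meridian A)) j t k)
    (hup : C.up j (t + 1) k = C'.up j (t' + 1) k') : TipMatch h h' 1 t t' := by
  cases c with
  | black => exact .of_not (by simp [isWhite_iff, hs]) (by simp [isWhite_iff, hs'])
  | white =>
    refine ⟨by simp [isWhite_iff, hs, hs'], fun _ => ?_, fun _ => ?_⟩
    · rw [hh.tipPot_birth hs, hh'.tipPot_birth hs', hpot, one_mul]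
    · rw [sign_birth hs, sign_birth hs', hup]

theorem tipMatch_birth_death (hh : IsMarking j h) (hh' : IsMarking j h')
    (hs : (C.word j)[t]? = some ⟨k, .birth c⟩) (hs' : (C'.word j)[t']? = some ⟨k', .death c⟩)
    (hpot : C'.leftProd (fun A => h' (C'.meridian A)) j t' k' =
      C.leftProd (fun A => h (C.meridian A)) j t k)
    (hup : C.up j (t + 1) k = !C'.up j t' k') : TipMatch h h' 1 t t' := by
  cases c with
  | black => exact .of_not (by simp [isWhite_iff, hs]) (by simp [isWhite_iff, hs'])
  | white =>
    refine ⟨by simp [isWhite_iff, hs, hs'], fun _ => ?_, fun _ => ?_⟩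
    · rw [hh.tipPot_birth hs, hh'.tipPot_death hs', hpot, one_mul]
    · rw [sign_birth hs, sign_death hs', hup]

theorem tipMatch_death_birth (hh : IsMarking j h) (hh' : IsMarking j h')
    (hs : (C.word j)[t]? = some ⟨k, .death c⟩) (hs' : (C'.word j)[t']? = some ⟨k', .birth c⟩)
    (hpot : C'.leftProd (fun A => h' (C'.meridian A)) j t' k' =
      C.leftProd (fun A => h (C.meridian A)) j t k)
    (hup : (!C.up j t k) = C'.up j (t' + 1) k') : TipMatch h h' 1 t t' := by
  cases c with
  | black => exact .of_not (by simp [isWhite_iff, hs]) (by simp [isWhite_iff, hs'])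
  | white =>
    refine ⟨by simp [isWhite_iff, hs, hs'], fun _ => ?_, fun _ => ?_⟩
    · rw [hh.tipPot_death hs, hh'.tipPot_birth hs', hpot, one_mul]
    · rw [sign_death hs, sign_birth hs', hup]

theorem tipMatch_death_death (hh : IsMarking j h) (hh' : IsMarking j h')
    (hs : (C.word j)[t]? = some ⟨k, .death c⟩) (hs' : (C'.word j)[t']? = some ⟨k', .death c⟩)
    (hpot : C'.leftProd (fun A => h' (C'.meridian A)) j t' k' =
      C.leftProd (fun A => h (C.meridian A)) j t k)
    (hup : C.up j t k = C'.up j t' k') : TipMatch h h' 1 t t' := by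
  cases c with
  | black => exact .of_not (by simp [isWhite_iff, hs]) (by simp [isWhite_iff, hs'])
  | white =>
    refine ⟨by simp [isWhite_iff, hs, hs'], fun _ => ?_, fun _ => ?_⟩
    · rw [hh.tipPot_death hs, hh'.tipPot_death hs', hpot, one_mul]
    · rw [sign_death hs, sign_death hs', hup]

variable {A u v D : List Slice} {m : List (ℕ × ℕ)}

theorem single_level_start :
    (Sites.single j A u v m D).matching.level j A.length A.length := by
  simp [Sites.matching, Sites.single]

theorem single_level_end : (Sites.single j A u v m D).matching.level j
    (A.length + u.length) (A.length + v.length) := by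
  simp only [Sites.matching, Sites.single, if_true]
  exact Or.inr (Or.inl ⟨0, le_rfl, rfl, rfl⟩)

/-- Only exchanges and rotations of end points can involve a `∘`; there its potential is compared
through a gap in the same region, and its sign through the orientation of its strand at a matched
level. -/
theorem kirkSim_isotopy (hI : Isotopy u v m) (hr : (Sites.single j A u v m D).Replaces C C')
    (i : Fin n) : KirkSim i C C' := by
  have hw := single_width hr
  cases hI with
  | exchange P Q k r =>
    have hs0 := single_src hr 0 rfl
    have hs1 := single_src hr 1 rfl
    have ht0 := single_tgt hr 0 rfl
    have ht1 := single_tgt hr 1 rfl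
    have w0 := width_step C hs0
    have w1 := width_step C hs1
    have w2 := width_step C' ht0
    have w3 := width_step C' ht1
    simp only [add_zero] at hs0 ht0 w0 w2
    simp only [add_assoc, Nat.reduceAdd] at w1 w3
    have hend : width (C.word j) (A.length + 2) = width (C'.word j) (A.length + 2) := by omega
    refine kirkSim_single hr hend (fun {h h'} hR => ?_) (fun {h h'} hx => ?_) i
    · have hh := hR.isMarking
      have hh' := hR.isMarking'
      have hl := fun {g : ℕ} => hR.leftProd_eq (g := g) single_level_start
      have hup := fun {p : ℕ} => hR.up_eq (p := p) single_level_start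
      have hup' := fun {p : ℕ} => hR.up_eq (t := A.length + 2) (t' := A.length + 2) (p := p)
        single_level_end
      intro x hx
      simp only [List.mem_cons, List.not_mem_nil, or_false] at hx
      rcases hx with rfl | rfl
      · have hpot : C'.leftProd (fun A => h' (C'.meridian A)) j (A.length + 1) k =
            C.leftProd (fun A => h (C.meridian A)) j A.length k := by
          rw [← leftProd_left ht0 (show k ≤ k + P.bot + r by omega), hl (by omega)]
        change TipMatch h h' 1 A.length (A.length + 1)
        cases P with
        | birth c =>
          have hb : (Piece.birth c).bot = 0 := rfl
          have ht : (Piece.birth c).top = 1 := rfl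
          refine tipMatch_birth_birth hh hh' hs0 ht1 hpot ?_
          rw [(C.strand_left j _ _ hs1 k (show k < k + 1 + r by omega)).1]
          exact hup' (by omega)
        | death c =>
          have hb : (Piece.death c).bot = 1 := rfl
          refine tipMatch_death_death hh hh' hs0 ht1 hpot ?_
          rw [← (C'.strand_left j _ _ ht0 k (show k < k + 1 + r by omega)).1]
          exact hup (by omega)
        | _ => exact .of_not (by simp [isWhite_iff, hs0]) (by simp [isWhite_iff, ht1])
      -- The right-hand piece has `P` on its left, either below or above the level considered; the
      -- potential does not change across a piece.
      · have hpot : C'.leftProd (fun A => h' (C'.meridian A)) j A.length (k + P.bot + r) =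
            C.leftProd (fun A => h (C.meridian A)) j (A.length + 1) (k + P.top + r) := by
          rw [hl (by omega)]
          exact hh.leftProd_right hs0 (show k + P.bot + r ≤ _ by omega)
        change TipMatch h h' 1 (A.length + 1) A.length
        cases Q with
        | birth c =>
          have hb : (Piece.birth c).bot = 0 := rfl
          have ht : (Piece.birth c).top = 1 := rfl
          refine tipMatch_birth_birth hh hh' hs1 ht0 hpot ?_
          rw [(C'.strand_right j _ _ ht1 r (show k + P.bot + r < _ by omega)).1]
          exact hup' (show k + P.top + r < _ by omega)
        | death c =>
          have hb : (Piece.death c).bot = 1 := rfl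
          refine tipMatch_death_death hh hh' hs1 ht0 hpot ?_
          rw [← (C.strand_right j _ _ hs0 r (show k + P.bot + r < _ by omega)).1]
          exact hup (show k + P.bot + r < _ by omega)
        | _ => exact .of_not (by simp [isWhite_iff, hs1]) (by simp [isWhite_iff, ht0])
    · have h0 := hx (0, 1) (by simp)
      have h1 := hx (1, 0) (by simp)
      simp only at h0 h1
      simp only [List.length_cons, List.length_nil, Finset.sum_range_succ, Finset.sum_range_zero,
        zero_add, h0, h1]
      rw [add_comm]
  | snake_right k =>
    refine kirkSim_single_of_no_white hr ?_ (by simp) (by simp) i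
    have h0 := width_step C' (single_tgt hr 0 rfl)
    have h1 := width_step C' (single_tgt hr 1 rfl)
    simp only [Piece.bot, Piece.top, List.length_cons, List.length_nil, add_zero, zero_add,
      add_assoc, Nat.reduceAdd] at *
    omega
  | snake_left k =>
    refine kirkSim_single_of_no_white hr ?_ (by simp) (by simp) i
    have h0 := width_step C' (single_tgt hr 0 rfl)
    have h1 := width_step C' (single_tgt hr 1 rfl)
    simp only [Piece.bot, Piece.top, List.length_cons, List.length_nil, add_zero, zero_add,
      add_assoc, Nat.reduceAdd] at *
    omega
  | slide_cap k b =>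
    refine kirkSim_single_of_no_white hr ?_ (by simp) (by simp) i
    have h0 := width_step C' (single_tgt hr 0 rfl)
    have h1 := width_step C' (single_tgt hr 1 rfl)
    have h2 := width_step C (single_src hr 0 rfl)
    have h3 := width_step C (single_src hr 1 rfl)
    simp only [Piece.bot, Piece.top, List.length_cons, List.length_nil, add_zero, zero_add,
      add_assoc, Nat.reduceAdd] at *
    omega
  | slide_cup k b =>
    refine kirkSim_single_of_no_white hr ?_ (by simp) (by simp) i
    have h0 := width_step C' (single_tgt hr 0 rfl)
    have h1 := width_step C' (single_tgt hr 1 rfl)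
    have h2 := width_step C (single_src hr 0 rfl)
    have h3 := width_step C (single_src hr 1 rfl)
    simp only [Piece.bot, Piece.top, List.length_cons, List.length_nil, add_zero, zero_add,
      add_assoc, Nat.reduceAdd] at *
    omega
  | birth_left k c =>
    have hs0 := single_src hr 0 rfl
    have ht0 := single_tgt hr 0 rfl
    have ht1 := single_tgt hr 1 rfl
    have w0 := width_step C hs0
    have w1 := width_step C' ht0
    have w2 := width_step C' ht1
    simp only [Piece.bot, Piece.top, add_zero, add_assoc, Nat.reduceAdd] at w0 w1 w2 hs0 ht0
    have hend : width (C.word j) (A.length + 1) = width (C'.word j) (A.length + 2) := by omega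
    refine kirkSim_single hr hend (fun {h h'} hR => ?_) (fun {h h'} hx => ?_) i
    · intro x hx
      simp only [List.mem_cons, List.not_mem_nil, or_false] at hx
      subst hx
      refine tipMatch_birth_death hR.isMarking hR.isMarking' hs0 ht1 ?_ ?_
      · rw [add_zero, ← leftProd_left ht0 (le_refl k), hR.leftProd_eq single_level_start (by omega)]
      · have h1 := (C'.piece_rule j _ _ ht0).1
        have h2 := (C'.strand_right j _ _ ht1 0 (show k + 1 + 0 < _ by omega)).1
        have h3 := hR.up_eq (t := A.length + 1) (t' := A.length + 2) (p := k) single_level_end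
          (by omega)
        simp only [Piece.bot, Piece.top, add_zero] at h2
        rw [add_zero, h3]
        change C'.up j (A.length + 1 + 1) k = _
        rw [← h2]
        revert h1
        cases C'.up j (A.length + 1) k <;> cases C'.up j (A.length + 1) (k + 1) <;> simp
    · have h0 := hx (0, 1) (by simp)
      have h1 : kirkTerm h' (A.length + 0) = 0 := kirkTerm_eq_zero ht0 (by simp) (by simp)
      simp only at h0
      simp only [List.length_cons, List.length_nil, Finset.sum_range_succ, Finset.sum_range_zero,
        zero_add, h0, h1]
  | birth_right k c =>
    have hs0 := single_src hr 0 rfl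
    have ht0 := single_tgt hr 0 rfl
    have ht1 := single_tgt hr 1 rfl
    have w0 := width_step C hs0
    have w1 := width_step C' ht0
    have w2 := width_step C' ht1
    simp only [Piece.bot, Piece.top, add_zero, add_assoc, Nat.reduceAdd] at w0 w1 w2 hs0 ht0
    have hend : width (C.word j) (A.length + 1) = width (C'.word j) (A.length + 2) := by omega
    refine kirkSim_single hr hend (fun {h h'} hR => ?_) (fun {h h'} hx => ?_) i
    · intro x hx
      simp only [List.mem_cons, List.not_mem_nil, or_false] at hx
      subst hx
      refine tipMatch_birth_death hR.isMarking hR.isMarking' hs0 ht1 ?_ ?_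
      -- After the rotation the end point lies on the other side of its strand; the gaps on both
      -- sides of the strand meet around the tip and have the same potential.
      · have h1 := hR.isMarking.leftProd_right (r := 0) hs0 (show k + 0 + 0 ≤ _ by omega)
        have h2 := hR.leftProd_eq (t := A.length + 1) (t' := A.length + 2) (g := k + 1)
          single_level_end (by omega)
        simp only [Piece.bot, Piece.top, add_zero] at h1
        rw [add_zero, h1, ← h2]
        exact leftProd_left ht1 le_rfl
      · have h1 := (C'.piece_rule j _ _ ht0).1
        have h2 := (C'.strand_left j _ _ ht1 k (Nat.lt_succ_self k)).1
        have h3 := hR.up_eq (t := A.length + 1) (t' := A.length + 2) (p := k) single_level_end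
          (by omega)
        rw [add_zero, h3]
        change C'.up j (A.length + 1 + 1) k = _
        rw [← h2]
        revert h1
        cases C'.up j (A.length + 1) k <;> cases C'.up j (A.length + 1) (k + 1) <;> simp
    · have h0 := hx (0, 1) (by simp)
      have h1 : kirkTerm h' (A.length + 0) = 0 := kirkTerm_eq_zero ht0 (by simp) (by simp)
      simp only at h0
      simp only [List.length_cons, List.length_nil, Finset.sum_range_succ, Finset.sum_range_zero,
        zero_add, h0, h1]
  | death_left k c =>
    have hs0 := single_src hr 0 rfl
    have ht0 := single_tgt hr 0 rfl
    have ht1 := single_tgt hr 1 rfl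
    have w0 := width_step C hs0
    have w1 := width_step C' ht0
    have w2 := width_step C' ht1
    simp only [Piece.bot, Piece.top, add_zero, add_assoc, Nat.reduceAdd] at w0 w1 w2 hs0 ht0
    have hend : width (C.word j) (A.length + 1) = width (C'.word j) (A.length + 2) := by omega
    refine kirkSim_single hr hend (fun {h h'} hR => ?_) (fun {h h'} hx => ?_) i
    · intro x hx
      simp only [List.mem_cons, List.not_mem_nil, or_false] at hx
      subst hx
      refine tipMatch_death_birth hR.isMarking hR.isMarking' hs0 ht0 ?_ ?_
      · exact hR.leftProd_eq single_level_start (show k ≤ width (C.word j) A.length by omega)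
      · have h1 := (C'.piece_rule j _ _ ht1).1
        have h2 := (C'.strand_right j _ _ ht0 0 (show k + 0 + 0 < _ by omega)).1
        have h3 := hR.up_eq (p := k) single_level_start (by omega)
        simp only [Piece.bot, Piece.top, add_zero] at h2
        rw [add_zero, h3, h2]
        revert h1
        cases C'.up j (A.length + 1) k <;> cases C'.up j (A.length + 1) (k + 1) <;> simp
    · have h0 := hx (0, 0) (by simp)
      have h1 : kirkTerm h' (A.length + 1) = 0 := kirkTerm_eq_zero ht1 (by simp) (by simp)
      simp only [add_zero] at h0
      simp only [List.length_cons, List.length_nil, Finset.sum_range_succ, Finset.sum_range_zero,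
        zero_add, h0, h1, add_zero]
  | death_right k c =>
    have hs0 := single_src hr 0 rfl
    have ht0 := single_tgt hr 0 rfl
    have ht1 := single_tgt hr 1 rfl
    have w0 := width_step C hs0
    have w1 := width_step C' ht0
    have w2 := width_step C' ht1
    simp only [Piece.bot, Piece.top, add_zero, add_assoc, Nat.reduceAdd] at w0 w1 w2 hs0 ht0
    have hend : width (C.word j) (A.length + 1) = width (C'.word j) (A.length + 2) := by omega
    refine kirkSim_single hr hend (fun {h h'} hR => ?_) (fun {h h'} hx => ?_) i
    · intro x hx
      simp only [List.mem_cons, List.not_mem_nil, or_false] at hx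
      subst hx
      refine tipMatch_death_birth hR.isMarking hR.isMarking' hs0 ht0 ?_ ?_
      · have h1 := hR.isMarking.leftProd_right (r := 0) hs0 (show k + 1 + 0 ≤ _ by omega)
        have h2 := hR.leftProd_eq (g := k + 1) single_level_start (by omega)
        simp only [Piece.bot, Piece.top, add_zero] at h1
        rw [add_zero, h2, h1]
        exact (leftProd_left hs0 le_rfl).symm
      · have h1 := (C'.piece_rule j _ _ ht1).1
        have h2 := (C'.strand_left j _ _ ht0 k (Nat.lt_succ_self k)).1
        have h3 := hR.up_eq (p := k) single_level_start (by omega)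
        rw [add_zero, h3, h2]
        revert h1
        cases C'.up j (A.length + 1) k <;> cases C'.up j (A.length + 1) (k + 1) <;> simp
    · have h0 := hx (0, 0) (by simp)
      have h1 : kirkTerm h' (A.length + 1) = 0 := kirkTerm_eq_zero ht1 (by simp) (by simp)
      simp only [add_zero] at h0
      simp only [List.length_cons, List.length_nil, Finset.sum_range_succ, Finset.sum_range_zero,
        zero_add, h0, h1, add_zero]

end Isotopies

/-! ## Invariance under the moves in two disks -/

section TwoDisks

variable {n : ℕ} {C C' : CutDiagram n}

theorem Sites.level_A (S : Sites n) {t : ℕ} (ht : t ≤ S.A.length) :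
    S.matching.level S.comp t t := by
  simp only [Sites.matching, if_true]
  exact Or.inl ⟨ht, trivial⟩

theorem Sites.level_B (S : Sites n) {r : ℕ} (hr : r ≤ S.B.length) :
    S.matching.level S.comp (S.A.length + S.u₁.length + r) (S.A.length + S.v₁.length + r) := by
  simp only [Sites.matching, if_true]
  exact Or.inr (Or.inl ⟨r, hr, rfl, rfl⟩)

theorem Sites.level_D (S : Sites n) {r : ℕ} (hr : r ≤ S.D.length) :
    S.matching.level S.comp (S.src₂ + S.u₂.length + r) (S.tgt₂ + S.v₂.length + r) := by
  simp only [Sites.matching, if_true]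
  exact Or.inr (Or.inr ⟨r, hr, rfl, rfl⟩)

/-! ### The finger move -/

/-- Two consecutive end points `∘` with opposite signs in the same region. -/
structure CancellingTips {i : Fin n} (h : C.Grp →* ReducedFreeGroup (Idx i)) (t : ℕ) : Prop where
  white₁ : C.IsWhite i t
  white₂ : C.IsWhite i (t + 1)
  tipPot_eq : tipPot h t = tipPot h (t + 1)
  sign_eq : C.sign i (t + 1) = -C.sign i t

variable {i : Fin n} {h : C.Grp →* ReducedFreeGroup (Idx i)}

/-- The two ends face each other in one region, and the strand keeps its orientation across the cut,
so one end is oriented outwards and the other inwards. -/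
theorem CancellingTips.of_cut (hh : IsMarking i h) {t k : ℕ}
    (h0 : (C.word i)[t]? = some ⟨k, .death .white⟩)
    (h1 : (C.word i)[t + 1]? = some ⟨k, .birth .white⟩) (hup : C.up i t k = C.up i (t + 2) k) :
    CancellingTips h t where
  white₁ := isWhite_iff.2 ⟨k, Or.inr h0⟩
  white₂ := isWhite_iff.2 ⟨k, Or.inl h1⟩
  tipPot_eq := by
    rw [hh.tipPot_death h0, hh.tipPot_birth h1]
    exact leftProd_left h0 le_rfl
  sign_eq := by
    rw [sign_death h0, sign_birth h1, hup]
    change (if C.up i (t + 2) k = true then (1 : ℤ) else -1) = _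
    cases C.up i (t + 2) k <;> simp

theorem CancellingTips.of_arc (hh : IsMarking i h) {t k : ℕ}
    (h0 : (C.word i)[t]? = some ⟨k, .birth .white⟩)
    (h1 : (C.word i)[t + 1]? = some ⟨k, .death .white⟩) : CancellingTips h t where
  white₁ := isWhite_iff.2 ⟨k, Or.inl h0⟩
  white₂ := isWhite_iff.2 ⟨k, Or.inr h1⟩
  tipPot_eq := by
    rw [hh.tipPot_birth h0, hh.tipPot_death h1]
    exact leftProd_left h0 le_rfl
  sign_eq := by
    rw [sign_birth h0, sign_death h1]
    cases C.up i (t + 1) k <;> simp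

/-- The partners of the two points have equal potentials as well, whichever way they are matched, so
the two terms sit at the same element with opposite signs. -/
theorem CancellingTips.kirkTerm_add {a b : ℕ} (ha : CancellingTips h a) (hb : CancellingTips h b)
    (h0 : C.pair i a = b ∨ C.pair i a = b + 1)
    (h1 : C.pair i (a + 1) = b ∨ C.pair i (a + 1) = b + 1) :
    kirkTerm h a + kirkTerm h (a + 1) = 0 := by
  have e0 : tipPot h (C.pair i a) = tipPot h b := by
    rcases h0 with e | e <;> rw [e]
    exact hb.tipPot_eq.symm
  have e1 : tipPot h (C.pair i (a + 1)) = tipPot h b := by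
    rcases h1 with e | e <;> rw [e]
    exact hb.tipPot_eq.symm
  rw [kirkTerm, kirkTerm, if_pos ha.white₁, if_pos ha.white₂, e0, e1, ← ha.tipPot_eq, ha.sign_eq,
    ← Finsupp.single_add, add_neg_cancel, Finsupp.single_zero]

theorem CancellingTips.kirkTerm_add_add {a b : ℕ} (ha : CancellingTips h a)
    (hb : CancellingTips h b)
    (hp : ({C.pair i a, C.pair i (a + 1)} : Set ℕ) = {b, b + 1}) :
    kirkTerm h a + kirkTerm h (a + 1) + (kirkTerm h b + kirkTerm h (b + 1)) = 0 := by
  have m0 : C.pair i a ∈ ({b, b + 1} : Set ℕ) := hp ▸ Or.inl rfl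
  have m1 : C.pair i (a + 1) ∈ ({b, b + 1} : Set ℕ) := hp ▸ Or.inr rfl
  have n0 : b ∈ ({C.pair i a, C.pair i (a + 1)} : Set ℕ) := hp ▸ Or.inl rfl
  have n1 : b + 1 ∈ ({C.pair i a, C.pair i (a + 1)} : Set ℕ) := hp ▸ Or.inr rfl
  have key : ∀ c, c ∈ ({C.pair i a, C.pair i (a + 1)} : Set ℕ) →
      C.pair i c = a ∨ C.pair i c = a + 1 := by
    rintro c (rfl | rfl)
    · exact Or.inl ha.white₁.pair_pair
    · exact Or.inr ha.white₂.pair_pair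
  rw [ha.kirkTerm_add hb m0 m1, hb.kirkTerm_add ha (key _ n0) (key _ n1), add_zero]

/-- Both new couples, the ends of the cut and the ends of the new arc, are cancelling, and each is
paired with the other; so the added terms sum to zero. -/
theorem kirkSim_finger (hF : Finger C C') (i : Fin n) : KirkSim i C C' := by
  obtain ⟨S, k, l, hr, hm₁, hm₂, hu₁, hu₂, hv, hp⟩ := hF
  have hw0 := hr.width_A le_rfl
  have hwv : ∀ {a k : ℕ} {P Q : Piece}, (C'.word S.comp)[a]? = some ⟨k, P⟩ →
      (C'.word S.comp)[a + 1]? = some ⟨k, Q⟩ → P.bot = Q.top → P.top = Q.bot →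
      width (C'.word S.comp) (a + 2) = width (C'.word S.comp) a := by
    intro a k P Q h0 h1 e1 e2
    have w0 := width_step C' h0
    have w1 := width_step C' h1
    simp only [add_assoc, Nat.reduceAdd] at w0 w1
    omega
  have ht1 : ∀ {P Q : Slice}, S.v₁ = [P, Q] → (C'.word S.comp)[S.A.length]? = some P ∧
      (C'.word S.comp)[S.A.length + 1]? = some Q := by
    intro P Q e
    have h0 := hr.tgt_v₁ (r := 0) (by simp [e])
    have h1 := hr.tgt_v₁ (r := 1) (by simp [e])
    rw [e] at h0 h1
    exact ⟨h0, h1⟩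
  have ht2 : ∀ {P Q : Slice}, S.v₂ = [P, Q] → (C'.word S.comp)[S.tgt₂]? = some P ∧
      (C'.word S.comp)[S.tgt₂ + 1]? = some Q := by
    intro P Q e
    have h0 := hr.tgt_v₂ (r := 0) (by simp [e])
    have h1 := hr.tgt_v₂ (r := 1) (by simp [e])
    rw [e] at h0 h1
    exact ⟨h0, h1⟩
  have hl₁ : S.v₁.length = 2 := by rcases hv with hv | hv <;> rw [hv.1] <;> rfl
  have hl₂ : S.v₂.length = 2 := by rcases hv with hv | hv <;> rw [hv.2.1] <;> rfl
  have hw1 : width (C.word S.comp) (S.A.length + S.u₁.length) =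
      width (C'.word S.comp) (S.A.length + S.v₁.length) := by
    rw [hu₁, hl₁, List.length_nil, add_zero, hw0]
    rcases hv with hv | hv
    · exact (hwv (ht1 hv.1).1 (ht1 hv.1).2 rfl rfl).symm
    · exact (hwv (ht1 hv.1).1 (ht1 hv.1).2 rfl rfl).symm
  have hwB := hr.width_B hw1 le_rfl
  have hw2 : width (C.word S.comp) (S.src₂ + S.u₂.length) =
      width (C'.word S.comp) (S.tgt₂ + S.v₂.length) := by
    rw [hu₂, hl₂, List.length_nil, add_zero]
    refine hwB.trans ?_
    rcases hv with hv | hv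
    · exact (hwv (ht2 hv.2.1).1 (ht2 hv.2.1).2 rfl rfl).symm
    · exact (hwv (ht2 hv.2.1).1 (ht2 hv.2.1).2 rfl rfl).symm
  have hR : Replacement S C C' i (basingHom C.outerBasing i) (basingHom C'.outerBasing i) :=
    ⟨hr, hw1, hw2, basingHom_reg _ i, basingHom_reg _ i⟩
  refine hR.kirkSim_of_tipMatch (by simp [hm₁]) (by simp [hm₂]) ?_
  rintro rfl -
  have hsum : CancellingTips (basingHom C'.outerBasing S.comp) S.A.length ∧
      CancellingTips (basingHom C'.outerBasing S.comp) S.tgt₂ := by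
    rcases hv with ⟨e1, e2, -⟩ | ⟨e1, e2, -⟩
    · refine ⟨.of_cut hR.isMarking' (ht1 e1).1 (ht1 e1).2 ?_,
        .of_arc hR.isMarking' (ht2 e2).1 (ht2 e2).2⟩
      have hk := (width_step C' (ht1 e1).1).1
      -- Since `S.u₁` is empty, one source level is matched with the levels just below and just
      -- above the cut; this gives the equality of the two orientations.
      have l0 := S.level_A le_rfl
      have l1 := S.level_B (Nat.zero_le _)
      rw [hu₁, hl₁] at l1
      rw [← hR.up_eq l0 (by rw [hw0]; exact hk)]
      exact hR.up_eq l1 (by rw [hw0]; exact hk)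
    · refine ⟨.of_arc hR.isMarking' (ht1 e1).1 (ht1 e1).2,
        .of_cut hR.isMarking' (ht2 e2).1 (ht2 e2).2 ?_⟩
      have hk := (width_step C' (ht2 e2).1).1
      have l0 : S.matching.level S.comp S.src₂ S.tgt₂ := S.level_B le_rfl
      have l1 := S.level_D (Nat.zero_le _)
      rw [hu₂, hl₂] at l1
      have hk' : k < width (C.word S.comp) S.src₂ := by rw [hR.width_eq l0]; exact hk
      rw [← hR.up_eq l0 hk']
      exact hR.up_eq l1 hk'
  have := hsum.1.kirkTerm_add_add hsum.2 hp
  rw [hu₁, hu₂, hl₁, hl₂]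
  simp only [List.length_nil, Finset.sum_range_succ, Finset.sum_range_zero, zero_add, add_zero,
    this]

/-! ### Simultaneous passage of two end points -/

/-- An end point `∘` that passes from the left to the right of a strand. -/
structure PassingTip {i : Fin n} (h : C.Grp →* ReducedFreeGroup (Idx i))
    (h' : C'.Grp →* ReducedFreeGroup (Idx i)) (t t' k : ℕ) : Prop where
  white : C.IsWhite i t
  white' : C'.IsWhite i t'
  lt : k < width (C.word i) t
  tipPot_eq : tipPot h' t' = tipPot h t * C'.crossVal (fun A => h' (C'.meridian A)) i t' k
  sign_eq : C'.sign i t' = C.sign i t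

variable {S : Sites n} {h : C.Grp →* ReducedFreeGroup (Idx S.comp)}
  {h' : C'.Grp →* ReducedFreeGroup (Idx S.comp)} {t t' k : ℕ}

theorem PassingTip.of_retract (hR : Replacement S C C' S.comp h h')
    (hl : S.matching.level S.comp t t') (hl' : S.matching.level S.comp (t + 2) (t' + 1))
    (hs0 : (C.word S.comp)[t]? = some ⟨k, .birth .white⟩)
    (hs1 : (C.word S.comp)[t + 1]? = some ⟨k, .cross false⟩)
    (ht0 : (C'.word S.comp)[t']? = some ⟨k + 1, .birth .white⟩) : PassingTip h h' t t' k := by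
  have w0 := width_step C hs0
  have w1 := width_step C hs1
  simp only [Piece.bot, Piece.top, add_assoc, Nat.reduceAdd] at w0 w1
  refine ⟨isWhite_iff.2 ⟨_, Or.inl hs0⟩, isWhite_iff.2 ⟨_, Or.inl ht0⟩, by omega, ?_, ?_⟩
  · rw [hR.isMarking'.tipPot_birth ht0, hR.isMarking.tipPot_birth hs0, CutData.leftProd_succ,
      hR.leftProd_eq hl (by omega)]
  · have h1 := (C.piece_rule S.comp _ _ hs1).2.1
    change C.up S.comp (t + 1) k = C.up S.comp (t + 2) (k + 1) at h1
    rw [sign_birth hs0, sign_birth ht0, h1, hR.up_eq hl' (by omega)]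

theorem PassingTip.of_extend (hR : Replacement S C C' S.comp h h')
    (hl : S.matching.level S.comp t t') (hl' : S.matching.level S.comp (t + 1) (t' + 2))
    (hs0 : (C.word S.comp)[t]? = some ⟨k, .birth .white⟩)
    (ht0 : (C'.word S.comp)[t']? = some ⟨k + 1, .birth .white⟩)
    (ht1 : (C'.word S.comp)[t' + 1]? = some ⟨k, .cross true⟩) : PassingTip h h' t t' k := by
  have w0 := width_step C hs0
  have w1 := width_step C' ht0
  have w2 := hR.width_eq hl
  simp only [Piece.bot, Piece.top] at w0 w1
  refine ⟨isWhite_iff.2 ⟨_, Or.inl hs0⟩, isWhite_iff.2 ⟨_, Or.inl ht0⟩, by omega, ?_, ?_⟩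
  · rw [hR.isMarking'.tipPot_birth ht0, hR.isMarking.tipPot_birth hs0, CutData.leftProd_succ,
      hR.leftProd_eq hl (by omega)]
  · have h1 := (C'.piece_rule S.comp _ _ ht1).2.1
    change C'.up S.comp (t' + 1) (k + 1) = C'.up S.comp (t' + 2) k at h1
    rw [sign_birth hs0, sign_birth ht0, h1, hR.up_eq hl' (by omega)]

/-- If both potentials acquire the same right factor, their quotient is unchanged. -/
theorem PassingTip.kirkTerm_eq {s s' k₂ : ℕ} (h₁ : PassingTip h h' t t' k)
    (h₂ : PassingTip h h' s s' k₂) (hp : C.pair S.comp t = s) (hp' : C'.pair S.comp t' = s')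
    (hc : C'.crossVal (fun A => h' (C'.meridian A)) S.comp t' k =
      C'.crossVal (fun A => h' (C'.meridian A)) S.comp s' k₂) :
    kirkTerm h' t' = kirkTerm h t := by
  rw [kirkTerm, kirkTerm, if_pos h₁.white, if_pos h₁.white', hp, hp', h₁.tipPot_eq, h₂.tipPot_eq,
    hc, h₁.sign_eq]
  congr 2
  group

/-- A replacement in which one pair of `∘` passes strands with the same value. -/
theorem Replacement.kirkSim_of_passingTip (hR : Replacement S C C' S.comp h h')
    (hm₁ : S.m₁ = [(0, 0)]) (hm₂ : S.m₂ = [(0, 0)]) {k₁ k₂ : ℕ} (hu₁ : 0 < S.u₁.length)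
    (hu₂ : 0 < S.u₂.length) (h₁ : PassingTip h h' S.A.length S.A.length k₁)
    (h₂ : PassingTip h h' S.src₂ S.tgt₂ k₂) (hp : C.pair S.comp S.A.length = S.src₂)
    (hc : C'.crossVal (fun A => h' (C'.meridian A)) S.comp S.A.length k₁ =
      C'.crossVal (fun A => h' (C'.meridian A)) S.comp S.tgt₂ k₂)
    (hsum : ∑ r ∈ Finset.range S.v₁.length, kirkTerm h' (S.A.length + r) =
        kirkTerm h' S.A.length ∧
      ∑ r ∈ Finset.range S.v₂.length, kirkTerm h' (S.tgt₂ + r) = kirkTerm h' S.tgt₂ ∧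
      ∑ r ∈ Finset.range S.u₁.length, kirkTerm h (S.A.length + r) = kirkTerm h S.A.length ∧
      ∑ r ∈ Finset.range S.u₂.length, kirkTerm h (S.src₂ + r) = kirkTerm h S.src₂) :
    KirkSim S.comp C C' := by
  -- The partner is the unique slice matched with `S.src₂`: all other alternatives of the matching
  -- place it outside the second disk or in the first one.
  have hp' : C'.pair S.comp S.A.length = S.tgt₂ := by
    have hs : S.matching.slice S.comp S.A.length S.A.length := by
      simp only [Sites.matching, if_true]
      exact Or.inr (Or.inl ⟨(0, 0), by simp [hm₁], rfl, rfl⟩)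
    have := hR.pair_slice hs h₁.white
    rw [hp] at this
    simp only [Sites.matching, if_true, hm₁, hm₂, List.mem_singleton] at this
    have e : S.src₂ = S.A.length + S.u₁.length + S.B.length := rfl
    rcases this with ⟨ht, -⟩ | ⟨x, rfl, ht, -⟩ | ⟨r, hr, ht, -⟩ | ⟨x, rfl, -, ht⟩ | ⟨r, hr, ht, -⟩
    · omega
    · omega
    · omega
    · exact ht
    · omega
  have hq : C.pair S.comp S.src₂ = S.A.length := by rw [← hp, h₁.white.pair_pair]
  have hq' : C'.pair S.comp S.tgt₂ = S.A.length := by rw [← hp', h₁.white'.pair_pair]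
  have htm : ∀ t t', S.matching.slice S.comp t t' → t ≠ S.A.length → t ≠ S.src₂ →
      TipMatch h h' 1 t t' := by
    intro t t' hs h1 h2
    simp only [Sites.matching, if_true, hm₁, hm₂, List.mem_singleton] at hs
    rcases hs with ⟨ht, rfl⟩ | ⟨x, rfl, rfl, rfl⟩ | ⟨r, hr, rfl, rfl⟩ | ⟨x, rfl, rfl, rfl⟩ |
      ⟨r, hr, rfl, rfl⟩
    · exact hR.tipMatch_A rfl ht
    · exact absurd rfl h1
    · exact hR.tipMatch_B rfl hr
    · exact absurd rfl h2
    · exact hR.tipMatch_D rfl hr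
  -- The passing points are partners of each other, so a pair with a point elsewhere has both its
  -- points elsewhere, and all potentials involved are preserved.
  have hout : ∀ t t', S.matching.slice S.comp t t' → t ≠ S.A.length → t ≠ S.src₂ →
      kirkTerm h' t' = kirkTerm h t := by
    intro t t' hs h1 h2
    rw [(htm t t' hs h1 h2).kirkTerm_eq fun hw => ?_, mapDomain_conj_one]
    refine htm _ _ (hR.pair_slice hs hw) (fun e => h2 ?_) fun e => h1 ?_
    · rw [← hp, ← e, hw.pair_pair]
    · rw [← hq, ← e, hw.pair_pair]
  have e : S.src₂ = S.A.length + S.u₁.length + S.B.length := rfl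
  refine hR.kirkSim_of_blocks rfl (fun t ht => hout _ _ ?_ (by omega) (by omega))
    (fun r hr => hout _ _ ?_ (by omega) (by omega)) (fun r hr => hout _ _ ?_ (by omega) (by omega))
    ?_
  · simp only [Sites.matching, if_true]; exact Or.inl ⟨ht, trivial⟩
  · simp only [Sites.matching, if_true]; exact Or.inr (Or.inr (Or.inl ⟨r, hr, rfl, rfl⟩))
  · simp only [Sites.matching, if_true]
    exact Or.inr (Or.inr (Or.inr (Or.inr ⟨r, hr, rfl, rfl⟩)))
  · rw [hsum.1, hsum.2.1, hsum.2.2.1, hsum.2.2.2, h₁.kirkTerm_eq h₂ hp hp' hc,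
      h₂.kirkTerm_eq h₁ hq hq' hc.symm]

theorem sum_two_of_eq_zero {M : Type*} [AddCommMonoid M] {f : ℕ → M} {a : ℕ}
    (h : f (a + 1) = 0) : ∑ r ∈ Finset.range 2, f (a + r) = f a := by
  simp [Finset.sum_range_succ, h]

/-- The equal labels and orientations of the two strands give them equal crossing values, hence both
points of the pair acquire the same right factor; the two cases differ by which point comes first in
the word. -/
theorem kirkSim_singularPass (hP : SingularPass C C') (i : Fin n) : KirkSim i C C' := by
  obtain ⟨S, k, l, k₁, k₂, hr, hm₁, hm₂, hv, hp, hup, -, hlabel⟩ := hP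
  have s1 : ∀ {r : ℕ} {P : Slice}, S.u₁[r]? = some P →
      (C.word S.comp)[S.A.length + r]? = some P := fun e => by
    rw [hr.src_u₁ (List.getElem?_eq_some_iff.1 e).1, e]
  have s2 : ∀ {r : ℕ} {P : Slice}, S.u₂[r]? = some P →
      (C.word S.comp)[S.src₂ + r]? = some P := fun e => by
    rw [hr.src_u₂ (List.getElem?_eq_some_iff.1 e).1, e]
  have t1 : ∀ {r : ℕ} {P : Slice}, S.v₁[r]? = some P →
      (C'.word S.comp)[S.A.length + r]? = some P := fun e => by
    rw [hr.tgt_v₁ (List.getElem?_eq_some_iff.1 e).1, e]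
  have t2 : ∀ {r : ℕ} {P : Slice}, S.v₂[r]? = some P →
      (C'.word S.comp)[S.tgt₂ + r]? = some P := fun e => by
    rw [hr.tgt_v₂ (List.getElem?_eq_some_iff.1 e).1, e]
  have hw0 := hr.width_A le_rfl
  have retract : ∀ {a a' k : ℕ}, width (C.word S.comp) a = width (C'.word S.comp) a' →
      (C.word S.comp)[a + 0]? = some ⟨k, .birth .white⟩ →
      (C.word S.comp)[a + 1]? = some ⟨k, .cross false⟩ →
      (C'.word S.comp)[a' + 0]? = some ⟨k + 1, .birth .white⟩ →
      width (C.word S.comp) (a + 2) = width (C'.word S.comp) (a' + 1) := by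
    intro a a' k hw h0 h1 h2
    have w0 := width_step C h0
    have w1 := width_step C h1
    have w2 := width_step C' h2
    simp only [Piece.bot, Piece.top, add_zero, add_assoc, Nat.reduceAdd] at w0 w1 w2
    omega
  have extend : ∀ {a a' k : ℕ}, width (C.word S.comp) a = width (C'.word S.comp) a' →
      (C.word S.comp)[a + 0]? = some ⟨k, .birth .white⟩ →
      (C'.word S.comp)[a' + 0]? = some ⟨k + 1, .birth .white⟩ →
      (C'.word S.comp)[a' + 1]? = some ⟨k, .cross true⟩ →
      width (C.word S.comp) (a + 1) = width (C'.word S.comp) (a' + 2) := by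
    intro a a' k hw h0 h1 h2
    have w0 := width_step C h0
    have w1 := width_step C' h1
    have w2 := width_step C' h2
    simp only [Piece.bot, Piece.top, add_zero, add_assoc, Nat.reduceAdd] at w0 w1 w2
    omega
  have hw1 : width (C.word S.comp) (S.A.length + S.u₁.length) =
      width (C'.word S.comp) (S.A.length + S.v₁.length) := by
    rcases hv with ⟨e1, e2, -, -, -, -⟩ | ⟨e1, e2, -, -, -, -⟩
    · have := retract hw0 (s1 (r := 0) (by rw [e1]; rfl)) (s1 (r := 1) (by rw [e1]; rfl))
        (t1 (r := 0) (by rw [e2]; rfl))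
      rw [e1, e2]; exact this
    · have := extend hw0 (s1 (r := 0) (by rw [e1]; rfl)) (t1 (r := 0) (by rw [e2]; rfl))
        (t1 (r := 1) (by rw [e2]; rfl))
      rw [e1, e2]; exact this
  have hwB : width (C.word S.comp) S.src₂ = width (C'.word S.comp) S.tgt₂ := hr.width_B hw1 le_rfl
  have hw2 : width (C.word S.comp) (S.src₂ + S.u₂.length) =
      width (C'.word S.comp) (S.tgt₂ + S.v₂.length) := by
    rcases hv with ⟨-, -, e1, e2, -, -⟩ | ⟨-, -, e1, e2, -, -⟩
    · have := extend hwB (s2 (r := 0) (by rw [e1]; rfl)) (t2 (r := 0) (by rw [e2]; rfl))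
        (t2 (r := 1) (by rw [e2]; rfl))
      rw [e1, e2]; exact this
    · have := retract hwB (s2 (r := 0) (by rw [e1]; rfl)) (s2 (r := 1) (by rw [e1]; rfl))
        (t2 (r := 0) (by rw [e2]; rfl))
      rw [e1, e2]; exact this
  have hR : Replacement S C C' i (basingHom C.outerBasing i) (basingHom C'.outerBasing i) :=
    ⟨hr, hw1, hw2, basingHom_reg _ i, basingHom_reg _ i⟩
  by_cases hi : i = S.comp
  swap
  · exact hR.kirkSim_of_ne hi
  subst hi
  have l0 := S.level_A le_rfl
  have l1 := S.level_B (Nat.zero_le _)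
  have l2 : S.matching.level S.comp S.src₂ S.tgt₂ := S.level_B le_rfl
  have l3 := S.level_D (Nat.zero_le _)
  have key : PassingTip (basingHom C.outerBasing S.comp) (basingHom C'.outerBasing S.comp)
        S.A.length S.A.length k₁ ∧
      PassingTip (basingHom C.outerBasing S.comp) (basingHom C'.outerBasing S.comp)
        S.src₂ S.tgt₂ k₂ := by
    rcases hv with ⟨e1, e2, e3, e4, rfl, rfl⟩ | ⟨e1, e2, e3, e4, rfl, rfl⟩
    · rw [e1, e2] at l1
      rw [e3, e4] at l3
      exact ⟨.of_retract hR l0 l1 (s1 (r := 0) (by rw [e1]; rfl)) (s1 (r := 1) (by rw [e1]; rfl))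
          (t1 (r := 0) (by rw [e2]; rfl)),
        .of_extend hR l2 l3 (s2 (r := 0) (by rw [e3]; rfl)) (t2 (r := 0) (by rw [e4]; rfl))
          (t2 (r := 1) (by rw [e4]; rfl))⟩
    · rw [e1, e2] at l1
      rw [e3, e4] at l3
      exact ⟨.of_extend hR l0 l1 (s1 (r := 0) (by rw [e1]; rfl)) (t1 (r := 0) (by rw [e2]; rfl))
          (t1 (r := 1) (by rw [e2]; rfl)),
        .of_retract hR l2 l3 (s2 (r := 0) (by rw [e3]; rfl)) (s2 (r := 1) (by rw [e3]; rfl))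
          (t2 (r := 0) (by rw [e4]; rfl))⟩
  have hc : C'.SameStrand S.comp S.A.length k₁ S.tgt₂ k₂ :=
    ⟨by rw [← hR.up_eq l0 key.1.lt, hup, hR.up_eq l2 key.2.lt], hlabel⟩
  refine hR.kirkSim_of_passingTip hm₁ hm₂ ?_ ?_ key.1 key.2 hp (hc.crossVal_eq _) ?_
  · rcases hv with hv | hv <;> simp [hv.1]
  · rcases hv with hv | hv <;> simp [hv.2.2.1]
  · rcases hv with ⟨e1, e2, e3, e4, -, -⟩ | ⟨e1, e2, e3, e4, -, -⟩
    · rw [e1, e2, e3, e4]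
      refine ⟨by simp, sum_two_of_eq_zero ?_, sum_two_of_eq_zero ?_, by simp⟩
      · exact kirkTerm_eq_zero (t2 (r := 1) (by rw [e4]; rfl)) (by simp) (by simp)
      · exact kirkTerm_eq_zero (s1 (r := 1) (by rw [e1]; rfl)) (by simp) (by simp)
    · rw [e1, e2, e3, e4]
      refine ⟨sum_two_of_eq_zero ?_, by simp, by simp, sum_two_of_eq_zero ?_⟩
      · exact kirkTerm_eq_zero (t1 (r := 1) (by rw [e2]; rfl)) (by simp) (by simp)
      · exact kirkTerm_eq_zero (s2 (r := 1) (by rw [e3]; rfl)) (by simp) (by simp)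

end TwoDisks

/-! ## Invariance under the passage across the point at infinity -/

section Sweep

variable {n : ℕ} {C C' : CutDiagram n} {j : Fin n} {A B : List Slice}

theorem sweepWord_zero : (sweepWord A B)[0]? = some ⟨0, .cup⟩ := by simp [sweepWord]

theorem sweepWord_A {r : ℕ} (hr : r < A.length) :
    (sweepWord A B)[r + 1]? = (A[r]?).map fun s => ⟨s.pos + 1, s.piece⟩ := by
  have := getElem?_block (w := sweepWord A B) (P := [⟨0, .cup⟩]) (Q := shiftRight A)
    (R := [⟨0, .cap⟩, ⟨0, .cup⟩] ++ shiftRight B ++ [⟨0, .cap⟩]) (by simp [sweepWord])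
    (r := r) (by simpa [shiftRight] using hr)
  rw [add_comm]
  simpa [shiftRight] using this

theorem sweepWord_cap : (sweepWord A B)[A.length + 1]? = some ⟨0, .cap⟩ := by
  have := getElem?_block (w := sweepWord A B) (P := [⟨0, .cup⟩] ++ shiftRight A)
    (Q := [⟨0, .cap⟩, ⟨0, .cup⟩]) (R := shiftRight B ++ [⟨0, .cap⟩]) (by simp [sweepWord])
    (r := 0) (by simp)
  simpa [shiftRight] using this

theorem sweepWord_cup : (sweepWord A B)[A.length + 2]? = some ⟨0, .cup⟩ := by
  have := getElem?_block (w := sweepWord A B) (P := [⟨0, .cup⟩] ++ shiftRight A)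
    (Q := [⟨0, .cap⟩, ⟨0, .cup⟩]) (R := shiftRight B ++ [⟨0, .cap⟩]) (by simp [sweepWord])
    (r := 1) (by simp)
  simpa [shiftRight] using this

theorem sweepWord_B {r : ℕ} (hr : r < B.length) :
    (sweepWord A B)[A.length + r + 3]? = (B[r]?).map fun s => ⟨s.pos + 1, s.piece⟩ := by
  have := getElem?_block (w := sweepWord A B)
    (P := [⟨0, .cup⟩] ++ shiftRight A ++ [⟨0, .cap⟩, ⟨0, .cup⟩]) (Q := shiftRight B)
    (R := [⟨0, .cap⟩]) (by simp [sweepWord]) (r := r) (by simpa [shiftRight] using hr)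
  rw [add_right_comm]
  simpa [shiftRight] using this

theorem sweepWord_last : (sweepWord A B)[A.length + B.length + 3]? = some ⟨0, .cap⟩ := by
  have := getElem?_block (w := sweepWord A B)
    (P := [⟨0, .cup⟩] ++ shiftRight A ++ [⟨0, .cap⟩, ⟨0, .cup⟩] ++ shiftRight B) (Q := [⟨0, .cap⟩])
    (R := []) (by simp [sweepWord]) (r := 0) (by simp)
  rw [List.getElem?_cons_zero] at this
  rw [← this]
  congr 1
  simp [shiftRight]
  omega

theorem length_sweepWord : (sweepWord A B).length = 1 + A.length + 2 + B.length + 1 := by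
  simp [sweepWord, shiftRight]
  omega

/-- The slice of the second diagram that corresponds to a slice of the first one. -/
theorem sweep_slice (hw : C.word j = A ++ B) (hw' : C'.word j = sweepWord A B) {t t' : ℕ}
    (h : (t < A.length ∧ t' = t + 1) ∨ (A.length ≤ t ∧ t < A.length + B.length ∧ t' = t + 3)) :
    (C'.word j)[t']? = ((C.word j)[t]?).map fun s => ⟨s.pos + 1, s.piece⟩ := by
  rw [hw, hw']
  rcases h with ⟨ht, rfl⟩ | ⟨ht, ht', rfl⟩
  · rw [sweepWord_A ht, List.getElem?_append_left ht]
  · obtain ⟨r, rfl⟩ := Nat.exists_eq_add_of_le ht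
    rw [sweepWord_B (by omega), List.getElem?_append_right ht, Nat.add_sub_cancel_left]

/-- If the slices of two diagrams agree up to a shift, then the widths do. -/
theorem width_shift {a a' m c : ℕ} (hs : ∀ r < m, (C'.word j)[a' + r]? =
      ((C.word j)[a + r]?).map fun s => ⟨s.pos + 1, s.piece⟩) (hlt : a + m ≤ (C.word j).length)
    (h0 : width (C'.word j) a' = width (C.word j) a + c) :
    ∀ r ≤ m, width (C'.word j) (a' + r) = width (C.word j) (a + r) + c := by
  intro r hr
  induction r with
  | zero => exact h0
  | succ r ih =>
    have h1 := ih (by omega)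
    have e : (C.word j)[a + r]? = some (C.word j)[a + r] := List.getElem?_eq_getElem (by omega)
    have e' := hs r (by omega)
    rw [e, Option.map_some] at e'
    have w1 := width_step C (k := (C.word j)[a + r].pos) (P := (C.word j)[a + r].piece) e
    have w2 := width_step C' e'
    rw [← add_assoc, ← add_assoc]
    omega

/-- A strand on the left of a shifted part of the diagram. -/
theorem sameStrand_shift {a a' m : ℕ} (hs : ∀ r < m, (C'.word j)[a' + r]? =
      ((C.word j)[a + r]?).map fun s => ⟨s.pos + 1, s.piece⟩) (hlt : a + m ≤ (C.word j).length) :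
    ∀ r ≤ m, C'.SameStrand j a' 0 (a' + r) 0 := by
  intro r hr
  induction r with
  | zero => exact ⟨rfl, rfl⟩
  | succ r ih =>
    have h1 := ih (by omega)
    have e : (C.word j)[a + r]? = some (C.word j)[a + r] := List.getElem?_eq_getElem (by omega)
    have e' := hs r (by omega)
    rw [e, Option.map_some] at e'
    have h2 := C'.strand_left j _ _ e' 0 (Nat.succ_pos _)
    exact ⟨h1.1.trans h2.1, h1.2.trans h2.2⟩

theorem sweep_width (hw : C.word j = A ++ B) (hw' : C'.word j = sweepWord A B) {t t' : ℕ}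
    (h : (sweepMatching j A B).level j t t') :
    width (C'.word j) t' = width (C.word j) t + 2 := by
  have hlen : (C.word j).length = A.length + B.length := by rw [hw, List.length_append]
  have z0 : width (C'.word j) 0 = 0 := rfl
  have z1 : width (C.word j) 0 = 0 := rfl
  have s0 := width_step C' (hw' ▸ sweepWord_zero : (C'.word j)[0]? = _)
  have s1 := width_step C' (hw' ▸ sweepWord_cap : (C'.word j)[A.length + 1]? = _)
  have s2 := width_step C' (hw' ▸ sweepWord_cup : (C'.word j)[A.length + 2]? = _)
  simp only [Piece.bot, Piece.top, add_assoc, Nat.reduceAdd, zero_add] at s0 s1 s2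
  have hA : ∀ r ≤ A.length, width (C'.word j) (1 + r) = width (C.word j) (0 + r) + 2 := by
    refine width_shift (fun r hr => ?_) (by omega) (by omega)
    exact sweep_slice hw hw' (Or.inl ⟨by omega, by omega⟩)
  have hAA := hA A.length le_rfl
  rw [add_comm 1, zero_add] at hAA
  have hB : ∀ r ≤ B.length, width (C'.word j) (A.length + 3 + r) =
      width (C.word j) (A.length + r) + 2 := by
    refine width_shift (fun r hr => ?_) (by omega) (by omega)
    exact sweep_slice hw hw' (Or.inr ⟨by omega, by omega, by omega⟩)
  simp only [sweepMatching, if_true] at h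
  rcases h with ⟨ht, rfl⟩ | ⟨ht, ht', rfl⟩
  · have := hA t ht
    rwa [add_comm 1, zero_add] at this
  · obtain ⟨r, rfl⟩ := Nat.exists_eq_add_of_le ht
    have := hB r (by omega)
    rwa [add_right_comm] at this

/-- The new leftmost strand is interrupted by a cap and a cup at the height where the old strand was
pushed. Their right legs are two copies of that old strand, so the left legs agree in label and
orientation. -/
theorem sweep_strand (hw : C.word j = A ++ B) (hw' : C'.word j = sweepWord A B)
    (hpos : 0 < width (C.word j) A.length) (hM : (sweepMatching j A B).Agree C C') {t t' : ℕ}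
    (h : (sweepMatching j A B).level j t t') : C'.SameStrand j 1 0 t' 0 := by
  have hlen : (C.word j).length = A.length + B.length := by rw [hw, List.length_append]
  have hA : ∀ r ≤ A.length, C'.SameStrand j 1 0 (1 + r) 0 := by
    refine sameStrand_shift (C := C) (a := 0) (fun r hr => ?_) (by omega)
    exact sweep_slice hw hw' (Or.inl ⟨by omega, by omega⟩)
  have hB : ∀ r ≤ B.length, C'.SameStrand j (A.length + 3) 0 (A.length + 3 + r) 0 := by
    refine sameStrand_shift (C := C) (a := A.length) (fun r hr => ?_) (by omega)
    exact sweep_slice hw hw' (Or.inr ⟨by omega, by omega, by omega⟩)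
  have l1 : (sweepMatching j A B).level j A.length (A.length + 1) := by simp [sweepMatching]
  have l3 : (sweepMatching j A B).level j A.length (A.length + 3) := by simp [sweepMatching]
  have arc : ∀ {t'}, (sweepMatching j A B).level j A.length t' →
      (sweepMatching j A B).SameArc C C' j A.length 0 t' 1 := fun {t'} hl => by
    have := sweep_width hw hw' hl
    refine ⟨hl, by simp [sweepMatching], hpos, ?_⟩
    change 1 < width _ _
    omega
  have cap := C'.piece_rule j _ _ (hw' ▸ sweepWord_cap : (C'.word j)[A.length + 1]? = _)
  have cup := C'.piece_rule j _ _ (hw' ▸ sweepWord_cup : (C'.word j)[A.length + 2]? = _)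
  have hmid : C'.SameStrand j (A.length + 1) 0 (A.length + 3) 0 := by
    have hu := (hM.up_eq _ _ _ _ _ (arc l1)).symm.trans (hM.up_eq _ _ _ _ _ (arc l3))
    have hl := hM.label_tgt _ _ _ _ _ _ _ (arc l1) (arc l3)
    refine ⟨?_, cap.2.trans (hl.trans cup.2.symm)⟩
    have c1 : C'.up j (A.length + 1) 0 ≠ C'.up j (A.length + 1) 1 := cap.1
    have c2 : C'.up j (A.length + 3) 0 ≠ C'.up j (A.length + 3) 1 := cup.1
    rw [← hu] at c2
    revert c1 c2
    cases C'.up j (A.length + 1) 0 <;> cases C'.up j (A.length + 1) 1 <;>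
      cases C'.up j (A.length + 3) 0 <;> simp
  simp only [sweepMatching, if_true] at h
  rcases h with ⟨ht, rfl⟩ | ⟨ht, ht', rfl⟩
  · rw [add_comm]
    exact hA t ht
  · obtain ⟨r, rfl⟩ := Nat.exists_eq_add_of_le ht
    have h1 := hA A.length le_rfl
    have h3 := hB r (by omega)
    rw [add_comm 1] at h1
    rw [add_right_comm]
    exact ⟨h1.1.trans (hmid.1.trans h3.1), h1.2.trans (hmid.2.trans h3.2)⟩

theorem coherent_sweep (hw : C.word j = A ++ B) (hpos : 0 < width (C.word j) A.length)
    (hw' : C'.word j = sweepWord A B) (hne : ∀ j', j' ≠ j → C.word j' = C'.word j')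
    (hM : (sweepMatching j A B).Agree C C') : Coherent (sweepMatching j A B) C C' where
  agree := hM
  width_le j' t t' h := by
    by_cases hj : j' = j
    · subst hj
      rw [sweep_width hw hw' h]
      simp [sweepMatching]
    · simp only [sweepMatching, if_neg hj] at h ⊢
      rw [h, hne j' hj, add_zero]
  inserted j' t₁ t₁' t₂ t₂' h₁ h₂ p hp := by
    by_cases hj : j' = j
    · subst hj
      simp only [sweepMatching, if_true, Nat.lt_one_iff] at hp
      subst hp
      have s₁ := sweep_strand hw hw' hpos hM h₁
      have s₂ := sweep_strand hw hw' hpos hM h₂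
      exact ⟨s₁.1.symm.trans s₂.1, s₁.2.symm.trans s₂.2⟩
    · simp [sweepMatching, hj] at hp

/-- On the swept sphere every gap acquires the same strand on its left, so all potentials there
acquire one left factor `l`; on the other spheres `l = 1`. The sums therefore differ by conjugation
with `l`. -/
theorem kirkSim_sweep (hS : Sweep C C') (i : Fin n) : KirkSim i C C' := by
  obtain ⟨j, A, B, hw, hpos, hw', hne, hM⟩ := hS
  have hC := coherent_sweep hw hpos hw' hne hM
  let M := sweepMatching (n := n) j A B
  -- The old outer region lies to the right of the inserted strand, first visible after the new cup:
  -- on the swept sphere both the level and the gap are `1`, elsewhere `0`, and `M.shift` supplies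
  -- all these values.
  let b' : C'.Basing := ⟨fun j' => C'.reg j' (M.shift j') (M.shift j'), fun _ => rfl⟩
  have hh := isMarking_basingHom C.outerBasing i
  have hh' := isMarking_basingHom b' i
  have hl0 : ∀ j', M.level j' 0 (M.shift j') := fun j' => by
    by_cases hj : j' = j <;> simp [M, sweepMatching, hj]
  have hv : ∀ X X', M.SameRegion C C' X X' → basingHom C.outerBasing i (C.meridian X) =
      basingHom b' i (C'.meridian X') := fun X X' h =>
    hC.sol_eq (isReducedFamily_xgen i) (isSol_meridian.map _) (isSol_meridian.map _)
      (fun j' => ⟨0, _, hl0 j', basingHom_reg C.outerBasing i j', basingHom_reg b' i j'⟩) h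
  set l := C'.leftProd (fun A => basingHom b' i (C'.meridian A)) i (M.shift i) (M.shift i) with hl
  have hslice : ∀ {t t'}, t < (C.word i).length → M.slice i t t' →
      M.level i t t' ∧ M.level i (t + 1) (t' + 1) ∧
        (C'.word i)[t']? = ((C.word i)[t]?).map fun s => ⟨s.pos + M.shift i, s.piece⟩ := by
    intro t t' ht h
    by_cases hi : i = j
    · subst hi
      simp only [M, sweepMatching, if_true] at h ⊢
      exact ⟨by omega, by omega, sweep_slice hw hw' h⟩
    · simp only [M, sweepMatching, if_neg hi] at h ⊢
      subst h
      exact ⟨rfl, rfl, by rw [hne i hi]; simp⟩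
  have htm : ∀ {t t'}, t < (C.word i).length → M.slice i t t' →
      TipMatch (basingHom C.outerBasing i) (basingHom b' i) l t t' := by
    intro t t' ht h
    obtain ⟨h1, h2, h3⟩ := hslice ht h
    have := TipMatch.of_coherent hC hh hh' hv h1 h2 h3
    rwa [hC.leftProd_shift_eq _ h1 (hl0 i)] at this
  have hterm : ∀ t t', t < (C.word i).length → M.slice i t t' →
      kirkTerm (basingHom b' i) t' = (kirkTerm (basingHom C.outerBasing i) t).mapDomain
        (MulAut.conj l).toMonoidHom := fun t t' ht h =>
    (htm ht h).kirkTerm_eq fun hwt => htm hwt.pair.lt (hM.pair_same i t t' h hwt)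
  refine KirkSim.of_markings hh hh' (Sim.erase_one ⟨_, IsBasisConj.conj l, ?_⟩)
  unfold kirk
  rw [Finsupp.mapDomain_finsetSum]
  by_cases hi : i = j
  · subst hi
    have e : (C.word i).length = A.length + B.length := by rw [hw, List.length_append]
    have z : ∀ {t : ℕ} {k : ℕ} {P : Piece}, (sweepWord A B)[t]? = some ⟨k, P⟩ →
        P ≠ .birth .white → P ≠ .death .white → kirkTerm (basingHom b' i) t = 0 :=
      fun h => kirkTerm_eq_zero (by rw [hw', h])
    -- The four extra slices are cups and caps and contribute nothing; the other two blocks are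
    -- shifted copies of `A` and `B`.
    rw [hw', length_sweepWord, sum_range_blocks, e, Finset.sum_range_add]
    simp only [Finset.sum_range_succ, Finset.sum_range_zero, zero_add, add_zero]
    rw [z sweepWord_zero (by simp) (by simp), add_comm 1 A.length,
      z sweepWord_cap (by simp) (by simp), z sweepWord_cup (by simp) (by simp),
      show A.length + 1 + 2 + B.length = A.length + B.length + 3 by ring,
      z sweepWord_last (by simp) (by simp), add_zero, add_zero, add_zero, zero_add]
    congr 1
    · refine Finset.sum_congr rfl fun t ht => hterm _ _ ?_ ?_
      · have := Finset.mem_range.1 ht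
        omega
      · simp only [M, sweepMatching, if_true]
        exact Or.inl ⟨Finset.mem_range.1 ht, add_comm _ _⟩
    · refine Finset.sum_congr rfl fun t ht => hterm _ _ ?_ ?_
      · have := Finset.mem_range.1 ht
        omega
      · have := Finset.mem_range.1 ht
        simp only [M, sweepMatching, if_true]
        omega
  · rw [← hne i hi]
    refine Finset.sum_congr rfl fun t ht => hterm _ _ (Finset.mem_range.1 ht) ?_
    simp [M, sweepMatching, hi]

end Sweep

theorem kirkSim_of_move {n : ℕ} {C C' : CutDiagram n} (i : Fin n) (h : Move C C') :
    KirkSim i C C' := by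
  cases h with
  | isotopy j A u v m D hI hr => exact kirkSim_isotopy hI hr i
  | sweep h => exact kirkSim_sweep h i
  | topological j A u v D hT hr => exact kirkSim_topological hT hr i
  | saddle h => exact kirkSim_saddle h i
  | singular_crossing h => exact kirkSim_singularCrossing h i
  | singular_pass h => exact kirkSim_singularPass h i
  | finger h => exact kirkSim_finger h i
  | cusp h => exact kirkSim_cusp h i

end

end CutDiag

theorem mainTheorem4 {n : ℕ} (C C' : CutDiag.CutDiagram n)
    (hCC' : CutDiag.SelfSingularEquiv C C') (i : Fin n)
    (b : C.Basing) (b' : C'.Basing)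
    (a : CutDiag.CutDiagram.Paths b i) (a' : CutDiag.CutDiagram.Paths b' i) :
    Function.Bijective (CutDiag.CutDiagram.psi b i) ∧
    (∀ I : CutDiag.NRSeq (CutDiag.CutDiagram.Idx i),
      CutDiag.CutDiagram.kappa b i a I = CutDiag.CutDiagram.kappa b' i a' I) ∧
    CutDiag.CutDiagram.K b i a = CutDiag.CutDiagram.K b' i a' :=
  ⟨CutDiag.CutDiagram.psi_bijective b i,
    CutDiag.CutDiagram.kappa_eq_and_K_eq
      (CutDiag.CutDiagram.KirkSim.of_eqvGen (fun _ _ => CutDiag.kirkSim_of_move i) hCC' b b') a a'⟩
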